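/- **Theorem.** Let $2<\psi\le 3$ be an exponent for matrix multiplication, i.e. $m\times m$ matrices can be multiplied with $O(m^\psi)$ arithmetic operations. Consider programs with unit cost: each arithmetic operation ($+,-,\times,/$, remainder), comparison, or draw of a random integer costs $1$; bit sizes are ignored; a product of matrices costs the least number of arithmetic operations needed for it, where rectangular products are cut into square blocks. Let $L$ be an integral $\mathbb Z$-lattice of rank $n$ with Gram matrix $G\in M_n(\mathbb Z)$ (symmetric bilinear form $B$) and let $D=|\det G|\ge 2$. Write $\omega(D)$ for the number of primes dividing $D$, $\nu_p(D)$ for the exponent of $p$ in $D$, and $\Omega(D)=\sum_{p\mid D}\nu_p(D)$. Hanke's algorithm for a maximal overlattice takes $G$ and the factorization of $D$ as input and does the following (here $L^\#$ is the dual lattice, $(L^\#)_p\subseteq L^\#$ consists of the $x$ with $p^kx\in L$ for some $k$, and $L$ always denotes the current lattice). 1. *Saturation.* For each $p\mid D$: start with $m=\nu_p(D)$; while $m>1$, compute the dual lattice, replace $L$ by $L+p^{\lceil m/2\rceil}(L^\#)_p$ and $m$ by $\lceil m/2\rceil$. 2. *Bilinear-maximal lattice.* For each $p\mid D$: compute the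 symmetric bilinear form modulo $p$ induced by $pB$ on the $p$-part of $L^\#/L$, splitting off the radical by Gaussian elimination over $\mathbb F_p$; find a maximal totally isotropic subspace by repeatedly finding an isotropic vector $v$, completing it to a hyperbolic pair and passing to the orthogonal complement of the pair; lift the vectors $v$ so found to elements of $L^\#$ whose components at all primes $q\neq p$ vanish (by congruences modulo the prime powers in $D$), and adjoin these to $L$. For odd $p$, in dimension at least $3$, and in dimension $2$ if minus the determinant of the form is a square modulo $p$, an isotropic vector is found by taking random vectors $a,m$ and solving $Q(a+tm)=0$ for $t\in\mathbb F_p$, until this succeeds; for $p=2$ it is found among $e_1,e_2,e_1+e_2$ for two basis vectors $e_1,e_2$. 3. *Even $2$-neighbor.* If $B(x,x)$ is odd for some $x\in L$, let $L_0=\{x\in L: B(x,x)\in 2\mathbb Z\}$ and search for $w\in L_0\setminus 2L_0$ with $B(w,L_0)\subseteq 2\mathbb Z$ and $B(w,w)\in 8\mathbb Z$; replace $L$ by $L_0+\mathbb Z\frac w2$ if such a $w$ exists, and by $L_0$ if not. (If the given lattice is even, i.e. $B(x,x)\in2\mathbb Z$ for all $x$, the output is meant to be a maximal even overlattice of it.)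 The expected running time of this algorithm is $$O\Bigl(n^3\,\omega(D)+n^\psi\sum_{p\mid D}\log\nu_p(D)+n^2\,\Omega(D)+n\,\omega(D)\,\Omega(D)\log D\Bigr),$$ with an implied constant that depends only on $\psi$. -/

import Mathlib

open scoped ENNReal

namespace MaxLat

/-! ## Arithmetic complexity of matrix multiplication -/

/-- A gate of a straight-line program over `ℚ`; `i`, `j` are addresses of earlier values. -/
inductive Gate where
  | const (c : ℚ)
  | add (i j : ℕ)
  | sub (i j : ℕ)
  | mul (i j : ℕ)

def Gate.eval (mem : List ℚ) : Gate → ℚ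
  | .const c => c
  | .add i j => mem.getD i 0 + mem.getD j 0
  | .sub i j => mem.getD i 0 - mem.getD j 0
  | .mul i j => mem.getD i 0 * mem.getD j 0

/-- Every gate appends its value to the memory. -/
def runGates (gs : List Gate) (mem : List ℚ) : List ℚ :=
  gs.foldl (fun m g => m ++ [g.eval m]) mem

/-- The entries of a matrix, row by row. -/
def entries {n : ℕ} (A : Matrix (Fin n) (Fin n) ℚ) : List ℚ :=
  (List.ofFn fun i => List.ofFn fun j => A i j).flatten

/-- The straight-line program `gs` multiplies `n × n` matrices. -/
def MultipliesMatrices (n : ℕ) (gs : List Gate) : Prop :=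
  ∃ out : Fin n → Fin n → ℕ, ∀ A B : Matrix (Fin n) (Fin n) ℚ, ∀ i j,
    (runGates gs (entries A ++ entries B)).getD (out i j) 0 = (A * B) i j

/-- The least number of arithmetic operations that suffices to multiply two `n × n` matrices. -/
noncomputable def mmCost (n : ℕ) : ℕ :=
  sInf {l | ∃ gs : List Gate, gs.length = l ∧ MultipliesMatrices n gs}

/-- `ψ` is an exponent for matrix multiplication: `n × n` matrices can be multiplied
with `O(n ^ ψ)` arithmetic operations. -/
def IsMatMulExponent (ψ : ℝ) : Prop :=
  ∃ c : ℝ, ∀ n : ℕ, 1 ≤ n → (mmCost n : ℝ) ≤ c * (n : ℝ) ^ ψ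

/-- Cost of an `a × b` times `b × c` product, cut into square blocks of side `min a b c`
(each block product is followed by one block addition). -/
noncomputable def rectCost (a b c : ℕ) : ℕ :=
  let s := min a (min b c)
  (a ⌈/⌉ s) * (b ⌈/⌉ s) * (c ⌈/⌉ s) * (mmCost s + s ^ 2)

/-! ## The machine model: randomized arithmetic programs with unit-cost arithmetic -/

inductive Op where
  | add | sub | mul | div | mod

/-- `mod` is the remainder with floor rounding, on rational arguments. -/
def Op.eval : Op → ℚ → ℚ → ℚ
  | .add, x, y => x + y
  | .sub, x, y => x - y
  | .mul, x, y => x * y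
  | .div, x, y => x / y
  | .mod, x, y => x - y * (⌊x / y⌋ : ℚ)

/-- Randomized programs that return an element of `α`. Scalars live in an abstract type `V`,
so that a program polymorphic in `V` can do arithmetic on its data, and inspect them, only by
the instructions below:
constants, arithmetic operations, equality tests, entrywise operations on matrices,
matrix products, a uniformly random integer in `{0, …, N - 1}`, and the loop that runs
`body` with fresh randomness until it returns some `b`, and then goes on with `k b`. -/
inductive Prog (V : Type) : Type → Type 1 where
  | ret {α : Type} (a : α) : Prog V α
  | lit {α : Type} (q : ℚ) (k : V → Prog V α) : Prog V α
  | op {α : Type} (o : Op) (x y : V) (k : V → Prog V α) : Prog V α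
  | test {α : Type} (x y : V) (k : Bool → Prog V α) : Prog V α
  | zip {α ι κ : Type} [Fintype ι] [Fintype κ] (o : Op) (A B : Matrix ι κ V)
      (k : Matrix ι κ V → Prog V α) : Prog V α
  | mmul {α ι κ μ : Type} [Fintype ι] [Fintype κ] [Fintype μ]
      (A : Matrix ι κ V) (B : Matrix κ μ V) (k : Matrix ι μ V → Prog V α) : Prog V α
  | rand {α : Type} (N : ℕ) (k : V → Prog V α) : Prog V α
  | loop {α β : Type} (body : Prog V (Option β)) (k : β → Prog V α) : Prog V α

namespace Prog

def bind {V : Type} : {α β : Type} → Prog V α → (α → Prog V β) → Prog V β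
  | _, _, .ret a, f => f a
  | _, _, .lit q k, f => .lit q fun x => bind (k x) f
  | _, _, .op o x y k, f => .op o x y fun z => bind (k z) f
  | _, _, .test x y k, f => .test x y fun b => bind (k b) f
  | _, _, @Prog.zip _ _ _ _ _ _ o A B k, f => .zip o A B fun M => bind (k M) f
  | _, _, @Prog.mmul _ _ _ _ _ _ _ _ A B k, f => .mmul A B fun M => bind (k M) f
  | _, _, .rand N k, f => .rand N fun x => bind (k x) f
  | _, _, .loop body k, f => .loop body fun b => bind (k b) f

instance {V : Type} : Monad (Prog V) where
  pure := .ret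
  bind := .bind

/-- Expected running time of a program over `ℚ`, plus the expected value of `f` at its result.
Scalar instructions cost `1`, entrywise matrix operations one unit per entry, matrix products
`rectCost`, and each round of a loop one unit on top of its body. A loop is the
supremum over `j` of its truncations to `j` rounds, so a loop that fails to end
with positive probability has expected running time `∞`. -/
noncomputable def ert : {α : Type} → Prog ℚ α → (α → ℝ≥0∞) → ℝ≥0∞
  | _, .ret a, f => f a
  | _, .lit q k, f => 1 + ert (k q) f
  | _, .op o x y k, f => 1 + ert (k (o.eval x y)) f
  | _, .test x y k, f => 1 + ert (k (decide (x = y))) f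
  | _, @Prog.zip _ _ ι κ _ _ o A B k, f =>
      (Fintype.card ι * Fintype.card κ : ℕ) + ert (k fun i j => o.eval (A i j) (B i j)) f
  | _, @Prog.mmul _ _ ι κ μ _ _ _ A B k, f =>
      (rectCost (Fintype.card ι) (Fintype.card κ) (Fintype.card μ) : ℕ) + ert (k (A * B)) f
  | _, .rand N k, f => 1 + (∑ i ∈ Finset.range N, ert (k i) f) / N
  | _, .loop body k, f =>
      ⨆ j : ℕ, (fun X => 1 + ert body fun r => r.elim X fun b => ert (k b) f)^[j] 0

/-- Expected running time. -/
noncomputable def expectedTime {α : Type} (P : Prog ℚ α) : ℝ≥0∞ := P.ert fun _ => 0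

end Prog

/-! ### Abbreviations for single instructions -/

section Instructions

variable {V : Type}

def lit (q : ℚ) : Prog V V := .lit q .ret

def op (o : Op) (x y : V) : Prog V V := .op o x y .ret

/-- Is `x = y`? -/
def test (x y : V) : Prog V Bool := .test x y .ret

/-- Entrywise operation. -/
def zip {ι κ : Type} [Fintype ι] [Fintype κ] (o : Op) (A B : Matrix ι κ V) :
    Prog V (Matrix ι κ V) := .zip o A B .ret

/-- Entrywise operation with a fixed second argument. -/
def each {ι κ : Type} [Fintype ι] [Fintype κ] (o : Op) (A : Matrix ι κ V) (c : V) :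
    Prog V (Matrix ι κ V) := zip o A fun _ _ => c

def mmul {ι κ μ : Type} [Fintype ι] [Fintype κ] [Fintype μ]
    (A : Matrix ι κ V) (B : Matrix κ μ V) : Prog V (Matrix ι μ V) := .mmul A B .ret

def rand (N : ℕ) : Prog V V := .rand N .ret

/-- Repeat `body` until it succeeds. -/
def untilSome {β : Type} (body : Prog V (Option β)) : Prog V β := .loop body .ret

/-- First element of a list that passes a test. -/
def find {β : Type} (f : β → Prog V Bool) : List β → Prog V (Option β)
  | [] => pure none
  | b :: l => do if ← f b then pure (some b) else find f l

/-- `x ^ e` by repeated squaring, for a given multiplication. -/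
def power {β : Type} (mul : β → β → Prog V β) (one x : β) (e : ℕ) : Prog V β :=
  e.bits.foldrM (fun b acc => do
    let s ← mul acc acc
    if b then mul s x else pure s) one

def mulMod (N x y : V) : Prog V V := do
  let z ← op .mul x y
  op .mod z N

def subMod (N x y : V) : Prog V V := do
  let z ← op .sub x y
  op .mod z N

end Instructions

/-! ## Fast linear algebra -/

/-- An index type with `2 ^ d` elements, set up for recursive halving. -/
def I : ℕ → Type
  | 0 => Unit
  | d + 1 => I d ⊕ I d

instance instFintypeI : (d : ℕ) → Fintype (I d)
  | 0 => inferInstanceAs (Fintype Unit)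
  | d + 1 =>
    letI := instFintypeI d
    inferInstanceAs (Fintype (I d ⊕ I d))

/-- Position of an index. -/
def rank : (d : ℕ) → I d → ℕ
  | 0, _ => 0
  | d + 1, .inl a => rank d a
  | d + 1, .inr a => 2 ^ d + rank d a

/-- Inverse of `rank`. -/
def unrank : (d : ℕ) → ℕ → I d
  | 0, _ => ()
  | d + 1, i => if i < 2 ^ d then .inl (unrank d i) else .inr (unrank d (i - 2 ^ d))

section LinearAlgebra

variable {V : Type}

/-- Inverse of a positive definite matrix, by Schur complements. -/
def invPosDef : (d : ℕ) → Matrix (I d) (I d) V → Prog V (Matrix (I d) (I d) V)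
  | 0, P => do
    let one ← lit 1
    let x ← op .div one (P () ())
    pure fun _ _ => x
  | d + 1, (P : Matrix (I d ⊕ I d) (I d ⊕ I d) V) => do
    let zero ← lit 0
    let a ← invPosDef d P.toBlocks₁₁
    let x ← mmul a P.toBlocks₁₂
    let y ← mmul P.toBlocks₂₁ x
    let s ← zip .sub P.toBlocks₂₂ y
    let t ← invPosDef d s
    let xt ← mmul x t
    let xtx ← mmul xt x.transpose
    let a' ← zip .add a xtx
    let b' ← zip .sub (fun _ _ => zero) xt
    pure (Matrix.fromBlocks a' b' b'.transpose t : Matrix (I d ⊕ I d) (I d ⊕ I d) V)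

/-- Inverse of a nonsingular symmetric matrix `A`, as `(A * A)⁻¹ * A`; the positive definite
matrix `A * A` is first bordered by an identity matrix to have a power of `2` as its size. -/
def inverse {n : ℕ} (A : Matrix (Fin n) (Fin n) V) : Prog V (Matrix (Fin n) (Fin n) V) := do
  let zero ← lit 0
  let one ← lit 1
  let P ← mmul A A
  let d := Nat.clog 2 n
  let Q ← invPosDef d fun a b =>
    if h : rank d a < n ∧ rank d b < n then P ⟨rank d a, h.1⟩ ⟨rank d b, h.2⟩
    else if rank d a = rank d b then one else zero
  mmul (Q.submatrix (fun i : Fin n => unrank d i) (fun i : Fin n => unrank d i)) A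

/-- Reduced row echelon form over the field with `p` elements of a matrix with entries in
`{0, …, p - 1}`, with the list of its pivot positions. -/
def echelon (p : ℕ) {n : ℕ} (A : Matrix (Fin n) (Fin n) V) :
    Prog V (Matrix (Fin n) (Fin n) V × List (Fin n × Fin n)) := do
  let P ← lit p
  let zero ← lit 0
  let one ← lit 1
  (List.finRange n).foldlM (init := (A, [])) fun (R, piv) j => do
    let free := (List.finRange n).filter fun i => i ∉ piv.map Prod.fst
    match ← find (fun i => do let b ← test (R i j) zero; pure (!b)) free with
    | none => pure (R, piv)
    | some i => do
      let c ← power (mulMod P) one (R i j) (p - 2)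
      let row ← each .mul (fun (_ : Unit) k => R i k) c
      let row ← each .mod row P
      let corr ← mmul (fun k (_ : Unit) => if k = i then zero else R k j) row
      let R' ← zip .sub (fun k l => if k = i then row () l else R k l) corr
      let R' ← each .mod R' P
      pure (R', (i, j) :: piv)

end LinearAlgebra

/-! ## Lattices

A lattice in `ℚ ^ n` is given by a matrix `S` whose columns form a basis. -/

section Lattice

variable {V : Type} {n : ℕ}

/-- `X + U * (W * X)`, that is, `1 + U * W` applied to `X`. -/
def applyUpdate {ι κ : Type} [Fintype ι] [Fintype κ] (U : Matrix (Fin n) ι V)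
    (W : Matrix ι (Fin n) V) (X : Matrix (Fin n) κ V) : Prog V (Matrix (Fin n) κ V) := do
  let Y ← mmul W X
  let Z ← mmul U Y
  zip .add X Z

/-- For a vector `c` with `x = p ^ t * c` integral, divide common factors `p` out of `x`. Returns
`(t', i, p ^ t' * c)` with the least `t'` for which `p ^ t' * c` is integral, and the position `i`
of an entry of `p ^ t' * c` prime to `p`; returns nothing if `c` is itself integral. -/
def clearPowers (P zero : V) :
    ℕ → Matrix (Fin n) Unit V → Prog V (Option (ℕ × Fin n × Matrix (Fin n) Unit V))
  | 0, _ => pure none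
  | t + 1, x => do
    let unit? ← find (fun i => do
      let r ← op .mod (x i ()) P
      let b ← test r zero
      pure (!b)) (List.finRange n)
    match unit? with
    | some i => pure (some (t + 1, i, x))
    | none => do
      let x' ← each .div x P
      clearPowers P zero t x'

/-- Basis of `ℤ ^ n + C ℤ ^ (2 ^ d)`, for a matrix `C` such that `p ^ k * C` is integral.
The result `(U, U', W)` stands for the basis matrix `T = 1 + U * W` and its
inverse `T⁻¹ = 1 + U' * W`. One column `c` is adjoined by scaling it, modulo `ℤ ^ n`, so that
an entry with the largest denominator `p ^ t` becomes `1 / p ^ t`, and putting it in place of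
the unit vector at that position; many columns are adjoined by halves. -/
def adjoin (p k : ℕ) : (d : ℕ) → Matrix (Fin n) (I d) V →
    Prog V (Matrix (Fin n) (I d) V × Matrix (Fin n) (I d) V × Matrix (I d) (Fin n) V)
  | 0, C => do
    let P ← lit p
    let zero ← lit 0
    let one ← lit 1
    let c : Matrix (Fin n) Unit V := fun i _ => C i ()
    let pk ← power (op .mul) one P k
    let x ← each .mul c pk
    match ← clearPowers P zero k x with
    | none => pure (fun _ _ => zero, fun _ _ => zero, fun _ _ => zero)
    | some (t, i, x) => do
      let pt ← power (op .mul) one P t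
      let r ← op .mod (x i ()) pt
      let l ← power (mulMod pt) one r (p ^ (t - 1) * (p - 1) - 1)
      let y ← each .mul c l
      let y ← each .mod y one
      let u ← zip .sub y fun j _ => if j = i then one else zero
      let npt ← op .sub zero pt
      let u' ← each .mul u npt
      pure (fun j _ => u j (), fun j _ => u' j (), fun _ j => if j = i then one else zero)
  | d + 1, (C : Matrix (Fin n) (I d ⊕ I d) V) => do
    let (U₁, U₁', W₁) ← adjoin p k d C.toCols₁
    let C₂ ← applyUpdate U₁' W₁ C.toCols₂
    let (U₂, U₂', W₂) ← adjoin p k d C₂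
    let U₂ ← applyUpdate U₁ W₁ U₂
    let U₁' ← applyUpdate U₂' W₂ U₁'
    pure ((Matrix.fromCols U₁ U₂ : Matrix (Fin n) (I d ⊕ I d) V),
      (Matrix.fromCols U₁' U₂' : Matrix (Fin n) (I d ⊕ I d) V),
      (Matrix.fromRows W₁ W₂ : Matrix (I d ⊕ I d) (Fin n) V))

/-- The lattice spanned by the columns of `S` and `S * C`, where `p ^ k * C` is integral. -/
def enlarge (p k : ℕ) (S : Matrix (Fin n) (Fin n) V) {h : ℕ} (C : Matrix (Fin n) (Fin h) V) :
    Prog V (Matrix (Fin n) (Fin n) V) := do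
  let zero ← lit 0
  let d := Nat.clog 2 h
  let (U, _, W) ← adjoin p k d fun i a =>
    if h' : rank d a < h then C i ⟨rank d a, h'⟩ else zero
  let SU ← mmul S U
  let SUW ← mmul SU W
  zip .add S SUW

/-- Gram matrix of the lattice `S` in the space with Gram matrix `G`. -/
def gram (G S : Matrix (Fin n) (Fin n) V) : Prog V (Matrix (Fin n) (Fin n) V) := do
  let GS ← mmul G S
  mmul S.transpose GS

/-- `∏ q ^ e` over the pairs `(q, e)` of the given factorization with `q ≠ p`. -/
def cofactor (fs : List (ℕ × ℕ)) (p : ℕ) : Prog V V := do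
  let one ← lit 1
  fs.foldlM (init := one) fun u qe =>
    if qe.1 = p then pure u
    else do
      let q ← lit qe.1
      let t ← power (op .mul) one q qe.2
      op .mul u t

/-- An integer that is `1` modulo `p` and `0` modulo the other prime powers. -/
def idempotent (fs : List (ℕ × ℕ)) (p : ℕ) : Prog V V := do
  let u ← cofactor fs p
  let P ← lit p
  let one ← lit 1
  let r ← op .mod u P
  let w ← power (mulMod P) one r (p - 2)
  op .mul u w

/-! ### Saturation -/

/-- Refinement loop at `p`. On entry `p ^ m` kills the `p`-part of `L^# / L`; a round replaces
`L` by `L + p ^ ⌈m / 2⌉ (L^#)_p`, where `(L^#)_p` is the `p`-part of the dual lattice `L^#`,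
and `m` by `⌈m / 2⌉`. -/
def saturate (G : Matrix (Fin n) (Fin n) V) (fs : List (ℕ × ℕ)) (p : ℕ) :
    (rounds m : ℕ) → Matrix (Fin n) (Fin n) V → Prog V (Matrix (Fin n) (Fin n) V)
  | 0, _, S => pure S
  | rounds + 1, m, S => do
    let c := (m + 1) / 2
    let one ← lit 1
    let P ← lit p
    let A ← gram G S
    let dual ← inverse A
    let u ← cofactor fs p
    let pc ← power (op .mul) one P c
    let s ← op .mul u pc
    let C ← each .mul dual s
    let S' ← enlarge p (m - c) S C
    saturate G fs p rounds c S'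

/-! ### Isotropic vectors over the field with `p` elements -/

/-- Is `x` a nonzero square modulo the odd prime `p`? (Euler's criterion, `x` reduced.) -/
def isSquare (p : ℕ) (x : V) : Prog V Bool := do
  let P ← lit p
  let one ← lit 1
  let r ← power (mulMod P) one x ((p - 1) / 2)
  test r one

/-- Square root modulo the odd prime `p`, if there is one, by Cipolla's method. -/
def sqrtMod (p : ℕ) (a : V) : Prog V (Option V) := do
  let P ← lit p
  let zero ← lit 0
  let one ← lit 1
  if ← test a zero then pure (some zero)
  else if ← isSquare p a then do
    let (s, w) ← untilSome do
      let s ← rand p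
      let s2 ← mulMod P s s
      let w ← subMod P s2 a
      if ← test w zero then pure none
      else if ← isSquare p w then pure none
      else pure (some (s, w))
    let mulQ : V × V → V × V → Prog V (V × V) := fun x y => do
      let a ← op .mul x.1 y.1
      let b ← op .mul x.2 y.2
      let b ← op .mul b w
      let c ← op .mul x.1 y.2
      let d ← op .mul x.2 y.1
      let re ← op .add a b
      let im ← op .add c d
      let re ← op .mod re P
      let im ← op .mod im P
      pure (re, im)
    let r ← power mulQ (one, zero) (s, one) ((p + 1) / 2)
    pure (some r.1)
  else pure none

/-- Random search for a nonzero isotropic vector supported on `act`: take random `a`, `m`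
and solve `Q (a + t m) = 0` for `t`. -/
def isotropicSearch (p : ℕ) (act : List (Fin n)) (E : Matrix (Fin n) (Fin n) V) :
    Prog V (Matrix (Fin n) Unit V) := do
  let P ← lit p
  let zero ← lit 0
  let one ← lit 1
  let randomVector : Prog V (Matrix (Fin n) Unit V) := do
    let f ← act.foldlM (init := fun _ : Fin n => zero) fun f i => do
      let x ← rand p
      pure (Function.update f i x)
    pure fun i _ => f i
  let form : Matrix (Fin n) Unit V → Matrix (Fin n) Unit V → Prog V V := fun x y => do
    let Ey ← mmul E y
    let r ← mmul x.transpose Ey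
    op .mod (r () ()) P
  untilSome do
    let a ← randomVector
    let m ← randomVector
    let qm ← form m m
    let qa ← form a a
    let b ← form a m
    if ← test qm zero then pure none
    else do
      let b2 ← mulMod P b b
      let qq ← mulMod P qm qa
      let disc ← subMod P b2 qq
      match ← sqrtMod p disc with
      | none => pure none
      | some r => do
        let num ← subMod P r b
        let inv ← power (mulMod P) one qm (p - 2)
        let t ← mulMod P num inv
        let tm ← each .mul m t
        let v ← zip .add a tm
        let v ← each .mod v P
        match ← find (fun i => do let z ← test (v i ()) zero; pure (!z)) act with
        | none => pure none
        | some _ => pure (some v)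

/-- A nonzero isotropic vector in the span of the basis vectors listed in `act`, on which the
symmetric bilinear form `E` modulo `p` is nondegenerate, or nothing if there is none. -/
def isotropicVector (p : ℕ) (act : List (Fin n)) (E : Matrix (Fin n) (Fin n) V) :
    Prog V (Option (Matrix (Fin n) Unit V)) := do
  let P ← lit p
  let zero ← lit 0
  let one ← lit 1
  match act with
  | [] => pure none
  | [_] => pure none
  | i :: j :: rest =>
    if p = 2 then do
      if ← test (E i i) zero then pure (some fun k _ => if k = i then one else zero)
      else if ← test (E j j) zero then pure (some fun k _ => if k = j then one else zero)
      else pure (some fun k _ => if k = i ∨ k = j then one else zero)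
    else if rest.isEmpty then do
      let x ← mulMod P (E i j) (E i j)
      let y ← mulMod P (E i i) (E j j)
      let d ← subMod P x y
      if ← isSquare p d then do
        let v ← isotropicSearch p act E
        pure (some v)
      else pure none
    else do
      let v ← isotropicSearch p act E
      pure (some v)

/-- Basis of a maximal totally isotropic subspace of the span of the vectors `X · j`, `j ∈ act`,
whose Gram matrix `E` modulo `p` is nondegenerate: find an isotropic vector `v`, complete it to a
hyperbolic pair `v, w`, project the other basis vectors to the orthogonal complement of the pair,
and go on there. -/
def isotropicSubspace (p : ℕ) : (rounds : ℕ) → List (Fin n) → Matrix (Fin n) (Fin n) V →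
    Matrix (Fin n) (Fin n) V → Prog V (List (Matrix (Fin n) Unit V))
  | 0, _, _, _ => pure []
  | rounds + 1, act, X, E => do
    let P ← lit p
    let zero ← lit 0
    let one ← lit 1
    match ← isotropicVector p act E with
    | none => pure []
    | some v => do
      -- `r j` is the product of `v` with the `j`-th basis vector
      let r ← mmul v.transpose E
      let r ← each .mod r P
      let i? ← find (fun i => do let z ← test (r () i) zero; pure (!z)) act
      match i? with
      | none => pure []
      | some i => do
        let j? ← find (fun j => do let z ← test (v j ()) zero; pure (!z))
          (act.filter fun j => j ≠ i)
        match j? with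
        | none => pure []
        | some j => do
          let s ← power (mulMod P) one (r () i) (p - 2)
          let v' ← mmul X v
          let v' ← each .mod v' P
          let w' ← each .mul (fun k (_ : Unit) => X k i) s
          let w' ← each .mod w' P
          -- `g j` is the product of `w` with the `j`-th basis vector, `c` that of `w` with `w`
          let g ← each .mul (fun (_ : Unit) k => E i k) s
          let g ← each .mod g P
          let c ← mulMod P (g () i) s
          let cr ← each .mul r c
          let α ← zip .sub g cr
          let α ← each .mod α P
          let vα ← mmul v' α
          let wr ← mmul w' r
          let X' ← zip .sub X vα
          let X' ← zip .sub X' wr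
          let X' ← each .mod X' P
          let αr ← mmul α.transpose r
          let rg ← mmul r.transpose g
          let E' ← zip .sub E αr
          let E' ← zip .sub E' rg
          let E' ← each .mod E' P
          let l ← isotropicSubspace p rounds (act.filter fun k => k ≠ i ∧ k ≠ j) X' E'
          pure (v' :: l)

/-! ### Bilinear-maximal overlattice -/

/-- Lift of an element of `L^# / L`, given by its coordinates `v` in the dual basis, to a vector
of `L^#` (in coordinates of `L`) with the same `p`-component and trivial other components. -/
def liftVector (fs : List (ℕ × ℕ)) (p : ℕ) (dual : Matrix (Fin n) (Fin n) V)
    (v : Matrix (Fin n) Unit V) : Prog V (Matrix (Fin n) Unit V) := do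
  let e ← idempotent fs p
  let y ← mmul dual v
  each .mul y e

/-- Makes a lattice `L` with `p (L^#)_p ⊆ L` maximal at `p` among lattices with integral bilinear
form: split off the radical of the discriminant form modulo `p`, and adjoin the lift of a maximal
totally isotropic subspace of the rest. -/
def maximizeAt (G : Matrix (Fin n) (Fin n) V) (fs : List (ℕ × ℕ)) (p : ℕ)
    (S : Matrix (Fin n) (Fin n) V) : Prog V (Matrix (Fin n) (Fin n) V) := do
  let P ← lit p
  let zero ← lit 0
  let one ← lit 1
  let A ← gram G S
  let dual ← inverse A
  let e ← idempotent fs p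
  let pe ← op .mul P e
  let E ← each .mul dual pe
  let E ← each .mod E P
  let (_, piv) ← echelon p E
  let vs ← isotropicSubspace p n (piv.map Prod.snd) (fun i j => if i = j then one else zero) E
  let lifts ← vs.mapM (liftVector fs p dual)
  enlarge p 1 S (h := lifts.length) fun i a => lifts.get a i ()

/-! ### Even neighbors at `2` -/

/-- For a bilinear-maximal lattice `L` with basis `S`: returns `L` if `L` is even. Otherwise takes
the even sublattice `L₀` and looks for `x ∈ L₀` not in `2 L₀` with `B(x, L₀) ⊆ 2 ℤ` and
`B(x, x) ∈ 8 ℤ`; returns the even neighbor `L₀ + ℤ x / 2` if there is such an `x`, and `L₀` if not.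
By maximality of `L`, the solutions modulo `2 L₀` of `B(x, L₀) ⊆ 2 ℤ` form a space of
dimension at most `3` over the field with two elements. -/
def evenNeighbor (G S : Matrix (Fin n) (Fin n) V) : Prog V (Matrix (Fin n) (Fin n) V) := do
  let zero ← lit 0
  let one ← lit 1
  let two ← lit 2
  let eight ← lit 8
  let A ← gram G S
  let par ← each .mod (fun (_ : Unit) i => A i i) two
  match ← find (fun i => test (par () i) one) (List.finRange n) with
  | none => pure S
  | some i₀ => do
    let npar ← zip .sub (fun _ _ => zero) par
    let K : Matrix (Fin n) (Fin n) V := fun i j =>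
      if i = i₀ then (if j = i₀ then two else npar () j)
      else if i = j then one else zero
    let S₀ ← mmul S K
    let A₀ ← gram A K
    let A₀mod ← each .mod A₀ two
    let (R, piv) ← echelon 2 A₀mod
    let free := (List.finRange n).filter fun j => j ∉ piv.map Prod.snd
    -- the null vectors modulo `2` read off from the echelon form
    let nullVectors : List (Matrix (Fin n) Unit V) := free.map fun f i _ =>
      if i = f then one
      else match piv.find? fun q => q.2 = i with
        | some q => R q.1 f
        | none => zero
    let candidates := (nullVectors.take 3).sublists.filter fun l => !l.isEmpty
    let sum : List (Matrix (Fin n) Unit V) → Prog V (Matrix (Fin n) Unit V) := fun l =>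
      l.foldlM (zip .add) fun _ _ => zero
    let good? ← find (fun l => do
      let x ← sum l
      let y ← mmul A₀ x
      let q ← mmul x.transpose y
      let r ← op .mod (q () ()) eight
      test r zero) candidates
    match good? with
    | none => pure S₀
    | some l => do
      let x ← sum l
      let c ← each .div x two
      enlarge 2 1 S₀ (h := 1) fun i _ => c i ()

/-! ### The algorithm -/

/-- Maximal overlattice of the lattice with Gram matrix `G`, for the factorization `fs` of its
determinant: saturate at all primes, make the lattice bilinear-maximal
at all primes, and pass to an even neighbor at `2`.
The result is the basis matrix of a lattice in coordinates of the given basis. -/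
def maximalOverlattice (fs : List (ℕ × ℕ)) (G : Matrix (Fin n) (Fin n) V) :
    Prog V (Matrix (Fin n) (Fin n) V) := do
  let zero ← lit 0
  let one ← lit 1
  let S ← fs.foldlM (init := fun i j => if i = j then one else zero) fun S pe =>
    saturate G fs pe.1 (Nat.clog 2 pe.2) pe.2 S
  let S ← fs.foldlM (init := S) fun S pe => maximizeAt G fs pe.1 S
  evenNeighbor G S

end Lattice

/-- The pairs `(p, ν_p(D))` for the primes `p ∣ D`. -/
def factorPairs (D : ℕ) : List (ℕ × ℕ) :=
  D.primeFactorsList.dedup.map fun p => (p, padicValNat p D)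

end MaxLat

open scoped ENNReal

namespace MaxLat

/-! ## A program logic for expected running time -/

namespace Prog

/-! The time is estimated in a program logic: `Runs P T Post` bounds the expected time of `P` by `T`
and asserts `Post` of its results. Outside the two random loops (Cipolla's square root and the
search for isotropic vectors) the cost can be read off from the instructions. The search needs a
nondegenerate form, so correctness is proved as far as that requires; maximality of the output plays
no role.

Random loops. A body that succeeds for at least the fraction `1/N` of its random choices costs at
most `N` bodies in all (`Runs.loop`). From `∑ χ(s² - a) = -1` for the quadratic character, at least
a third of all `s` make `s² - a` a nonsquare, so `N = 3` serves for square roots. Applying such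
counts along lines in the space of vectors, first to the form and then to discriminant forms derived
from it, shows that one in 27 pairs `a, m` leads to an isotropic vector (`card_goodPair`).

Nondegeneracy. A number kills `L^#/L` exactly when its multiple of the inverse Gram matrix is
integral (`IsInt (c • dualGram G S)`). Initially `D` does this; saturation replaces `p ^ ν_p(D)` by
`p`, and passing to a larger lattice keeps such properties (`Refines.dual`). Then the form modulo
`p` has entries in `ZMod p`, it is nondegenerate on the pivot columns of its echelon form
(`EchelonIn.nonDeg`), and splitting off a hyperbolic pair keeps it so (`nonDeg_projGram`).

Costs. Inversion by Schur complements and adjoining columns by halves both cost `O(n ^ ψ)`, because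
their recursions are geometric for `ψ > 2`. A saturation round that lowers the exponent by `k` costs
in addition `O(k)` times `n² + n log p`. There are `O(log ν_p)` rounds and the `k` add up to less
than `ν_p`, which gives `n ^ ψ ∑ log ν_p`, `n² Ω` and `n log D`. The other work at `p` consists of
`O(n)` steps of `O(n² + log p)` operations plus cofactors of cost `O(Ω)`, whence `n³ ω` and the last
term. -/

theorem bind_ret {V α : Type} (P : Prog V α) : P.bind .ret = P := by
  induction P <;> simp only [bind, *]

theorem bind_bind {V α β γ : Type} (P : Prog V α) (F : α → Prog V β) (H : β → Prog V γ) :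
    (P.bind F).bind H = P.bind fun a => (F a).bind H := by
  induction P <;> simp only [bind, *]

instance {V : Type} : LawfulMonad (Prog V) :=
  LawfulMonad.mk' _ (fun P => bind_ret P) (fun _ _ => rfl) (fun P F H => bind_bind P F H)

/-- The expected cost is a transformer of continuations, so sequencing programs is composition of
transformers. Every rule for `Runs` and `Draws` rests on this identity. -/
theorem ert_bind {α β : Type} (P : Prog ℚ α) (F : α → Prog ℚ β) (f : β → ℝ≥0∞) :
    (P >>= F).ert f = P.ert fun a => (F a).ert f := by
  change (P.bind F).ert f = _
  induction P <;> simp only [bind, ert, *]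
  rename_i ih
  exact congrArg _ (ih _ F)

end Prog

/-- The expected running time of `P` is at most `T`, and all its results satisfy `Post`. -/
def Runs {α : Type} (P : Prog ℚ α) (T : ℕ) (Post : α → Prop) : Prop :=
  ∀ (f : α → ℝ≥0∞) (K : ℝ≥0∞), (∀ a, Post a → f a ≤ K) → P.ert f ≤ T + K

namespace Runs

variable {α β : Type} {T T' T₁ T₂ : ℕ} {Post Post' : α → Prop}

theorem mono {P : Prog ℚ α} (h : Runs P T Post) (hT : T ≤ T')
    (hP : ∀ a, Post a → Post' a) : Runs P T' Post' := fun f K hf =>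
  (h f K fun a ha => hf a (hP a ha)).trans (by gcongr)

theorem le {P : Prog ℚ α} (h : Runs P T Post) (hT : T ≤ T') : Runs P T' Post :=
  h.mono hT fun _ => id

theorem post {P : Prog ℚ α} (h : Runs P T Post) (hP : ∀ a, Post a → Post' a) : Runs P T Post' :=
  h.mono le_rfl hP

theorem expectedTime_le {P : Prog ℚ α} (h : Runs P T Post) : P.expectedTime ≤ T := by
  simpa [Prog.expectedTime] using h (fun _ => 0) 0 fun _ _ => le_rfl

theorem pure {a : α} (h : Post a) : Runs (pure a) 0 Post := fun f K hf => by
  change f a ≤ _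
  simpa using hf a h

theorem bind {P : Prog ℚ β} {F : β → Prog ℚ α} {Q : β → Prop} (h₁ : Runs P T₁ Q)
    (h₂ : ∀ b, Q b → Runs (F b) T₂ Post) : Runs (P >>= F) (T₁ + T₂) Post := fun f K hf => by
  rw [Prog.ert_bind, Nat.cast_add, add_assoc]
  exact h₁ _ _ fun b hb => h₂ b hb f K hf

theorem lit {F : ℚ → Prog ℚ α} {q : ℚ} (h : Runs (F q) T Post) :
    Runs (lit q >>= F) (1 + T) Post := fun f K hf => by
  rw [Prog.ert_bind, Nat.cast_add, add_assoc]
  simpa [MaxLat.lit, Prog.ert] using h f K hf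

theorem op {F : ℚ → Prog ℚ α} {o : Op} {x y : ℚ} (h : Runs (F (o.eval x y)) T Post) :
    Runs (op o x y >>= F) (1 + T) Post := fun f K hf => by
  rw [Prog.ert_bind, Nat.cast_add, add_assoc]
  simpa [MaxLat.op, Prog.ert] using h f K hf

theorem test {F : Bool → Prog ℚ α} {x y : ℚ} (h : Runs (F (decide (x = y))) T Post) :
    Runs (test x y >>= F) (1 + T) Post := fun f K hf => by
  rw [Prog.ert_bind, Nat.cast_add, add_assoc]
  simpa [MaxLat.test, Prog.ert] using h f K hf

section
variable {ι κ μ : Type} [Fintype ι] [Fintype κ] [Fintype μ]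

theorem zip {F : Matrix ι κ ℚ → Prog ℚ α} {o : Op} {A B : Matrix ι κ ℚ}
    (h : Runs (F fun i j => o.eval (A i j) (B i j)) T Post) :
    Runs (zip o A B >>= F) (Fintype.card ι * Fintype.card κ + T) Post := fun f K hf => by
  rw [Prog.ert_bind, Nat.cast_add, add_assoc]
  simp only [MaxLat.zip, Prog.ert]
  exact add_le_add_right (h f K hf) _

theorem each {F : Matrix ι κ ℚ → Prog ℚ α} {o : Op} {A : Matrix ι κ ℚ} {c : ℚ}
    (h : Runs (F fun i j => o.eval (A i j) c) T Post) :
    Runs (each o A c >>= F) (Fintype.card ι * Fintype.card κ + T) Post := zip h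

theorem mmul {F : Matrix ι μ ℚ → Prog ℚ α} {A : Matrix ι κ ℚ} {B : Matrix κ μ ℚ}
    (h : Runs (F (A * B)) T Post) :
    Runs (mmul A B >>= F)
      (rectCost (Fintype.card ι) (Fintype.card κ) (Fintype.card μ) + T) Post := fun f K hf => by
  rw [Prog.ert_bind, Nat.cast_add, add_assoc]
  simpa [MaxLat.mmul, Prog.ert] using h f K hf

end

theorem of_bind_pure {P : Prog ℚ α} (h : Runs (P >>= Pure.pure) T Post) : Runs P T Post := by
  rwa [bind_pure] at h

theorem ite {c : Prop} [Decidable c] {P Q : Prog ℚ α} (h₁ : c → Runs P T₁ Post)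
    (h₂ : ¬c → Runs Q T₂ Post) : Runs (if c then P else Q) (max T₁ T₂) Post := by
  split_ifs with h
  · exact (h₁ h).le (le_max_left _ _)
  · exact (h₂ h).le (le_max_right _ _)

/-- The invariant depends on the prefix already processed, so that it can record which columns or
primes are finished. A step also receives the splitting of `l`, from which membership and
distinctness can be deduced. -/
theorem foldlM {σ γ : Type} {F : σ → γ → Prog ℚ σ} {c : γ → ℕ} (I : List γ → σ → Prop)
    {l : List γ}
    (step : ∀ l₁ a l₂ s, l = l₁ ++ a :: l₂ → I l₁ s → Runs (F s a) (c a) (I (l₁ ++ [a])))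
    {s : σ} (h : I [] s) : Runs (l.foldlM F s) (l.map c).sum (I l) := by
  suffices ∀ l₂ l₁ s, l = l₁ ++ l₂ → I l₁ s →
      Runs (l₂.foldlM F s) (l₂.map c).sum (I l) from this l [] s rfl h
  intro l₂
  induction l₂ with
  | nil =>
    intro l₁ s hl hs
    simp only [List.append_nil] at hl
    subst hl
    exact pure hs
  | cons a l₂ ih =>
    intro l₁ s hl hs
    rw [List.foldlM_cons, List.map_cons, List.sum_cons]
    exact bind (step l₁ a l₂ s hl hs) fun s' hs' => ih (l₁ ++ [a]) s' (by simp [hl]) hs'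

theorem mapM {γ : Type} {F : γ → Prog ℚ α} {c : ℕ} {l : List γ}
    (h : ∀ a ∈ l, Runs (F a) c Post) :
    Runs (l.mapM F) (l.length * c) fun r => r.length = l.length ∧ ∀ b ∈ r, Post b := by
  induction l with
  | nil => simpa using pure (a := ([] : List α)) (by simp)
  | cons a l ih =>
    rw [List.mapM_cons]
    refine le (bind (h a (by simp)) fun b hb =>
      bind (ih fun a ha => h a (by simp [ha])) fun r hr => pure ?_)
      (T := c + (l.length * c + 0)) (by simp [add_mul, add_comm])
    simp [hr.1, hb]
    exact hr.2

theorem find {φ : β → Prop} {f : β → Prog ℚ Bool} {c : ℕ}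
    (l : List β) (h : ∀ b ∈ l, Runs (f b) c fun r => r = true ↔ φ b) :
    Runs (find f l) (l.length * c) fun r =>
      (∀ b, r = some b → b ∈ l ∧ φ b) ∧ (r = none → ∀ b ∈ l, ¬ φ b) := by
  induction l with
  | nil => exact (pure (by simp)).le (Nat.zero_le _)
  | cons b l ih =>
    rw [MaxLat.find]
    refine le (bind (h b List.mem_cons_self) fun r hr => ite (fun h => pure ?_) fun _ =>
      post (ih fun b hb => h b (List.mem_cons_of_mem _ hb)) ?_)
      (T := c + max 0 (l.length * c)) (by simp [add_mul, add_comm])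
    · simp_all
    · rintro a ⟨h₁, h₂⟩
      have hb : ¬ φ b := fun hb => ‹¬ r = true› (hr.2 hb)
      refine ⟨fun x hx => ⟨by simp [(h₁ x hx).1], (h₁ x hx).2⟩, fun ha x hx => ?_⟩
      rcases List.mem_cons.1 hx with rfl | hx
      · exact hb
      · exact h₂ ha x hx

/-- The running time of a loop whose body succeeds for at least the fraction `1 / N` of all
random choices `ω`. -/
theorem loop {Ω : Type} [Fintype Ω] [Nonempty Ω] (good : Ω → Prop) [DecidablePred good]
    {body : Prog ℚ (Option α)} {N : ℕ}
    (hbody : ∀ (f : Option α → ℝ≥0∞) (K Y : ℝ≥0∞), f none ≤ K + Y →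
      (∀ b, Post b → f (some b) ≤ K) →
      body.ert f ≤ T + (∑ ω, (K + if good ω then 0 else Y)) / Fintype.card Ω)
    (hgood : Fintype.card Ω ≤ N * (Finset.univ.filter good).card) :
    Runs (untilSome body) (N * (T + 1)) Post := by
  intro f K hf
  have hN : 1 ≤ N := by
    rcases Nat.eq_zero_or_pos N with rfl | h
    · simp at hgood
    · exact h
  have hcard := Finset.card_filter_add_card_filter_not (s := (Finset.univ : Finset Ω)) good
  rw [Finset.card_univ] at hcard
  set cΩ := Fintype.card Ω with hc
  have hc0 : cΩ ≠ 0 := Fintype.card_ne_zero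
  set bad := (Finset.univ.filter fun ω => ¬ good ω).card with hbad
  -- At most the fraction `(N - 1) / N` of the choices fails.
  have key : bad * N ≤ cΩ * (N - 1) := by
    obtain ⟨M, rfl⟩ := Nat.exists_eq_add_of_le' hN
    simp only [Nat.add_sub_cancel]
    have e1 : cΩ * M + cΩ = cΩ * (M + 1) := by ring
    have e2 : bad * (M + 1) + (M + 1) * (Finset.univ.filter good).card = cΩ * (M + 1) := by
      rw [← hcard]; ring
    omega
  simp only [untilSome, Prog.ert]
  -- The bound `X = N (T + 1)` reproduces itself: a further round costs `1 + T` and leaves at most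
  -- `(N - 1) / N` times `X`, which add up to `X`.
  refine iSup_le fun j => ?_
  induction j with
  | zero => simp
  | succ j ih =>
    rw [Function.iterate_succ_apply']
    refine (add_le_add_right (hbody _ K (N * (T + 1) : ℕ) ?_ fun b hb => hf b hb) 1).trans ?_
    · simpa [add_comm] using ih
    · have e : (∑ ω, (K + if good ω then 0 else ((N * (T + 1) : ℕ) : ℝ≥0∞)))
          = cΩ * K + (bad * (N * (T + 1)) : ℕ) := by
        rw [Finset.sum_add_distrib, Finset.sum_ite]
        simp [hc, hbad]
      have e' : (∑ ω, (K + if good ω then 0 else ((N * (T + 1) : ℕ) : ℝ≥0∞))) / cΩ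
          ≤ K + ((N - 1) * (T + 1) : ℕ) := by
        rw [e]
        refine ENNReal.div_le_of_le_mul' ?_
        have : bad * (N * (T + 1)) ≤ cΩ * ((N - 1) * (T + 1)) := by
          calc bad * (N * (T + 1)) = bad * N * (T + 1) := by ring
            _ ≤ cΩ * (N - 1) * (T + 1) := by gcongr
            _ = _ := by ring
        rw [mul_add (cΩ : ℝ≥0∞)]
        exact add_le_add le_rfl (by exact_mod_cast this)
      calc _ ≤ 1 + (T + (K + ((N - 1) * (T + 1) : ℕ))) := by gcongr
        _ = ((1 + T + (N - 1) * (T + 1) : ℕ) : ℝ≥0∞) + K := by push_cast; ring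
        _ ≤ _ := by
          gcongr
          obtain ⟨M, rfl⟩ := Nat.exists_eq_add_of_le' hN
          simp only [Nat.add_sub_cancel]
          ring_nf; rfl

end Runs

/-- `P` takes time at most `T` and returns `g ω` for a uniformly distributed `ω`. -/
def Draws {α Ω : Type} [Fintype Ω] (P : Prog ℚ α) (T : ℕ) (g : Ω → α) : Prop :=
  ∀ f : α → ℝ≥0∞, P.ert f ≤ T + (∑ ω, f (g ω)) / Fintype.card Ω

/-! ## Modular arithmetic on rationals -/

/-- The reduced representative of a residue class. -/
def red {N : ℕ} (a : ZMod N) : ℚ := (a.val : ℚ)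

/-- `x` is an integer in the residue class `a`. -/
def Rep {N : ℕ} (x : ℚ) (a : ZMod N) : Prop := ∃ z : ℤ, x = z ∧ (z : ZMod N) = a

section Rep

variable {N : ℕ} {x y : ℚ} {a b : ZMod N}

theorem Rep.add (h : Rep x a) (h' : Rep y b) : Rep (x + y) (a + b) := by
  obtain ⟨z, rfl, rfl⟩ := h
  obtain ⟨w, rfl, rfl⟩ := h'
  exact ⟨z + w, by push_cast; rfl, by push_cast; rfl⟩

theorem Rep.sub (h : Rep x a) (h' : Rep y b) : Rep (x - y) (a - b) := by
  obtain ⟨z, rfl, rfl⟩ := h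
  obtain ⟨w, rfl, rfl⟩ := h'
  exact ⟨z - w, by push_cast; rfl, by push_cast; rfl⟩

theorem Rep.mul (h : Rep x a) (h' : Rep y b) : Rep (x * y) (a * b) := by
  obtain ⟨z, rfl, rfl⟩ := h
  obtain ⟨w, rfl, rfl⟩ := h'
  exact ⟨z * w, by push_cast; rfl, by push_cast; rfl⟩

theorem Rep.zero : Rep (0 : ℚ) (0 : ZMod N) := ⟨0, by simp, by simp⟩

theorem Rep.int (z : ℤ) : Rep (z : ℚ) (z : ZMod N) := ⟨z, rfl, rfl⟩

theorem Rep.red [NeZero N] (a : ZMod N) : Rep (red a) a :=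
  ⟨a.val, by simp [MaxLat.red], by simp⟩

theorem Rep.sum {ι : Type*} (s : Finset ι) {f : ι → ℚ} {g : ι → ZMod N}
    (h : ∀ i ∈ s, Rep (f i) (g i)) : Rep (∑ i ∈ s, f i) (∑ i ∈ s, g i) := by
  classical
  induction s using Finset.induction_on with
  | empty => exact Rep.zero
  | insert i s hi ih =>
    rw [Finset.sum_insert hi, Finset.sum_insert hi]
    exact (h i (by simp)).add (ih fun j hj => h j (by simp [hj]))

theorem Rep.matMul {ι κ μ : Type*} [Fintype κ] {A : Matrix ι κ ℚ} {B : Matrix κ μ ℚ}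
    {A' : Matrix ι κ (ZMod N)} {B' : Matrix κ μ (ZMod N)} (hA : ∀ i j, Rep (A i j) (A' i j))
    (hB : ∀ i j, Rep (B i j) (B' i j)) (i : ι) (j : μ) : Rep ((A * B) i j) ((A' * B') i j) := by
  rw [Matrix.mul_apply, Matrix.mul_apply]
  exact Rep.sum _ fun k _ => (hA i k).mul (hB k j)

/-- Floor rounding makes the remainder nonnegative for negative integers too. Each residue class
thus has one representative as a rational, and equality tests on reduced values decide equality in
`ZMod N`. -/
theorem Rep.mod [NeZero N] (h : Rep x a) : Op.eval .mod x (N : ℚ) = MaxLat.red a := by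
  obtain ⟨z, rfl, rfl⟩ := h
  have hf : ⌊(z : ℚ) / N⌋ = z / N := by
    have := Rat.floor_intCast_div_natCast z N
    exact this
  have hv : (((z : ZMod N).val : ℤ) : ℚ) = ((z % N : ℤ) : ℚ) := by rw [ZMod.val_intCast]
  simp only [Op.eval, MaxLat.red]
  rw [hf, ← Int.cast_natCast (R := ℚ) (ZMod.val _), hv, Int.emod_def]
  push_cast
  ring

theorem red_injective [NeZero N] : Function.Injective (red (N := N)) := fun a b h => by
  simp only [red, Nat.cast_inj] at h
  exact ZMod.val_injective N h

theorem red_inj [NeZero N] : red a = red b ↔ a = b := red_injective.eq_iff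

@[simp] theorem red_zero : red (0 : ZMod N) = 0 := by simp [red]

theorem red_one (hN : 1 < N) : red (1 : ZMod N) = 1 := by
  have : Fact (1 < N) := ⟨hN⟩
  simp [red, ZMod.val_one]

theorem red_eq_zero [NeZero N] : red a = 0 ↔ a = 0 := by
  rw [← red_zero (N := N), red_inj]

end Rep

/-- All entries are integers. -/
def IsInt {ι κ : Type*} (A : Matrix ι κ ℚ) : Prop := ∀ i j, ∃ z : ℤ, A i j = z

theorem IsInt.mul {ι κ μ : Type*} [Fintype κ] {A : Matrix ι κ ℚ} {B : Matrix κ μ ℚ}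
    (hA : IsInt A) (hB : IsInt B) : IsInt (A * B) := fun i j => by
  choose a ha using hA
  choose b hb using hB
  exact ⟨∑ k, a i k * b k j, by simp [Matrix.mul_apply, ha, hb]⟩

theorem IsInt.add {ι κ : Type*} {A B : Matrix ι κ ℚ}
    (hA : IsInt A) (hB : IsInt B) : IsInt (A + B) := fun i j => by
  obtain ⟨a, ha⟩ := hA i j
  obtain ⟨b, hb⟩ := hB i j
  exact ⟨a + b, by simp [ha, hb]⟩

theorem IsInt.smul {ι κ : Type*} {A : Matrix ι κ ℚ} (z : ℤ) (hA : IsInt A) :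
    IsInt ((z : ℚ) • A) := fun i j => by
  obtain ⟨a, ha⟩ := hA i j
  exact ⟨z * a, by simp [ha]⟩

theorem IsInt.transpose {ι κ : Type*} {A : Matrix ι κ ℚ} (hA : IsInt A) : IsInt A.transpose :=
  fun i j => hA j i

theorem IsInt.one {ι : Type*} [DecidableEq ι] : IsInt (1 : Matrix ι ι ℚ) := fun i j => by
  by_cases h : i = j
  · exact ⟨1, by subst h; simp⟩
  · exact ⟨0, by simp [h]⟩

/-! ## Basic instructions -/

/-- Relating data to a monoid by `R` lets one proof serve for rational powers, powers modulo `N` and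
powers in a quadratic extension. Each binary digit of the exponent costs at most two
multiplications. -/
theorem runs_power {β M : Type} [Monoid M] (R : β → M → Prop) {mul : β → β → Prog ℚ β} {c : ℕ}
    (hmul : ∀ x y a b, R x a → R y b → Runs (mul x y) c fun z => R z (a * b))
    {one x : β} {a : M} (h1 : R one 1) (hx : R x a) (e : ℕ) :
    Runs (power mul one x e) (2 * c * e.size) fun z => R z (a ^ e) := by
  -- The digits come from the top, so the exponent reached so far changes by `Nat.bit` at each step.
  have key : ∀ (l : List Bool) (y : β) (m : ℕ), R y (a ^ m) →
      Runs (l.foldlM (fun acc b => do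
        let s ← mul acc acc
        if b then mul s x else pure s) y) (l.length * (2 * c))
        fun z => R z (a ^ (l.foldl (fun m b => Nat.bit b m) m)) := by
    intro l
    induction l with
    | nil => intro y m hy; exact Runs.le (Runs.pure hy) (Nat.zero_le _)
    | cons b l ih =>
      intro y m hy
      rw [List.foldlM_cons, List.foldl_cons]
      refine (Runs.bind (T₁ := 2 * c) (Q := fun z => R z (a ^ Nat.bit b m)) ?_
        fun z hz => ih z _ hz).le (by simp [add_mul, add_comm])
      refine (Runs.bind (hmul _ _ _ _ hy hy) fun s hs => Runs.ite (T₁ := c) (T₂ := 0)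
        (fun h => (hmul _ _ _ _ hs hx).post ?_) fun h => Runs.pure ?_).le (by simp; omega)
      · intro z hz
        rw [h]
        convert hz using 1
        simp [Nat.bit, pow_add, two_mul]
      · rw [Bool.eq_false_iff.2 h]
        convert hs using 1
        simp [Nat.bit, pow_add, two_mul]
  have := key e.bits.reverse one 0 (by simpa using h1)
  rw [MaxLat.power, ← List.foldlM_reverse]
  refine this.mono ?_ ?_
  · rw [List.length_reverse, ← Nat.size_eq_bits_len]
    exact le_of_eq (by ring)
  · intro z hz
    convert hz using 2
    rw [List.foldl_reverse]
    clear this hz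
    induction e using Nat.binaryRec' with
    | zero => simp
    | bit b n h ih => rw [Nat.bits_append_bit n b h, List.foldr_cons, ← ih]

theorem runs_power_mul {α : Type} {T : ℕ} {Post : α → Prop} {F : ℚ → Prog ℚ α} {x : ℚ} {e : ℕ}
    (h : Runs (F (x ^ e)) T Post) :
    Runs (power (MaxLat.op .mul) 1 x e >>= F) (2 * e.size + T) Post := by
  refine Runs.bind ((runs_power (M := ℚ) (fun y a => y = a) (c := 1) ?_ rfl rfl e).le
    (by omega)) ?_
  · rintro x y a b rfl rfl
    exact Runs.of_bind_pure (Runs.op (T := 0) (Runs.pure (by rfl)))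
  · rintro b rfl
    exact h

theorem runs_mulMod {N : ℕ} (x y : ℚ) :
    Runs (mulMod (N : ℚ) x y) 2 fun r => ∀ [NeZero N] (a b : ZMod N), Rep x a → Rep y b →
      r = red (a * b) := by
  unfold mulMod
  refine Runs.op (T := 1) (Runs.of_bind_pure (Runs.op (T := 0) (Runs.pure ?_)))
  intro _ a b ha hb
  exact (ha.mul hb).mod

theorem runs_subMod {N : ℕ} (x y : ℚ) :
    Runs (subMod (N : ℚ) x y) 2 fun r => ∀ [NeZero N] (a b : ZMod N), Rep x a → Rep y b →
      r = red (a - b) := by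
  unfold subMod
  refine Runs.op (T := 1) (Runs.of_bind_pure (Runs.op (T := 0) (Runs.pure ?_)))
  intro _ a b ha hb
  exact (ha.sub hb).mod

theorem runs_power_mod {N : ℕ} (hN : 1 < N) (x : ℚ) (e : ℕ) :
    Runs (power (MaxLat.mulMod (N : ℚ)) 1 x e) (4 * e.size) fun r =>
      ∀ a : ZMod N, x = red a → r = red (a ^ e) := by
  have : NeZero N := ⟨by omega⟩
  by_cases hx : ∃ a : ZMod N, x = red a
  · obtain ⟨a, rfl⟩ := hx
    refine (runs_power (M := ZMod N) (fun y a => y = red a) (c := 2) ?_ (red_one hN).symm rfl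
      e).mono le_rfl ?_
    · rintro x y a b rfl rfl
      exact (runs_mulMod _ _).post fun r hr => hr a b (Rep.red a) (Rep.red b)
    · intro r hr b hb
      rw [hr, red_inj.1 hb]
  -- For a value that is not reduced only the time is claimed, and computing in the trivial monoid
  -- gives it.
  · refine (runs_power (M := Unit) (fun y a => True) (c := 2) (x := x) (a := ()) ?_ trivial trivial
      e).mono le_rfl ?_
    · exact fun _ _ _ _ _ _ => (runs_mulMod _ _).post fun _ _ => trivial
    · exact fun r _ a ha => (hx ⟨a, ha⟩).elim

/-- Search for the first entry different from zero. -/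
theorem runs_find_ne_zero {β : Type} (g : β → ℚ) (l : List β) :
    Runs (MaxLat.find (fun i => do let b ← MaxLat.test (g i) 0; pure (!b)) l) l.length fun r =>
      (∀ b, r = some b → b ∈ l ∧ g b ≠ 0) ∧ (r = none → ∀ b ∈ l, g b = 0) := by
  refine (Runs.find (φ := fun i => g i ≠ 0) (c := 1) l fun b _ => ?_).mono (by omega) ?_
  · exact Runs.test (T := 0) (Runs.pure (by simp))
  · rintro r ⟨h1, h2⟩
    exact ⟨h1, fun h b hb => not_not.1 (h2 h b hb)⟩

/-- The fixed part `T'` of the cost leaves the average, while the part `h ω` that depends on the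
draw stays inside. This is the form in which `Runs.loop` expects the cost of a loop body. -/
theorem Draws.bind_le {α β Ω : Type} [Fintype Ω] {P : Prog ℚ α} {F : α → Prog ℚ β} {T T' : ℕ}
    {g : Ω → α} (hP : Draws P T g) [Nonempty Ω] {f : β → ℝ≥0∞} {h : Ω → ℝ≥0∞}
    (hF : ∀ ω, (F (g ω)).ert f ≤ T' + h ω) :
    (P >>= F).ert f ≤ (T + T' : ℕ) + (∑ ω, h ω) / Fintype.card Ω := by
  rw [Prog.ert_bind]
  refine (hP _).trans ?_
  rw [Nat.cast_add, add_assoc]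
  refine add_le_add le_rfl ?_
  calc _ ≤ (∑ ω, (T' + h ω)) / (Fintype.card Ω : ℝ≥0∞) := by gcongr with ω _; exact hF ω
    _ = _ := by
      rw [Finset.sum_add_distrib, ENNReal.add_div]
      congr 1
      rw [Finset.sum_const, Finset.card_univ, nsmul_eq_mul, mul_comm]
      exact ENNReal.mul_div_cancel_right (by simp) (by simp)

theorem Draws.bind {α β Ω Ω' : Type} [Fintype Ω] [Fintype Ω'] [Nonempty Ω] [Nonempty Ω']
    {P : Prog ℚ α} {F : α → Prog ℚ β} {T T' : ℕ} {g : Ω → α} {g' : Ω → Ω' → β}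
    (hP : Draws P T g) (hF : ∀ ω, Draws (F (g ω)) T' (g' ω)) :
    Draws (P >>= F) (T + T') fun ω : Ω × Ω' => g' ω.1 ω.2 := fun f => by
  refine (hP.bind_le fun ω => hF ω f).trans ?_
  refine add_le_add le_rfl (le_of_eq ?_)
  rw [Fintype.sum_prod_type, Fintype.card_prod, Nat.cast_mul]
  simp only [div_eq_mul_inv]
  rw [← Finset.sum_mul, mul_assoc, ENNReal.mul_inv (by simp) (by simp), mul_comm (_⁻¹)]

theorem Draws.rand (p : ℕ) [NeZero p] : Draws (rand p : Prog ℚ ℚ) 1 (red (N := p)) := fun f => by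
  simp only [MaxLat.rand, Prog.ert, ZMod.card, Nat.cast_one]
  refine le_of_eq ?_
  congr 2
  refine Finset.sum_bij' (fun i _ => (i : ZMod p)) (fun a _ => a.val) ?_ ?_ ?_ ?_ ?_
  · simp
  · intro a _; simpa using ZMod.val_lt a
  · intro i hi; exact ZMod.val_cast_of_lt (by simpa using hi)
  · simp
  · intro i hi; rw [red, ZMod.val_cast_of_lt (by simpa using hi)]

open Matrix

/-! ## Inversion -/

instance instDecidableEqI : (d : ℕ) → DecidableEq (I d)
  | 0 => inferInstanceAs (DecidableEq Unit)
  | d + 1 =>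
    letI := instDecidableEqI d
    inferInstanceAs (DecidableEq (I d ⊕ I d))

@[simp] theorem card_I : (d : ℕ) → Fintype.card (I d) = 2 ^ d
  | 0 => rfl
  | d + 1 => by
    have : Fintype.card (I (d + 1)) = Fintype.card (I d ⊕ I d) := rfl
    rw [this, Fintype.card_sum, card_I d]
    ring

/-- A symmetric positive definite matrix. -/
def PosDefQ {ι : Type} [Fintype ι] (P : Matrix ι ι ℚ) : Prop :=
  Pᵀ = P ∧ ∀ x : ι → ℚ, x ≠ 0 → 0 < x ⬝ᵥ (P *ᵥ x)

section Blocks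

variable {ι κ : Type} [Fintype ι] [Fintype κ]

theorem PosDefQ.toBlocks₁₁ {P : Matrix (ι ⊕ κ) (ι ⊕ κ) ℚ} (h : PosDefQ P) :
    PosDefQ P.toBlocks₁₁ := by
  refine ⟨?_, fun x hx => ?_⟩
  · ext i j
    exact congrFun (congrFun h.1 (Sum.inl i)) (Sum.inl j)
  · have := h.2 (Sum.elim x 0) (fun h0 => hx (by
      funext i
      simpa using congrFun h0 (Sum.inl i)))
    rw [← fromBlocks_toBlocks P, fromBlocks_mulVec] at this
    simpa [sumElim_dotProduct_sumElim] using this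

theorem PosDefQ.toBlocks₂₁ {P : Matrix (ι ⊕ κ) (ι ⊕ κ) ℚ} (h : PosDefQ P) :
    P.toBlocks₂₁ = P.toBlocks₁₂ᵀ := by
  ext i j
  exact (congrFun (congrFun h.1 (Sum.inr i)) (Sum.inl j)).symm

/-- The Schur complement takes at `z` the value of `P` at the vector `(-a P₁₂ z, z)`, whose image
under `P` has first block zero. -/
theorem PosDefQ.schur [DecidableEq ι] {P : Matrix (ι ⊕ κ) (ι ⊕ κ) ℚ} (h : PosDefQ P) {a : Matrix ι ι ℚ}
    (ha : P.toBlocks₁₁ * a = 1) (hs : aᵀ = a) :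
    PosDefQ (P.toBlocks₂₂ - P.toBlocks₂₁ * (a * P.toBlocks₁₂)) := by
  have h22 : P.toBlocks₂₂ᵀ = P.toBlocks₂₂ := by
    ext i j
    exact congrFun (congrFun h.1 (Sum.inr i)) (Sum.inr j)
  refine ⟨?_, fun z hz => ?_⟩
  · rw [transpose_sub, transpose_mul, transpose_mul, h.toBlocks₂₁, hs, h22, transpose_transpose,
      Matrix.mul_assoc]
  · have := h.2 (Sum.elim (-((a * P.toBlocks₁₂) *ᵥ z)) z) (fun h0 => hz (by
      funext i
      simpa using congrFun h0 (Sum.inr i)))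
    rw [← fromBlocks_toBlocks P, fromBlocks_mulVec] at this
    simp only [toBlocks_fromBlocks₁₂, Sum.elim_comp_inl, Sum.elim_comp_inr,
      sumElim_dotProduct_sumElim] at this
    have e : P.toBlocks₁₁ *ᵥ (-((a * P.toBlocks₁₂) *ᵥ z)) + P.toBlocks₁₂ *ᵥ z = 0 := by
      rw [mulVec_neg, mulVec_mulVec, ← Matrix.mul_assoc, ha, Matrix.one_mul, neg_add_cancel]
    rw [e, dotProduct_zero, zero_add, mulVec_neg, mulVec_mulVec, neg_add_eq_sub,
      ← sub_mulVec] at this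
    exact this

/-- Block inversion in terms of `x = A⁻¹ B` and the inverse `t` of the Schur complement. By symmetry
the transpose of `x` replaces `Bᵀ A⁻¹`, so four products suffice. -/
theorem schur_inverse [DecidableEq ι] [DecidableEq κ] {A a : Matrix ι ι ℚ} {B x : Matrix ι κ ℚ} {C s t : Matrix κ κ ℚ}
    (ha : A * a = 1) (hs : aᵀ = a) (hx : x = a * B) (hS : s = C - Bᵀ * x) (ht : s * t = 1)
    (hts : tᵀ = t) :
    fromBlocks A B Bᵀ C * fromBlocks (a + x * t * xᵀ) (-(x * t)) (-(x * t))ᵀ t = 1 := by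
  have hAx : A * x = B := by rw [hx, ← Matrix.mul_assoc, ha, Matrix.one_mul]
  have hxT : xᵀ = Bᵀ * a := by rw [hx, transpose_mul, hs]
  rw [fromBlocks_multiply, ← fromBlocks_one]
  congr 1
  · rw [Matrix.mul_add, ha, transpose_neg, transpose_mul, hts, ← Matrix.mul_assoc,
      ← Matrix.mul_assoc, hAx, Matrix.mul_neg, Matrix.mul_assoc]
    abel
  · rw [Matrix.mul_neg, ← Matrix.mul_assoc, hAx, neg_add_cancel]
  · have : Bᵀ * (x * t * xᵀ) - C * (t * xᵀ) = - (s * t * xᵀ) := by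
      rw [hS]; simp only [Matrix.sub_mul, Matrix.mul_assoc]; abel
    rw [Matrix.mul_add, transpose_neg, transpose_mul, hts, Matrix.mul_neg, ← hxT, add_assoc,
      ← sub_eq_add_neg, this, ht, Matrix.one_mul, add_neg_cancel]
  · rw [Matrix.mul_neg, ← Matrix.mul_assoc, neg_add_eq_sub, ← Matrix.sub_mul, ← hS, ht]

theorem PosDefQ.inverse_fromBlocks [DecidableEq ι] [DecidableEq κ]
    {P : Matrix (ι ⊕ κ) (ι ⊕ κ) ℚ} (h : PosDefQ P)
    {a : Matrix ι ι ℚ} {t : Matrix κ κ ℚ} (ha : P.toBlocks₁₁ * a = 1) (hs : aᵀ = a)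
    (ht : (P.toBlocks₂₂ - P.toBlocks₂₁ * (a * P.toBlocks₁₂)) * t = 1) (hts : tᵀ = t) :
    P * fromBlocks (a + a * P.toBlocks₁₂ * t * (a * P.toBlocks₁₂)ᵀ) (0 - a * P.toBlocks₁₂ * t)
        (0 - a * P.toBlocks₁₂ * t)ᵀ t = 1 ∧
      (fromBlocks (a + a * P.toBlocks₁₂ * t * (a * P.toBlocks₁₂)ᵀ) (0 - a * P.toBlocks₁₂ * t)
        (0 - a * P.toBlocks₁₂ * t)ᵀ t)ᵀ =
      fromBlocks (a + a * P.toBlocks₁₂ * t * (a * P.toBlocks₁₂)ᵀ) (0 - a * P.toBlocks₁₂ * t)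
        (0 - a * P.toBlocks₁₂ * t)ᵀ t := by
  rw [zero_sub]
  constructor
  · have key := schur_inverse ha hs rfl rfl (by rwa [h.toBlocks₂₁] at ht) hts
    rwa [← h.toBlocks₂₁, fromBlocks_toBlocks] at key
  · rw [fromBlocks_transpose, transpose_transpose, hts]
    congr 1
    simp only [transpose_add, transpose_mul, hs, hts, transpose_transpose, Matrix.mul_assoc]

end Blocks

/-- Running time of `invPosDef`. -/
noncomputable def invCost : ℕ → ℕ
  | 0 => 2
  | d + 1 => 1 + 2 * invCost d + 4 * rectCost (2 ^ d) (2 ^ d) (2 ^ d) + 3 * (2 ^ d * 2 ^ d)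

/-- Positive definiteness passes to the leading block and to its Schur complement, so both recursive
calls meet invertible matrices and no pivoting is needed. Symmetry of the result is carried along
for the block formula. -/
theorem runs_invPosDef (d : ℕ) (P : Matrix (I d) (I d) ℚ) :
    Runs (invPosDef d P) (invCost d) fun Q => PosDefQ P → P * Q = 1 ∧ Qᵀ = Q := by
  induction d with
  | zero =>
    unfold invPosDef
    refine Runs.lit (T := 1) (Runs.op (T := 0) (Runs.pure fun h => ⟨?_, rfl⟩))
    have e (p : Matrix Unit Unit ℚ) : (fun _ => 1 : Unit → ℚ) ⬝ᵥ (p *ᵥ fun _ => 1) = p () () := by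
      simp [dotProduct, mulVec]
    have h1 : (0 : ℚ) < (P : Matrix Unit Unit ℚ) () () :=
      (h.2 (fun _ => 1) (fun h0 => one_ne_zero (congrFun h0 ()))).trans_eq (e P)
    funext i j
    change ∑ k : Unit, (P : Matrix Unit Unit ℚ) i k * (1 / (P : Matrix Unit Unit ℚ) () ()) = 1
    rw [Finset.univ_unique, Finset.sum_singleton]
    exact mul_one_div_cancel h1.ne'
  | succ d ih =>
    unfold invPosDef
    refine Runs.le (Runs.lit (Runs.bind (ih _) fun a ha => Runs.mmul (Runs.mmul (Runs.zip
      (Runs.bind (ih _) fun t ht => Runs.mmul (Runs.mmul (Runs.zip (Runs.zip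
        (Runs.pure ?_))))))))) ?_
    · intro h
      let P' : Matrix (I d ⊕ I d) (I d ⊕ I d) ℚ := P
      change PosDefQ P' at h
      obtain ⟨ha, has⟩ := ha h.toBlocks₁₁
      obtain ⟨ht, hts⟩ := ht (h.schur ha has)
      exact h.inverse_fromBlocks ha has ht hts
    · simp only [card_I, invCost]
      omega

theorem rank_lt : (d : ℕ) → (a : I d) → rank d a < 2 ^ d
  | 0, _ => by simp [rank]
  | d + 1, .inl a => by
    have := rank_lt d a
    simp only [rank, pow_succ]
    omega
  | d + 1, .inr a => by
    have := rank_lt d a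
    simp only [rank, pow_succ]
    omega

theorem unrank_rank : (d : ℕ) → (a : I d) → unrank d (rank d a) = a
  | 0, _ => rfl
  | d + 1, .inl a => (if_pos (rank_lt d a)).trans (congrArg Sum.inl (unrank_rank d a))
  | d + 1, .inr a => (if_neg (by simp [rank])).trans (congrArg Sum.inr (by
    rw [rank, Nat.add_sub_cancel_left, unrank_rank d a]))

theorem rank_unrank : (d i : ℕ) → i < 2 ^ d → rank d (unrank d i) = i
  | 0, i, h => by simp [rank] at h ⊢; omega
  | d + 1, i, h => by
    by_cases h' : i < 2 ^ d
    · have e : unrank (d + 1) i = Sum.inl (unrank d i) := if_pos h'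
      rw [e]
      exact rank_unrank d i h'
    · have e : unrank (d + 1) i = Sum.inr (unrank d (i - 2 ^ d)) := if_neg h'
      rw [pow_succ] at h
      have e' := rank_unrank d (i - 2 ^ d) (by omega)
      rw [e]
      change 2 ^ d + rank d (unrank d (i - 2 ^ d)) = i
      omega

section Border

variable {n d : ℕ}

/-- The matrix `P`, bordered by an identity matrix. -/
def border (d : ℕ) (P : Matrix (Fin n) (Fin n) ℚ) : Matrix (I d) (I d) ℚ := fun a b =>
  if h : rank d a < n ∧ rank d b < n then P ⟨rank d a, h.1⟩ ⟨rank d b, h.2⟩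
  else if rank d a = rank d b then 1 else 0

/-- Sums over the indices below `n` and the other ones. -/
theorem sum_I (hn : n ≤ 2 ^ d) (f : I d → ℚ) :
    ∑ a, f a = (∑ i : Fin n, f (unrank d i)) + ∑ a with n ≤ rank d a, f a := by
  rw [← Finset.sum_filter_add_sum_filter_not Finset.univ (fun a => rank d a < n)]
  simp only [not_lt]
  congr 1
  refine Finset.sum_bij' (fun a ha => ⟨rank d a, by simpa using ha⟩) (fun i _ => unrank d i)
    ?_ ?_ ?_ ?_ ?_
  · simp
  · intro i _
    simp [rank_unrank d i (by omega)]
  · intro a _; exact unrank_rank d a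
  · intro i _
    ext
    exact rank_unrank d i (by omega)
  · intro a _; simp only [unrank_rank]

theorem border_unrank (hn : n ≤ 2 ^ d) (P : Matrix (Fin n) (Fin n) ℚ) (i j : Fin n) :
    border d P (unrank d i) (unrank d j) = P i j := by
  have hi := rank_unrank d i (by omega)
  have hj := rank_unrank d j (by omega)
  simp only [border, hi, hj]
  simp

theorem border_unrank_of_le (hn : n ≤ 2 ^ d) (P : Matrix (Fin n) (Fin n) ℚ) (i : Fin n) {a : I d}
    (ha : n ≤ rank d a) : border d P (unrank d i) a = 0 := by
  have hi := rank_unrank d i (by omega)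
  simp only [border, hi]
  rw [dif_neg (by omega), if_neg (by omega)]

theorem border_of_le (P : Matrix (Fin n) (Fin n) ℚ) {a : I d} (ha : n ≤ rank d a) (b : I d) :
    border d P a b = if a = b then 1 else 0 := by
  simp only [border]
  rw [dif_neg (by omega)]
  congr 1
  exact propext ⟨fun h => by rw [← unrank_rank d a, h, unrank_rank], fun h => h ▸ rfl⟩

/-- The bordered form is the orthogonal sum of `P` and a sum of squares. -/
theorem posDefQ_border (hn : n ≤ 2 ^ d) {P : Matrix (Fin n) (Fin n) ℚ} (hP : PosDefQ P) :
    PosDefQ (border d P) := by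
  refine ⟨?_, fun x hx => ?_⟩
  · ext a b
    simp only [border, transpose_apply]
    by_cases h : rank d a < n ∧ rank d b < n
    · rw [dif_pos h, dif_pos h.symm]
      exact congrFun (congrFun hP.1 _) _
    · rw [dif_neg h, dif_neg fun h' => h h'.symm]
      simp only [eq_comm]
  · have e : x ⬝ᵥ (border d P *ᵥ x) = (fun i : Fin n => x (unrank d i)) ⬝ᵥ
        (P *ᵥ fun i => x (unrank d i)) + ∑ a with n ≤ rank d a, x a * x a := by
      simp only [dotProduct, mulVec]
      rw [sum_I hn]
      congr 1
      · refine Finset.sum_congr rfl fun i _ => ?_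
        rw [sum_I hn, Finset.sum_eq_zero (s := Finset.univ.filter _), add_zero]
        · simp only [border_unrank hn]
        · intro a ha
          rw [border_unrank_of_le hn P i (by simpa using ha), zero_mul]
      · refine Finset.sum_congr rfl fun a ha => ?_
        simp only [border_of_le P (by simpa using ha : n ≤ rank d a), ite_mul, one_mul, zero_mul,
          Finset.sum_ite_eq, Finset.mem_univ, if_true]
    rw [e]
    have h0 : 0 ≤ ∑ a with n ≤ rank d a, x a * x a :=
      Finset.sum_nonneg fun a _ => mul_self_nonneg _
    by_cases hy : (fun i : Fin n => x (unrank d i)) = 0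
    · rw [hy, zero_dotProduct, zero_add]
      obtain ⟨a, ha⟩ := Function.ne_iff.1 hx
      have hna : n ≤ rank d a := by
        by_contra hlt
        have := congrFun hy ⟨rank d a, by omega⟩
        rw [unrank_rank] at this
        exact ha this
      exact Finset.sum_pos' (fun a _ => mul_self_nonneg _)
        ⟨a, by simpa using hna, mul_self_pos.2 ha⟩
    · exact add_pos_of_pos_of_nonneg (hP.2 _ hy) h0

theorem mul_submatrix_of_border (hn : n ≤ 2 ^ d) {P : Matrix (Fin n) (Fin n) ℚ}
    {Q : Matrix (I d) (I d) ℚ} (h : border d P * Q = 1) :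
    P * Q.submatrix (fun i : Fin n => unrank d i) (fun i : Fin n => unrank d i) = 1 := by
  ext i j
  have := congrFun (congrFun h (unrank d i)) (unrank d j)
  rw [mul_apply, sum_I hn, Finset.sum_eq_zero (s := Finset.univ.filter _), add_zero] at this
  · simp only [border_unrank hn] at this
    rw [mul_apply]
    simp only [submatrix_apply]
    rw [this, one_apply, one_apply]
    congr 1
    refine propext ⟨fun h => ?_, fun h => h ▸ rfl⟩
    ext
    rw [← rank_unrank d i (by omega), h, rank_unrank d j (by omega)]
  · intro a ha
    rw [border_unrank_of_le hn P i (by simpa using ha), zero_mul]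

end Border

/-- Here `xᵀ A A x = |A x|²`. This is how an indefinite Gram matrix becomes accessible to inversion
without pivoting. -/
theorem posDefQ_mul_self {n : ℕ} {A : Matrix (Fin n) (Fin n) ℚ} (hA : Aᵀ = A) (hdet : A.det ≠ 0) :
    PosDefQ (A * A) := by
  refine ⟨by rw [transpose_mul, hA], fun x hx => ?_⟩
  have e : x ⬝ᵥ ((A * A) *ᵥ x) = (A *ᵥ x) ⬝ᵥ (A *ᵥ x) := by
    rw [← mulVec_mulVec, dotProduct_mulVec, ← mulVec_transpose, hA]
  rw [e]
  have hne : A *ᵥ x ≠ 0 := fun h => hx (eq_zero_of_mulVec_eq_zero hdet h)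
  obtain ⟨i, hi⟩ := Function.ne_iff.1 hne
  exact Finset.sum_pos' (fun i _ => mul_self_nonneg _) ⟨i, by simp, mul_self_pos.2 hi⟩

/-- Running time of `inverse`. -/
noncomputable def inverseCost (n : ℕ) : ℕ := 2 + 2 * rectCost n n n + invCost (Nat.clog 2 n)

theorem runs_inverse {n : ℕ} (A : Matrix (Fin n) (Fin n) ℚ) :
    Runs (inverse A) (inverseCost n) fun B => Aᵀ = A → A.det ≠ 0 → B = A⁻¹ := by
  unfold inverse
  refine Runs.le (Runs.lit (Runs.lit (Runs.mmul (Runs.bind (runs_invPosDef _ _) fun Q hQ =>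
    Runs.of_bind_pure (Runs.mmul (Runs.pure ?_)))))) ?_
  · intro hA hdet
    have hn : n ≤ 2 ^ Nat.clog 2 n := Nat.le_pow_clog (by norm_num) n
    have h1 := (hQ (posDefQ_border hn (posDefQ_mul_self hA hdet))).1
    have h2 := mul_submatrix_of_border hn h1
    symm
    apply inv_eq_left_inv
    have h3 := mul_eq_one_comm.1 h2
    rwa [← Matrix.mul_assoc] at h3
  · simp only [Fintype.card_fin, inverseCost]
    omega

/-! ## Echelon form -/

section Echelon

variable {F : Type*} [Field F] {n : ℕ}

/-- `R` is row equivalent to `E`, and reduced in the columns listed in `l`, with pivots `piv`. -/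
structure EchelonIn (E R : Matrix (Fin n) (Fin n) F) (l : List (Fin n))
    (piv : List (Fin n × Fin n)) : Prop where
  ker : ∀ x, R *ᵥ x = 0 ↔ E *ᵥ x = 0
  pivot : ∀ q ∈ piv, ∀ k, R k q.2 = if k = q.1 then 1 else 0
  rows : (piv.map Prod.fst).Nodup
  cols : (piv.map Prod.snd).Nodup
  mem : ∀ q ∈ piv, q.2 ∈ l
  zero : ∀ j ∈ l, ∀ i ∉ piv.map Prod.fst, R i j = 0

theorem EchelonIn.nil (E : Matrix (Fin n) (Fin n) F) : EchelonIn E E [] [] :=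
  ⟨fun _ => Iff.rfl, by simp, by simp, by simp, by simp, by simp⟩

variable {E R : Matrix (Fin n) (Fin n) F} {l : List (Fin n)} {piv : List (Fin n × Fin n)}

theorem EchelonIn.skip (h : EchelonIn E R l piv) {j : Fin n}
    (hj : ∀ i ∉ piv.map Prod.fst, R i j = 0) : EchelonIn E R (l ++ [j]) piv where
  ker := h.ker
  pivot := h.pivot
  rows := h.rows
  cols := h.cols
  mem q hq := by simp [h.mem q hq]
  zero k hk i hi := by
    rcases List.mem_append.1 hk with hk | hk
    · exact h.zero k hk i hi
    · rw [List.mem_singleton.1 hk]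
      exact hj i hi

/-- The elimination step with pivot position `(i, j)`; `c` is the inverse of the pivot. -/
def eliminate (R : Matrix (Fin n) (Fin n) F) (i j : Fin n) (c : F) : Matrix (Fin n) (Fin n) F :=
  fun k l => if k = i then R i l * c else R k l - R k j * (R i l * c)

theorem eliminate_mulVec (R : Matrix (Fin n) (Fin n) F) (i j : Fin n) (c : F) (x : Fin n → F)
    (k : Fin n) : (eliminate R i j c *ᵥ x) k =
      if k = i then (R *ᵥ x) i * c else (R *ᵥ x) k - R k j * ((R *ᵥ x) i * c) := by
  simp only [mulVec, dotProduct, eliminate]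
  split_ifs with h
  · rw [Finset.sum_mul]
    exact Finset.sum_congr rfl fun l _ => by ring
  · rw [Finset.sum_mul, Finset.mul_sum, ← Finset.sum_sub_distrib]
    exact Finset.sum_congr rfl fun l _ => by ring

theorem EchelonIn.eliminate (h : EchelonIn E R l piv) {i j : Fin n} {c : F} (hj : j ∉ l)
    (hi : i ∉ piv.map Prod.fst) (hc : R i j * c = 1) :
    EchelonIn E (eliminate R i j c) (l ++ [j]) ((i, j) :: piv) where
  ker x := by
    rw [← h.ker]
    have hc0 : c ≠ 0 := right_ne_zero_of_mul_eq_one hc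
    constructor
    · intro h0
      have hi0 : (R *ᵥ x) i = 0 := by
        have := congrFun h0 i
        rw [eliminate_mulVec, if_pos rfl] at this
        exact (mul_eq_zero.1 this).resolve_right hc0
      funext k
      have := congrFun h0 k
      rw [eliminate_mulVec] at this
      by_cases hk : k = i
      · rw [hk, hi0]; rfl
      · rw [if_neg hk, hi0] at this
        simpa using this
    · intro h0
      funext k
      rw [eliminate_mulVec, h0]
      simp
  pivot q hq k := by
    rcases List.mem_cons.1 hq with rfl | hq
    · simp only [MaxLat.eliminate]
      split_ifs with hk
      · exact hc
      · rw [hc, mul_one, sub_self]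
    · have hne : i ≠ q.1 := fun e => hi (by rw [e]; exact List.mem_map_of_mem hq)
      have h0 : R i q.2 = 0 := by rw [h.pivot q hq, if_neg hne]
      simp only [MaxLat.eliminate, h0]
      split_ifs with hk hk' hk'
      · exact (hne (hk ▸ hk')).elim
      · simp
      · rw [h.pivot q hq, if_pos hk']; simp
      · rw [h.pivot q hq, if_neg hk']; simp
  rows := by
    rw [List.map_cons, List.nodup_cons]
    exact ⟨hi, h.rows⟩
  cols := by
    rw [List.map_cons, List.nodup_cons]
    refine ⟨fun hm => hj ?_, h.cols⟩
    obtain ⟨q, hq, rfl⟩ := List.mem_map.1 hm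
    exact h.mem q hq
  mem q hq := by
    rcases List.mem_cons.1 hq with rfl | hq
    · simp
    · simp [h.mem q hq]
  zero k hk m hm := by
    simp only [List.map_cons, List.mem_cons, not_or] at hm
    simp only [MaxLat.eliminate, if_neg hm.1]
    rcases List.mem_append.1 hk with hk | hk
    · rw [h.zero k hk m hm.2, h.zero k hk i hi]; simp
    · rw [List.mem_singleton.1 hk, hc, mul_one, sub_self]

/-- The vector `v` is supported on the indices in `act`. -/
def SuppOn (act : List (Fin n)) (v : Fin n → F) : Prop := ∀ k ∉ act, v k = 0

/-- The matrix `E` defines a nondegenerate form on the span of the basis vectors in `act`. -/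
def NonDeg (E : Matrix (Fin n) (Fin n) F) (act : List (Fin n)) : Prop :=
  ∀ v, SuppOn act v → (∀ k ∈ act, (E *ᵥ v) k = 0) → v = 0

theorem EchelonIn.mulVec_pivot (h : EchelonIn E R l piv) {x : Fin n → F}
    (hx : SuppOn (piv.map Prod.snd) x) {q : Fin n × Fin n} (hq : q ∈ piv) :
    (R *ᵥ x) q.1 = x q.2 := by
  simp only [mulVec, dotProduct]
  rw [Finset.sum_eq_single q.2]
  · rw [h.pivot q hq, if_pos rfl, one_mul]
  · intro b _ hb
    by_cases hbm : b ∈ piv.map Prod.snd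
    · obtain ⟨q', hq', rfl⟩ := List.mem_map.1 hbm
      have : q.1 ≠ q'.1 := fun e => hb (by
        rw [List.inj_on_of_nodup_map h.rows hq hq' e])
      rw [h.pivot q' hq', if_neg this, zero_mul]
    · rw [hx b hbm, mul_zero]
  · simp

/-- Modulo the kernel of `E` every vector can be replaced by one supported on the pivot columns. A
vector orthogonal to the pivot basis vectors is therefore orthogonal to everything; if it is itself
supported there, its coordinates can be read off from `R *ᵥ v = 0`. -/
theorem EchelonIn.nonDeg (h : EchelonIn E R l piv) (hl : ∀ j, j ∈ l) (hE : Eᵀ = E) :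
    NonDeg E (piv.map Prod.snd) := by
  intro v hv hEv
  have hnot : ∀ (x : Fin n → F) (i : Fin n), i ∉ piv.map Prod.fst → (R *ᵥ x) i = 0 := by
    intro x i hi
    simp only [mulVec, dotProduct]
    exact Finset.sum_eq_zero fun j _ => by rw [h.zero j (hl j) i hi, zero_mul]
  have hspan : ∀ y : Fin n → F, ∃ x, SuppOn (piv.map Prod.snd) x ∧ E *ᵥ x = E *ᵥ y := by
    intro y
    classical
    let x : Fin n → F := fun j =>
      if hj : ∃ q ∈ piv, q.2 = j then (R *ᵥ y) hj.choose.1 else 0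
    have hxs : SuppOn (piv.map Prod.snd) x := fun k hk => dif_neg fun ⟨q, hq, e⟩ =>
      hk (List.mem_map.2 ⟨q, hq, e⟩)
    have hx : ∀ q ∈ piv, x q.2 = (R *ᵥ y) q.1 := fun q hq => by
      have hex : ∃ q' ∈ piv, q'.2 = q.2 := ⟨q, hq, rfl⟩
      have : hex.choose = q :=
        List.inj_on_of_nodup_map h.cols hex.choose_spec.1 hq hex.choose_spec.2
      simp only [x, dif_pos hex, this]
    refine ⟨x, hxs, sub_eq_zero.1 ?_⟩
    rw [← mulVec_sub, ← h.ker, mulVec_sub, sub_eq_zero]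
    funext i
    by_cases hi : i ∈ piv.map Prod.fst
    · obtain ⟨q, hq, rfl⟩ := List.mem_map.1 hi
      rw [h.mulVec_pivot hxs hq, hx q hq]
    · rw [hnot x i hi, hnot y i hi]
  have hEv0 : E *ᵥ v = 0 := by
    refine dotProduct_eq_zero _ fun y => ?_
    obtain ⟨x, hx, e⟩ := hspan y
    have e1 (w : Fin n → F) : (E *ᵥ v) ⬝ᵥ w = v ⬝ᵥ (E *ᵥ w) := by
      rw [dotProduct_mulVec, ← mulVec_transpose, hE]
    rw [e1, ← e, ← e1]
    refine Finset.sum_eq_zero fun k _ => ?_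
    by_cases hk : k ∈ piv.map Prod.snd
    · rw [hEv k hk, zero_mul]
    · rw [hx k hk, mul_zero]
  have hRv := (h.ker v).2 hEv0
  funext k
  by_cases hk : k ∈ piv.map Prod.snd
  · obtain ⟨q, hq, rfl⟩ := List.mem_map.1 hk
    rw [← h.mulVec_pivot hv hq, hRv]; rfl
  · exact hv k hk

end Echelon

theorem outer_mul_apply {ι κ : Type*} {R : Type*} [CommSemiring R] (A : Matrix ι Unit R)
    (B : Matrix Unit κ R) (i : ι) (j : κ) : (A * B) i j = A i () * B () j := by
  simp [mul_apply]

theorem Rep.outer {N : ℕ} {ι κ : Type*} {A : Matrix ι Unit ℚ} {B : Matrix Unit κ ℚ} {i : ι}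
    {j : κ} {a b : ZMod N} (hA : Rep (A i ()) a) (hB : Rep (B () j) b) :
    Rep ((A * B) i j) (a * b) := by
  rw [outer_mul_apply]
  exact hA.mul hB

theorem mul_pow_sub_two {p : ℕ} [hp : Fact p.Prime] {a : ZMod p} (ha : a ≠ 0) :
    a * a ^ (p - 2) = 1 := by
  rw [← pow_succ', ← ZMod.pow_card_sub_one_eq_one ha]
  congr 1
  have := hp.out.two_le
  omega

/-- Running time of `echelon`. -/
noncomputable def echelonCost (p n : ℕ) : ℕ :=
  3 + n * (3 * n + 4 * p.size + rectCost n 1 n + 2 * (n * n))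

theorem runs_echelon {p : ℕ} [hp : Fact p.Prime] {n : ℕ} (A : Matrix (Fin n) (Fin n) ℚ) :
    Runs (echelon p A) (echelonCost p n) fun r => ∀ E : Matrix (Fin n) (Fin n) (ZMod p),
      A = E.map red → Eᵀ = E → (r.2.map Prod.snd).Nodup ∧ NonDeg E (r.2.map Prod.snd) := by
  have hp2 := hp.out.two_le
  unfold echelon
  refine Runs.le (Runs.lit (Runs.lit (Runs.lit (Runs.mono (Runs.foldlM
    (c := fun _ => 3 * n + 4 * p.size + rectCost n 1 n + 2 * (n * n))
    (fun l s => ∀ E : Matrix (Fin n) (Fin n) (ZMod p), A = E.map red →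
      ∃ R, s.1 = R.map red ∧ EchelonIn E R l s.2) ?_ ?_) le_rfl ?_)))) ?_
  · rintro l₁ j l₂ ⟨R, piv⟩ hl hI
    -- Each column is visited once, which keeps the pivot columns distinct.
    have hj : j ∉ l₁ := by
      have := List.nodup_finRange n
      rw [hl] at this
      exact fun h => (List.nodup_append.1 this).2.2 _ h _ (by simp) rfl
    have hfree : ((List.finRange n).filter fun i => i ∉ piv.map Prod.fst).length ≤ n :=
      (List.length_filter_le _ _).trans (by simp)
    refine Runs.le (Runs.bind ((runs_find_ne_zero (fun i => R i j) _).le hfree)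
      (T₂ := 4 * p.size + 2 * n + rectCost n 1 n + 2 * (n * n)) ?_) (by omega)
    rintro (_ | i) hfind
    · refine Runs.le (Runs.pure fun E hE => ?_) (Nat.zero_le _)
      obtain ⟨R', hR, h⟩ := hI E hE
      refine ⟨R', hR, h.skip fun i hi => ?_⟩
      have := hfind.2 rfl i (by simpa using hi)
      simp only at hR
      rwa [hR, map_apply, red_eq_zero] at this
    · have hi := hfind.1 i rfl
      refine Runs.le (Runs.bind (runs_power_mod (by omega) _ _) fun c hc => Runs.each (Runs.each
        (Runs.mmul (Runs.zip (Runs.each (Runs.pure ?_)))))) ?_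
      · intro E hE
        obtain ⟨R', hR, h⟩ := hI E hE
        simp only at hR
        subst hR
        have hi0 : R' i j ≠ 0 := fun h0 => hi.2 (by simp [h0])
        refine ⟨eliminate R' i j (R' i j ^ (p - 2)), ?_,
          h.eliminate hj (by simpa using hi.1) (mul_pow_sub_two hi0)⟩
        rw [hc _ rfl]
        have hrow : ∀ k, Op.eval .mod (Op.eval .mul (R'.map red i k) (red (R' i j ^ (p - 2)))) p =
            red (R' i k * R' i j ^ (p - 2)) := fun k => ((Rep.red _).mul (Rep.red _)).mod
        ext k m
        simp only [hrow]
        refine Rep.mod ?_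
        have e : eliminate R' i j (R' i j ^ (p - 2)) k m =
            (if k = i then R' i m * R' i j ^ (p - 2) else R' k m) -
              (if k = i then 0 else R' k j) * (R' i m * R' i j ^ (p - 2)) := by
          simp only [eliminate]
          split_ifs <;> ring
        rw [e]
        refine Rep.sub ?_ (Rep.outer ?_ (Rep.red _))
        · by_cases hk : k = i
          · simp only [if_pos hk]
            exact Rep.red (N := p) _
          · simp only [if_neg hk]
            exact Rep.red (N := p) _
        · by_cases hk : k = i
          · simp only [if_pos hk]
            exact Rep.zero
          · simp only [if_neg hk]
            exact Rep.red (N := p) _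
      · have : (p - 2).size ≤ p.size := Nat.size_le_size (by omega)
        simp only [Fintype.card_fin, Fintype.card_unit]
        omega
  · intro E hE
    exact ⟨E, hE, EchelonIn.nil E⟩
  · intro r hr E hA hE
    obtain ⟨R, -, h⟩ := hr E hA
    exact ⟨h.cols, h.nonDeg (by simp) hE⟩
  · simp [echelonCost]
    omega

/-! ## Adjoining vectors to a lattice -/

theorem size_le_self (k : ℕ) : k.size ≤ k := Nat.size_le.2 Nat.lt_two_pow_self

theorem size_le_mul_size {e p t : ℕ} (h : e < p ^ t) : e.size ≤ t * p.size := by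
  refine Nat.size_le.2 (h.trans_le ?_)
  rw [mul_comm, pow_mul]
  exact Nat.pow_le_pow_left (Nat.lt_size_self p).le t

theorem runs_power_mod_of_eq {N : ℕ} {M : ℚ} (hN : 1 < N) (hM : M = N) (x : ℚ) (e : ℕ) :
    Runs (power (mulMod M) 1 x e) (4 * e.size) fun r =>
      ∀ a : ZMod N, x = red a → r = red (a ^ e) := by
  subst hM
  exact runs_power_mod hN x e

section Adjoin

variable {n : ℕ}

theorem mod_eq_zero_iff {p : ℕ} (hp : 0 < p) {x : ℚ} (hx : ∃ z : ℤ, x = z) :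
    Op.eval .mod x p = 0 ↔ ∃ w : ℤ, x = p * w := by
  have hp' : (p : ℚ) ≠ 0 := by positivity
  constructor
  · intro h
    exact ⟨_, sub_eq_zero.1 h⟩
  · rintro ⟨w, rfl⟩
    simp [Op.eval, hp']

theorem runs_clearPowers {p : ℕ} (hp : 0 < p) (t : ℕ) (x : Matrix (Fin n) Unit ℚ) :
    Runs (clearPowers (p : ℚ) 0 t x) (3 * n * t) fun r =>
      (∀ s i y, r = some (s, i, y) → 1 ≤ s ∧ s ≤ t) ∧
      ∀ c : Matrix (Fin n) Unit ℚ, x = (p : ℚ) ^ t • c → IsInt x → (r = none → IsInt c) ∧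
        ∀ s i y, r = some (s, i, y) → y = (p : ℚ) ^ s • c ∧ IsInt y ∧
          ¬ ∃ w : ℤ, y i () = p * w := by
  have hp' : (p : ℚ) ≠ 0 := by positivity
  induction t generalizing x with
  | zero =>
    unfold clearPowers
    refine Runs.le (Runs.pure ⟨by simp, fun c hx hi => ⟨fun _ => ?_, by simp⟩⟩) (Nat.zero_le _)
    rwa [hx, pow_zero, one_smul] at hi
  | succ t ih =>
    unfold clearPowers
    refine Runs.le (Runs.bind (T₂ := n + 3 * n * t) (Runs.find (c := 2)
      (φ := fun i => Op.eval .mod (x i ()) p ≠ 0) _ fun i _ => ?_) ?_) ?_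
    · exact Runs.op (T := 1) (Runs.test (T := 0) (Runs.pure (by simp)))
    · rintro (_ | i) hfind
      · refine Runs.le (Runs.each (Runs.post (ih _) ?_)) (by simp)
        rintro r ⟨h1, h2⟩
        refine ⟨fun s i y h => ⟨(h1 s i y h).1, (h1 s i y h).2.trans t.le_succ⟩,
          fun c hx hi => h2 c ?_ ?_⟩
        · ext i j
          simp only [Op.eval, hx, Matrix.smul_apply, smul_eq_mul, pow_succ]
          field_simp
        · intro i j
          have h0 := not_not.1 (hfind.2 rfl i (by simp))
          obtain ⟨w, hw⟩ := (mod_eq_zero_iff hp (hi i ())).1 h0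
          refine ⟨w, ?_⟩
          change x i () / p = w
          rw [hw]
          field_simp
      · refine Runs.le (Runs.pure ⟨?_, fun c hx hi => ⟨by simp, ?_⟩⟩) (Nat.zero_le _)
        · intro s i y h
          simp only [Option.some.injEq, Prod.mk.injEq] at h
          omega
        · intro s i' y h
          simp only [Option.some.injEq, Prod.mk.injEq] at h
          obtain ⟨rfl, rfl, rfl⟩ := h
          exact ⟨hx, hi, fun h0 => (hfind.1 i rfl).2 ((mod_eq_zero_iff hp (hi i ())).2 h0)⟩
    · simp only [List.length_finRange]
      ring_nf
      rfl

/-- `1 + U * W` is a basis of a lattice containing `ℤ ^ n` and the columns of `C`, with inverse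
matrix `1 + U' * W`. -/
structure Adjoined {κ ι : Type*} [Fintype ι] (C : Matrix (Fin n) κ ℚ) (U U' : Matrix (Fin n) ι ℚ)
    (W : Matrix ι (Fin n) ℚ) : Prop where
  mul_inv : (1 + U * W) * (1 + U' * W) = 1
  isInt : IsInt (1 + U' * W)
  isInt_mul : IsInt ((1 + U' * W) * C)

theorem Adjoined.zero {κ ι : Type*} [Fintype ι] {C : Matrix (Fin n) κ ℚ} (hC : IsInt C) :
    Adjoined C (0 : Matrix (Fin n) ι ℚ) 0 0 where
  mul_inv := by simp
  isInt := by simpa using IsInt.one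
  isInt_mul := by simpa using hC

/-- The matrix `1 + u W` puts the fractional part `y` of `l c` in place of the `i`-th unit vector.
Since `y_i = 1 / p ^ t`, it has determinant `1 / p ^ t`, and the formula for rank-one updates gives
the inverse with `u' = -p ^ t u`, which is integral. The column `c` itself is recovered because `l`
inverts `p ^ t c_i` modulo `p ^ t`. -/
theorem Adjoined.column {p t : ℕ} (hp : 1 < p) (ht : 1 ≤ t) {c : Matrix (Fin n) Unit ℚ} {i : Fin n}
    (hx : IsInt ((p : ℚ) ^ t • c)) {l : ℤ}
    (hl : ∃ w : ℤ, (p : ℚ) ^ t * c i () * l = 1 + p ^ t * w)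
    {u u' : Matrix (Fin n) Unit ℚ} {W : Matrix Unit (Fin n) ℚ}
    (hu : ∀ j, u j () = c j () * l - ⌊c j () * l⌋ - if j = i then 1 else 0)
    (hu' : u' = -(p : ℚ) ^ t • u) (hW : ∀ j, W () j = if j = i then 1 else 0) :
    Adjoined c u u' W := by
  obtain ⟨w, hw⟩ := hl
  have hP : (0 : ℚ) < (p : ℚ) ^ t := by positivity
  have hP1 : (1 : ℚ) < (p : ℚ) ^ t := one_lt_pow₀ (by exact_mod_cast hp) (by omega)
  -- The `i`-th entry of `l c` is `1 / p ^ t` modulo `1`, and `t ≥ 1` makes this its fractional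
  -- part.
  have hci : c i () * l = w + 1 / (p : ℚ) ^ t := by
    field_simp
    linear_combination hw
  have hfl : ⌊c i () * l⌋ = w := by
    rw [hci, Int.floor_intCast_add, Int.floor_eq_zero_iff.2, add_zero]
    exact ⟨by positivity, by rw [div_lt_one hP]; exact hP1⟩
  have hui : u i () = 1 / (p : ℚ) ^ t - 1 := by
    rw [hu, hfl, hci, if_pos rfl]
    ring
  have hWx (κ : Type) (B : Matrix (Fin n) κ ℚ) (k : κ) : (W * B) () k = B i k := by
    rw [mul_apply]
    simp [hW]
  have hWu' : W * u' = ((p : ℚ) ^ t - 1) • (1 : Matrix Unit Unit ℚ) := by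
    ext a b
    rw [hWx, hu']
    simp only [Matrix.smul_apply, one_apply_eq, hui, smul_eq_mul]
    field_simp
    ring
  have hfin (j : Fin n) : ∃ z : ℤ, u' j () = z := by
    obtain ⟨z, hz⟩ := hx j ()
    simp only [Matrix.smul_apply, smul_eq_mul] at hz
    refine ⟨-(z * l - p ^ t * ⌊c j () * l⌋ - p ^ t * if j = i then 1 else 0), ?_⟩
    rw [hu']
    simp only [Matrix.smul_apply, smul_eq_mul, hu]
    push_cast
    rw [← hz]
    split_ifs <;> ring
  refine ⟨?_, ?_, ?_⟩
  · have e : (1 + u * W) * (1 + u' * W) = 1 + (u + u' + u * (W * u')) * W := by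
      simp only [Matrix.mul_add, Matrix.add_mul, Matrix.mul_one, Matrix.one_mul,
        Matrix.mul_assoc]
      abel
    rw [e, hWu', hu', Matrix.mul_smul, Matrix.mul_one, sub_smul, neg_smul, one_smul]
    convert add_zero (1 : Matrix (Fin n) (Fin n) ℚ) using 2
    convert Matrix.zero_mul W using 2
    abel
  · refine IsInt.one.add (IsInt.mul (fun j _ => hfin j) fun _ j => ?_)
    exact ⟨if j = i then 1 else 0, by rw [hW]; split_ifs <;> simp⟩
  · intro j _
    obtain ⟨z, hz⟩ := hx j ()
    obtain ⟨zi, hzi⟩ := hx i ()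
    simp only [Matrix.smul_apply, smul_eq_mul] at hz hzi
    have e : ((1 + u' * W) * c : Matrix (Fin n) Unit ℚ) j () = c j () + u' j () * c i () := by
      rw [Matrix.add_mul, Matrix.one_mul, Matrix.mul_assoc, Matrix.add_apply, outer_mul_apply, hWx]
    -- The term `c_j - p ^ t c_j l c_i` equals `-w p ^ t c_j` by the choice of `l`; the rest is `p ^
    -- t c_i` times an integer.
    refine ⟨-w * z + zi * ⌊c j () * l⌋ + zi * if j = i then 1 else 0, ?_⟩
    change ((1 + u' * W) * c : Matrix (Fin n) Unit ℚ) j () = _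
    rw [e, hu']
    simp only [Matrix.smul_apply, smul_eq_mul, hu]
    push_cast
    rw [← hz, ← hzi]
    split_ifs
    · linear_combination -(c j ()) * hw
    · linear_combination -(c j ()) * hw

/-- Bases multiply: once `C₁` is adjoined, `C₂` has coordinates `(1 + U₁' W₁) C₂` in the new basis,
and its adjunction is composed with the first. A product of two updates `1 + U W` is again such an
update, with the factors placed side by side. -/
theorem Adjoined.append {κ κ' ι ι' : Type*} [Fintype ι] [Fintype ι'] {C₁ : Matrix (Fin n) κ ℚ}
    {C₂ : Matrix (Fin n) κ' ℚ} {U₁ U₁' : Matrix (Fin n) ι ℚ} {W₁ : Matrix ι (Fin n) ℚ}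
    {U₂ U₂' : Matrix (Fin n) ι' ℚ} {W₂ : Matrix ι' (Fin n) ℚ} (h₁ : Adjoined C₁ U₁ U₁' W₁)
    (h₂ : Adjoined (C₂ + U₁' * (W₁ * C₂)) U₂ U₂' W₂) :
    Adjoined (fromCols C₁ C₂) (fromCols U₁ (U₂ + U₁ * (W₁ * U₂)))
      (fromCols (U₁' + U₂' * (W₂ * U₁')) U₂') (fromRows W₁ W₂) := by
  have e₁ : 1 + fromCols U₁ (U₂ + U₁ * (W₁ * U₂)) * fromRows W₁ W₂ =
      (1 + U₁ * W₁) * (1 + U₂ * W₂) := by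
    rw [fromCols_mul_fromRows]
    simp only [Matrix.mul_add, Matrix.add_mul, Matrix.mul_one, Matrix.one_mul, Matrix.mul_assoc]
    abel
  have e₂ : 1 + fromCols (U₁' + U₂' * (W₂ * U₁')) U₂' * fromRows W₁ W₂ =
      (1 + U₂' * W₂) * (1 + U₁' * W₁) := by
    rw [fromCols_mul_fromRows]
    simp only [Matrix.mul_add, Matrix.add_mul, Matrix.mul_one, Matrix.one_mul, Matrix.mul_assoc]
    abel
  have e₃ : (1 + U₁' * W₁) * C₂ = C₂ + U₁' * (W₁ * C₂) := by
    rw [Matrix.add_mul, Matrix.one_mul, Matrix.mul_assoc]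
  refine ⟨?_, ?_, ?_⟩
  · rw [e₁, e₂, Matrix.mul_assoc, ← Matrix.mul_assoc (1 + U₂ * W₂), h₂.mul_inv, Matrix.one_mul,
      h₁.mul_inv]
  · rw [e₂]
    exact h₂.isInt.mul h₁.isInt
  · rw [e₂, mul_fromCols, Matrix.mul_assoc, Matrix.mul_assoc, e₃]
    rintro i (j | j)
    · exact (h₂.isInt.mul h₁.isInt_mul) i j
    · exact h₂.isInt_mul i j

/-- Running time of `adjoin`, for a given running time in the case of one column. -/
noncomputable def adjoinCost (n leaf : ℕ) : ℕ → ℕ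
  | 0 => leaf
  | d + 1 => 2 * adjoinCost n leaf d +
      3 * (rectCost (2 ^ d) n (2 ^ d) + rectCost n (2 ^ d) (2 ^ d) + n * 2 ^ d)

/-- Running time of `adjoin` for one column. -/
def leafCost (n p k : ℕ) : ℕ := 5 + 5 * n + 3 * n * k + 4 * k + 4 * (k * p.size)

theorem runs_applyUpdate {α ι κ : Type} [Fintype ι] [Fintype κ] {T : ℕ} {Post : α → Prop}
    {U : Matrix (Fin n) ι ℚ} {W : Matrix ι (Fin n) ℚ} {X : Matrix (Fin n) κ ℚ}
    {F : Matrix (Fin n) κ ℚ → Prog ℚ α} (h : Runs (F (X + U * (W * X))) T Post) :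
    Runs (applyUpdate U W X >>= F)
      (rectCost (Fintype.card ι) n (Fintype.card κ) + rectCost n (Fintype.card ι) (Fintype.card κ) +
        n * Fintype.card κ + T) Post := by
  refine Runs.le (Runs.bind (Q := fun Y => Y = X + U * (W * X)) (T₂ := T) (Runs.mmul (Runs.mmul
    (Runs.of_bind_pure (Runs.zip (Runs.pure rfl))))) ?_) ?_
  · rintro _ rfl
    exact h
  · simp only [Fintype.card_fin]
    omega

theorem runs_adjoin_column {p : ℕ} [hp : Fact p.Prime] (k : ℕ) (C : Matrix (Fin n) (I 0) ℚ) :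
    Runs (adjoin p k 0 C) (leafCost n p k) fun r =>
      IsInt ((p : ℚ) ^ k • C) → Adjoined C r.1 r.2.1 r.2.2 := by
  have hp2 := hp.out.two_le
  have hk := size_le_self k
  unfold adjoin
  refine Runs.le (Runs.lit (Runs.lit (Runs.lit (runs_power_mul (Runs.each (Runs.bind
    (runs_clearPowers hp.out.pos k _) (T₂ := 2 + 4 * n + 2 * k + 4 * (k * p.size)) ?_)))))) ?_
  · rintro (_ | ⟨t, i, x⟩) ⟨h1, h2⟩
    · refine Runs.le (Runs.pure fun hC => ?_) (Nat.zero_le _)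
      refine Adjoined.zero (ι := I 0) ?_
      refine ((h2 C ?_ ?_).1 rfl)
      · ext i j
        exact mul_comm _ _
      · intro i j
        obtain ⟨z, hz⟩ := hC i j
        exact ⟨z, by rw [← hz]; exact mul_comm _ _⟩
    · obtain ⟨ht1, htk⟩ := h1 t i x rfl
      have hpt : 1 < p ^ t := Nat.one_lt_pow (by omega) (by omega)
      have : NeZero (p ^ t) := ⟨by omega⟩
      have hcast : (p : ℚ) ^ t = (p ^ t : ℕ) := by push_cast; rfl
      refine Runs.le (runs_power_mul (Runs.op (Runs.bind
        (runs_power_mod_of_eq hpt hcast _ _) fun l hl =>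
        Runs.each (Runs.each (Runs.zip (Runs.op (Runs.each (Runs.pure ?_)))))))) ?_
      · intro hC
        obtain ⟨hx, hxi, hxp⟩ := (h2 C (by
          ext i j
          exact mul_comm _ _) (fun i j => by
          obtain ⟨z, hz⟩ := hC i j
          exact ⟨z, by rw [← hz]; exact mul_comm _ _⟩)).2 t i x rfl
        obtain ⟨z, hz⟩ := hxi i ()
        have hr : Op.eval .mod (x i ()) ((p : ℚ) ^ t) = red (z : ZMod (p ^ t)) := by
          rw [hcast, hz]
          exact (Rep.int z).mod
        have hl' := hl _ hr
        set a : ZMod (p ^ t) := (z : ZMod (p ^ t)) with ha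
        -- The exponent is `φ(p ^ t) - 1`, so Euler's theorem gives the inverse of a unit.
        have hinv : (z : ZMod (p ^ t)) * a ^ (p ^ (t - 1) * (p - 1) - 1) = 1 := by
          have hcop : IsCoprime z (p ^ t : ℕ) := by
            have h1 : IsCoprime z (p : ℤ) :=
              (((Nat.prime_iff_prime_int.1 hp.out).coprime_iff_not_dvd).2 fun ⟨w, hw⟩ =>
                hxp ⟨w, by rw [hz, hw]; push_cast; rfl⟩).symm
            push_cast
            exact h1.pow_right
          have hu : IsUnit (z : ZMod (p ^ t)) := (ZMod.coe_int_isUnit_iff_isCoprime _ _).2 hcop.symm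
          obtain ⟨v, hv⟩ := hu
          rw [ha, ← hv, ← pow_succ']
          have hφ : p ^ (t - 1) * (p - 1) - 1 + 1 = Nat.totient (p ^ t) := by
            rw [Nat.totient_prime_pow hp.out (by omega)]
            have : 0 < p ^ (t - 1) * (p - 1) := Nat.mul_pos (pow_pos hp.out.pos _) (by omega)
            omega
          rw [hφ, ← Units.val_pow_eq_pow_val, ZMod.pow_totient, Units.val_one]
        set b := a ^ (p ^ (t - 1) * (p - 1) - 1)
        refine Adjoined.column (i := i) (l := (b.val : ℤ)) (by omega) ht1 (hx ▸ hxi) ?_ ?_ ?_ ?_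
        · have h3 : ((z * b.val - 1 : ℤ) : ZMod (p ^ t)) = 0 := by
            push_cast
            rw [ZMod.natCast_zmod_val, hinv, sub_self]
          obtain ⟨w, hw⟩ := (ZMod.intCast_zmod_eq_zero_iff_dvd _ _).1 h3
          refine ⟨w, ?_⟩
          have h4 : (p : ℚ) ^ t * C i () = z := by
            rw [← hz, hx]; rfl
          rw [h4]
          have h5 : ((z * b.val - 1 : ℤ) : ℚ) = ((((p ^ t : ℕ) : ℤ) * w : ℤ) : ℚ) := by rw [hw]
          push_cast at h5 ⊢
          linear_combination h5
        · intro j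
          have : l = ((b.val : ℤ) : ℚ) := by rw [hl']; simp [red]
          rw [← this]
          simp only [Op.eval, div_one, one_mul]
        · funext j k
          exact (mul_comm _ _).trans (congrArg (· * _) (zero_sub ((p : ℚ) ^ t)))
        · intro j
          rfl
      · have e1 : t.size ≤ k := (size_le_self t).trans htk
        have e2 : (p ^ (t - 1) * (p - 1) - 1).size ≤ k * p.size := by
          refine (size_le_mul_size (t := t) ?_).trans (Nat.mul_le_mul_right _ htk)
          have h1 : p ^ (t - 1) * (p - 1) ≤ p ^ (t - 1) * p := Nat.mul_le_mul_left _ (by omega)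
          rw [← pow_succ, Nat.sub_add_cancel ht1] at h1
          omega
        simp only [Fintype.card_fin, Fintype.card_unit, mul_one]
        omega
  · simp only [leafCost, Fintype.card_fin, Fintype.card_unit, mul_one]
    omega

theorem runs_adjoin {p : ℕ} [hp : Fact p.Prime] (k d : ℕ) (C : Matrix (Fin n) (I d) ℚ) :
    Runs (adjoin p k d C) (adjoinCost n (leafCost n p k) d) fun r =>
      IsInt ((p : ℚ) ^ k • C) → Adjoined C r.1 r.2.1 r.2.2 := by
  induction d with
  | zero => exact runs_adjoin_column k C
  | succ d ih =>
    unfold adjoin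
    refine Runs.le (Runs.bind (ih _) (T₂ := adjoinCost n (leafCost n p k) d +
      3 * (rectCost (2 ^ d) n (2 ^ d) + rectCost n (2 ^ d) (2 ^ d) + n * 2 ^ d)) ?_) ?_
    · rintro ⟨U₁, U₁', W₁⟩ h₁
      refine Runs.le (runs_applyUpdate (Runs.bind (ih _) (T₂ :=
        2 * (rectCost (2 ^ d) n (2 ^ d) + rectCost n (2 ^ d) (2 ^ d) + n * 2 ^ d)) ?_)) ?_
      · rintro ⟨U₂, U₂', W₂⟩ h₂
        refine Runs.le (runs_applyUpdate (runs_applyUpdate (Runs.pure ?_))) ?_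
        · intro hC
          let C' : Matrix (Fin n) (I d ⊕ I d) ℚ := C
          have h₁' : Adjoined C'.toCols₁ U₁ U₁' W₁ := h₁ fun i j => hC i (Sum.inl j)
          have h₂' : Adjoined (C'.toCols₂ + U₁' * (W₁ * C'.toCols₂)) U₂ U₂' W₂ := by
            refine h₂ ?_
            -- The denominators of the second half stay bounded by `p ^ k`, since the change of
            -- coordinates is an integral matrix.
            have e : (p : ℚ) ^ k • (C'.toCols₂ + U₁' * (W₁ * C'.toCols₂)) =
                (1 + U₁' * W₁) * ((p : ℚ) ^ k • C'.toCols₂) := by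
              rw [Matrix.add_mul, Matrix.one_mul, Matrix.mul_smul, smul_add, Matrix.mul_assoc]
            change IsInt ((p : ℚ) ^ k • (C'.toCols₂ + U₁' * (W₁ * C'.toCols₂)))
            rw [e]
            exact h₁'.isInt.mul fun i j => hC i (Sum.inr j)
          have h := h₁'.append h₂'
          rw [fromCols_toCols] at h
          exact h
        · simp only [card_I]
          omega
      · simp only [card_I]
        omega
    · simp only [adjoinCost]
      omega

/-- The matrix `C` with zero columns added. -/
def pad (d : ℕ) {h : ℕ} (C : Matrix (Fin n) (Fin h) ℚ) : Matrix (Fin n) (I d) ℚ :=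
  fun i a => if h' : rank d a < h then C i ⟨rank d a, h'⟩ else 0

theorem isInt_smul_pad {d h : ℕ} {C : Matrix (Fin n) (Fin h) ℚ} {c : ℚ} (hC : IsInt (c • C)) :
    IsInt (c • pad d C) := fun i a => by
  rw [Matrix.smul_apply, pad]
  split_ifs with hr
  · exact hC i ⟨_, hr⟩
  · exact ⟨0, by simp⟩

theorem isInt_of_pad {d h : ℕ} (hd : h ≤ 2 ^ d) {C : Matrix (Fin n) (Fin h) ℚ}
    {T : Matrix (Fin n) (Fin n) ℚ} (hT : IsInt (T * pad d C)) : IsInt (T * C) := fun i j => by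
  obtain ⟨z, hz⟩ := hT i (unrank d j)
  refine ⟨z, ?_⟩
  rw [← hz, mul_apply, mul_apply]
  refine Finset.sum_congr rfl fun l _ => ?_
  have hj := rank_unrank d (j : ℕ) (j.2.trans_le hd)
  have hlt : rank d (unrank d j) < h := by rw [hj]; exact j.2
  rw [pad, dif_pos hlt]
  congr 2
  exact Fin.ext hj.symm

/-- Running time of `enlarge`. -/
noncomputable def enlargeCost (n h p k : ℕ) : ℕ :=
  1 + adjoinCost n (leafCost n p k) (Nat.clog 2 h) + rectCost n n (2 ^ Nat.clog 2 h) +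
    rectCost n (2 ^ Nat.clog 2 h) n + n * n

/-- With `T` the matrix of the old basis in the new one, integrality of `T` and `T * C` says that
the new lattice contains the old one and the columns of `S * C`. Only this inclusion is needed for
the invariants. Padding by zero columns up to a power of two is harmless, also for `h = 0`. -/
theorem runs_enlarge {p : ℕ} [hp : Fact p.Prime] (k : ℕ) (S : Matrix (Fin n) (Fin n) ℚ) {h : ℕ}
    (C : Matrix (Fin n) (Fin h) ℚ) :
    Runs (enlarge p k S C) (enlargeCost n h p k) fun S' =>
      IsInt ((p : ℚ) ^ k • C) → ∃ T, S' * T = S ∧ IsInt T ∧ IsInt (T * C) := by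
  unfold enlarge
  refine Runs.le (Runs.lit (Runs.bind (runs_adjoin k _ _) (T₂ :=
    rectCost n n (2 ^ Nat.clog 2 h) + rectCost n (2 ^ Nat.clog 2 h) n + n * n) ?_)) ?_
  · rintro ⟨U, U', W⟩ hU
    refine Runs.le (Runs.mmul (Runs.mmul (Runs.of_bind_pure (Runs.zip (Runs.pure ?_))))) ?_
    · intro hC
      have hd : h ≤ 2 ^ Nat.clog 2 h := Nat.le_pow_clog (by norm_num) h
      obtain ⟨h1, h2, h3⟩ := hU (isInt_smul_pad hC)
      refine ⟨1 + U' * W, ?_, h2, isInt_of_pad hd h3⟩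
      change (S + S * U * W) * (1 + U' * W) = S
      have e : S + S * U * W = S * (1 + U * W) := by
        rw [Matrix.mul_add, Matrix.mul_one, Matrix.mul_assoc]
      rw [e, Matrix.mul_assoc, h1, Matrix.mul_one]
    · simp only [card_I, Fintype.card_fin]
      omega
  · simp only [enlargeCost]
    omega

end Adjoin

/-! ## Counting values of quadratic forms -/

section CharSum

variable {p : ℕ} [hp : Fact p.Prime]

theorem ringChar_zmod_ne_two (hp2 : p ≠ 2) : ringChar (ZMod p) ≠ 2 := by
  rwa [ZMod.ringChar_zmod_n]

/-- Substituting `y = a t` turns the sum into `χ(-1)` times the Jacobi sum of `χ` and `χ⁻¹ = χ`,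
which is `-χ(-1)`. -/
theorem sum_quadraticChar_mul_sub (hp2 : p ≠ 2) {a : ZMod p} (ha : a ≠ 0) :
    ∑ y : ZMod p, quadraticChar (ZMod p) y * quadraticChar (ZMod p) (y - a) = -1 := by
  have hF := ringChar_zmod_ne_two hp2
  set χ := quadraticChar (ZMod p) with hχ
  have hneg : χ (-1) * χ (-1) = 1 := by rw [← map_mul]; simp
  have haa : χ a * χ a = 1 := by
    rw [← sq]; exact quadraticChar_sq_one ha
  have e : ∑ y : ZMod p, χ y * χ (y - a) = ∑ t : ZMod p, χ (a * t) * χ (a * t - a) := by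
    refine (Fintype.sum_bijective (fun t => a * t) (mulLeft_bijective₀ a ha) _ _ fun t => rfl).symm
  have hinv : χ⁻¹ = χ := (quadraticChar_isQuadratic (ZMod p)).inv
  have hj := jacobiSum_nontrivial_inv (quadraticChar_ne_one hF)
  rw [← hχ, hinv, jacobiSum] at hj
  calc _ = ∑ t : ZMod p, χ (-1) * (χ t * χ (1 - t)) := by
        rw [e]
        refine Finset.sum_congr rfl fun t _ => ?_
        have : a * t - a = a * (-1) * (1 - t) := by ring
        rw [this, map_mul, map_mul, map_mul]
        linear_combination (χ t * χ (-1) * χ (1 - t)) * haa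
    _ = -1 := by rw [← Finset.mul_sum, hj]; linear_combination -hneg

/-- An element `y` has `1 + χ(y)` square roots. Grouping by `y = s²` leaves the sum of `χ(y) χ(y -
a)` and the vanishing sum of `χ(y - a)`. -/
theorem sum_quadraticChar_sq_sub (hp2 : p ≠ 2) {a : ZMod p} (ha : a ≠ 0) :
    ∑ s : ZMod p, quadraticChar (ZMod p) (s ^ 2 - a) = -1 := by
  have hF := ringChar_zmod_ne_two hp2
  rw [← sum_quadraticChar_mul_sub hp2 ha]
  rw [← Finset.sum_fiberwise Finset.univ (fun s : ZMod p => s ^ 2)]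
  have hz : ∑ y : ZMod p, quadraticChar (ZMod p) (y - a) = 0 := by
    rw [← quadraticChar_sum_zero hF]
    exact Fintype.sum_bijective (fun y => y - a) (Equiv.subRight a).bijective _ _ fun _ => rfl
  rw [← add_zero (∑ y : ZMod p, _ * _), ← hz, ← Finset.sum_add_distrib]
  refine Finset.sum_congr rfl fun y _ => ?_
  have hc := quadraticChar_card_sqrts hF y
  have hs : ({x : ZMod p | x ^ 2 = y}.toFinset) = Finset.univ.filter fun x => x ^ 2 = y := by
    ext; simp
  rw [hs] at hc
  have : ∑ s with s ^ 2 = y, quadraticChar (ZMod p) (s ^ 2 - a) =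
      ∑ s with s ^ 2 = y, quadraticChar (ZMod p) (y - a) :=
    Finset.sum_congr rfl fun s hs => by rw [(Finset.mem_filter.1 hs).2]
  rw [this, Finset.sum_const, nsmul_eq_mul, hc]
  ring

theorem sum_eq_card_sub_card {ι : Type*} [Fintype ι] (f : ι → ZMod p) :
    ∑ i, quadraticChar (ZMod p) (f i) + 2 * (Finset.univ.filter fun i => ¬ IsSquare (f i)).card =
      Fintype.card ι - (Finset.univ.filter fun i => f i = 0).card := by
  classical
  have h (i : ι) : quadraticChar (ZMod p) (f i) + 2 * (if ¬ IsSquare (f i) then 1 else 0) =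
      1 - if f i = 0 then 1 else 0 := by
    by_cases h0 : f i = 0
    · simp [h0]
    · by_cases hs : IsSquare (f i)
      · simp [(quadraticChar_one_iff_isSquare h0).2 hs, hs, h0]
      · simp [quadraticChar_neg_one_iff_not_isSquare.2 hs, hs, h0]
  have := Finset.sum_congr (rfl : (Finset.univ : Finset ι) = _) fun i _ => h i
  rw [Finset.sum_add_distrib, ← Finset.mul_sum, Finset.sum_sub_distrib] at this
  rw [Finset.sum_boole, Finset.sum_boole, Finset.sum_const, Finset.card_univ] at this
  simpa using this

/-- With `z ≤ 2` zeros and character sum `-1`, the number of nonsquares is `(p + 1 - z) / 2 ≥ (p -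
1) / 2`, which is at least `p / 3` for `p ≥ 3`. Hence three rounds in Cipolla's search. -/
theorem card_nonsquare (hp2 : p ≠ 2) {a : ZMod p} (ha : a ≠ 0) :
    p ≤ 3 * (Finset.univ.filter fun s : ZMod p => ¬ IsSquare (s ^ 2 - a)).card := by
  have h1 := sum_eq_card_sub_card fun s : ZMod p => s ^ 2 - a
  rw [sum_quadraticChar_sq_sub hp2 ha, ZMod.card] at h1
  have h2 : (Finset.univ.filter fun s : ZMod p => s ^ 2 - a = 0).card ≤ 2 := by
    have hF := ringChar_zmod_ne_two hp2
    have hc := quadraticChar_card_sqrts hF a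
    have hs : ({x : ZMod p | x ^ 2 = a}.toFinset) =
        Finset.univ.filter fun x => x ^ 2 - a = 0 := by
      ext; simp [sub_eq_zero]
    rw [hs] at hc
    rcases quadraticChar_dichotomy ha with h | h <;> rw [h] at hc <;> omega
  have := hp.out.two_le
  omega

/-- Multiplying by `A` and completing the square gives the character sum `-χ(A)`, so there are at
most `(p + 1) / 2` nonsquares. The discriminant must not vanish: otherwise the values would be `A`
times squares. -/
theorem card_square_quadratic (hp2 : p ≠ 2) {A B C : ZMod p} (hA : A ≠ 0)
    (hd : B ^ 2 - A * C ≠ 0) :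
    p ≤ 3 * (Finset.univ.filter fun s : ZMod p => IsSquare (A * s ^ 2 + 2 * B * s + C)).card := by
  have h1 := sum_eq_card_sub_card fun s : ZMod p => A * s ^ 2 + 2 * B * s + C
  have hsum : ∑ s : ZMod p, quadraticChar (ZMod p) (A * s ^ 2 + 2 * B * s + C) =
      - quadraticChar (ZMod p) A := by
    have e (s : ZMod p) : quadraticChar (ZMod p) (A * s ^ 2 + 2 * B * s + C) =
        quadraticChar (ZMod p) A * quadraticChar (ZMod p) ((A * s + B) ^ 2 - (B ^ 2 - A * C)) := by
      have : (A * s + B) ^ 2 - (B ^ 2 - A * C) = A * (A * s ^ 2 + 2 * B * s + C) := by ring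
      rw [this, map_mul, ← mul_assoc, ← sq, quadraticChar_sq_one hA, one_mul]
    simp only [e]
    rw [← Finset.mul_sum, Fintype.sum_bijective (fun s => A * s + B)
      ((Equiv.addRight B).bijective.comp (mulLeft_bijective₀ A hA)) _
      (fun z => quadraticChar (ZMod p) (z ^ 2 - (B ^ 2 - A * C))) fun _ => rfl,
      sum_quadraticChar_sq_sub hp2 hd]
    ring
  rw [hsum, ZMod.card] at h1
  have h3 := Finset.card_filter_add_card_filter_not (s := (Finset.univ : Finset (ZMod p)))
    fun s => IsSquare (A * s ^ 2 + 2 * B * s + C)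
  rw [Finset.card_univ, ZMod.card] at h3
  have := hp.out.two_le
  have hA1 : quadraticChar (ZMod p) A ≤ 1 := by
    rcases quadraticChar_dichotomy hA with h | h <;> rw [h]; norm_num
  omega

theorem card_ne_zero_quadratic (hp2 : p ≠ 2) {A B C : ZMod p} (hA : A ≠ 0) :
    p ≤ 3 * (Finset.univ.filter fun s : ZMod p => A * s ^ 2 + 2 * B * s + C ≠ 0).card := by
  have h3 := Finset.card_filter_add_card_filter_not (s := (Finset.univ : Finset (ZMod p)))
    fun s => A * s ^ 2 + 2 * B * s + C = 0
  rw [Finset.card_univ, ZMod.card] at h3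
  have h2 : (Finset.univ.filter fun s : ZMod p => A * s ^ 2 + 2 * B * s + C = 0).card ≤ 2 := by
    have hq : (Polynomial.C A * Polynomial.X ^ 2 + Polynomial.C (2 * B) * Polynomial.X +
        Polynomial.C C).natDegree ≤ 2 := Polynomial.natDegree_quadratic_le
    have hne : (Polynomial.C A * Polynomial.X ^ 2 + Polynomial.C (2 * B) * Polynomial.X +
        Polynomial.C C) ≠ 0 := fun h0 => hA (by
      have := Polynomial.leadingCoeff_quadratic (b := 2 * B) (c := C) hA
      rwa [h0, Polynomial.leadingCoeff_zero, eq_comm] at this)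
    refine le_trans ?_ ((Polynomial.card_roots' _).trans hq)
    refine (Finset.card_le_card ?_).trans (Multiset.toFinset_card_le _)
    intro s hs
    simp only [Finset.mem_filter, Finset.mem_univ, true_and] at hs
    rw [Multiset.mem_toFinset, Polynomial.mem_roots hne]
    simpa [Polynomial.IsRoot] using hs
  have := hp.out.two_le
  have : 3 ≤ p := by omega
  simp only [ne_eq]
  omega

end CharSum

/-! ### Symmetric bilinear forms over the field with `p` elements: values along lines. -/

section Forms

variable {p : ℕ} [hp : Fact p.Prime] {W : Type} [AddCommGroup W] [Module (ZMod p) W]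

/-- Averaging over the lines in direction `u`. -/
theorem card_le_of_lines [Fintype W] (u : W) (S₀ S : W → Prop) [DecidablePred S₀] [DecidablePred S]
    (h : ∀ x, S₀ x → p ≤ 3 * (Finset.univ.filter fun s : ZMod p => S (x + s • u)).card) :
    (Finset.univ.filter S₀).card ≤ 3 * (Finset.univ.filter S).card := by
  -- Translation by `s • u` permutes `W`, so each `s` counts every point of `S` once.
  have e : ∑ x : W, (Finset.univ.filter fun s : ZMod p => S (x + s • u)).card =
      p * (Finset.univ.filter S).card := by
    simp only [Finset.card_filter]
    rw [Finset.sum_comm]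
    have (s : ZMod p) : ∑ x : W, (if S (x + s • u) then 1 else 0) =
        ∑ x : W, if S x then 1 else 0 :=
      Fintype.sum_bijective (fun x => x + s • u) (Equiv.addRight (s • u)).bijective _ _
        fun _ => rfl
    simp [this]
  have h1 : p * (Finset.univ.filter S₀).card ≤
      3 * ∑ x : W, (Finset.univ.filter fun s : ZMod p => S (x + s • u)).card := by
    rw [Finset.mul_sum, mul_comm, ← smul_eq_mul, ← Finset.sum_const]
    refine (Finset.sum_le_sum fun x hx => h x (Finset.mem_filter.1 hx).2).trans ?_
    exact Finset.sum_le_sum_of_subset (Finset.filter_subset _ _)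
  rw [e] at h1
  have hp0 := hp.out.pos
  nlinarith

variable (B : W →ₗ[ZMod p] W →ₗ[ZMod p] ZMod p)

/-- The form `B(x, u) B(y, u) - B(u, u) B(x, y)`. -/
def discForm (u : W) : W →ₗ[ZMod p] W →ₗ[ZMod p] ZMod p :=
  (LinearMap.mul (ZMod p) (ZMod p)).compl₁₂ (B u) (B u) - B u u • B

theorem discForm_apply (u x y : W) : discForm B u x y = B u x * B u y - B u u * B x y := by
  simp [discForm]

variable {B}

theorem discForm_symm (hB : ∀ x y, B x y = B y x) (u x y : W) :
    discForm B u x y = discForm B u y x := by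
  rw [discForm_apply, discForm_apply, hB x y, mul_comm (B u x)]

theorem form_line (hB : ∀ x y, B x y = B y x) (x u : W) (s : ZMod p) :
    B (x + s • u) (x + s • u) = B u u * s ^ 2 + 2 * B u x * s + B x x := by
  simp only [map_add, map_smul, LinearMap.add_apply, LinearMap.smul_apply, smul_eq_mul]
  rw [hB x u]
  ring

/-- Polarization, for odd `p`. -/
theorem form_eq_zero (hp2 : p ≠ 2) (hB : ∀ x y, B x y = B y x) (h : ∀ x, B x x = 0) (x y : W) :
    B x y = 0 := by
  have h1 := form_line hB x y 1
  rw [h, h, h, hB y x] at h1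
  have h2 : (2 : ZMod p) ≠ 0 := by
    intro h0
    have : ((2 : ℕ) : ZMod p) = 0 := by exact_mod_cast h0
    rw [ZMod.natCast_eq_zero_iff] at this
    exact hp2 (Nat.le_antisymm (Nat.le_of_dvd two_pos this) hp.out.two_le)
  have h3 : 2 * B x y = 0 := by linear_combination -h1
  exact (mul_eq_zero.1 h3).resolve_left h2

/-- On every line in direction `u` the form is a polynomial of degree exactly two, with at most two
zeros among at least three points. -/
theorem card_form_ne_zero [Fintype W] (hp2 : p ≠ 2) (hB : ∀ x y, B x y = B y x) {u : W} (hu : B u u ≠ 0) :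
    Fintype.card W ≤ 3 * (Finset.univ.filter fun x => B x x ≠ 0).card := by
  have := card_le_of_lines (p := p) u (fun _ : W => True) (fun x => B x x ≠ 0) fun x _ => by
    simp only [form_line hB]
    exact card_ne_zero_quadratic hp2 hu
  simpa using this

/-- On the line through `x` in direction `u` the form is quadratic with discriminant `4 discForm B u
x x`, a value constant along the line. It is nonzero for a third of all `x`, and then a third of the
points on the line give squares. -/
theorem card_form_square [Fintype W] (hp2 : p ≠ 2) (hB : ∀ x y, B x y = B y x) {u y : W} (hu : B u u ≠ 0)
    (hy : discForm B u y y ≠ 0) :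
    Fintype.card W ≤ 9 *
      (Finset.univ.filter fun x => discForm B u x x ≠ 0 ∧ IsSquare (B x x)).card := by
  have h1 := card_form_ne_zero hp2 (discForm_symm hB u) hy
  have h2 := card_le_of_lines (p := p) u (fun x => discForm B u x x ≠ 0)
    (fun x => discForm B u x x ≠ 0 ∧ IsSquare (B x x)) fun x hx => by
    have e (s : ZMod p) : discForm B u (x + s • u) (x + s • u) = discForm B u x x := by
      rw [form_line (discForm_symm hB u)]
      simp only [discForm_apply]
      ring
    simp only [form_line hB, e, hx, ne_eq, not_false_eq_true, true_and]
    refine card_square_quadratic hp2 hu ?_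
    rw [discForm_apply] at hx
    rwa [sq]
  omega

end Forms

/-! ### Forms on the span of some basis vectors, and the success probability of the random search.
-/

section Act

variable {p : ℕ} [hp : Fact p.Prime] {n : ℕ}

/-- Projection to the span of the basis vectors listed in `act`. -/
def projOn (act : List (Fin n)) : (Fin n → ZMod p) →ₗ[ZMod p] (Fin n → ZMod p) where
  toFun x i := if i ∈ act then x i else 0
  map_add' x y := by ext i; by_cases h : i ∈ act <;> simp [h]
  map_smul' c x := by ext i; by_cases h : i ∈ act <;> simp [h]

theorem projOn_apply (act : List (Fin n)) (x : Fin n → ZMod p) (i : Fin n) :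
    projOn act x i = if i ∈ act then x i else 0 := rfl

theorem projOn_suppOn (act : List (Fin n)) (x : Fin n → ZMod p) : SuppOn act (projOn act x) :=
  fun _ h => if_neg h

theorem projOn_of_suppOn {act : List (Fin n)} {x : Fin n → ZMod p} (hx : SuppOn act x) :
    projOn act x = x := by
  ext i
  rw [projOn_apply]
  split_ifs with h
  · rfl
  · exact (hx i h).symm

/-- The bilinear form with matrix `E` on the span of the basis vectors listed in `act`. -/
noncomputable def formOn (E : Matrix (Fin n) (Fin n) (ZMod p)) (act : List (Fin n)) :
    (Fin n → ZMod p) →ₗ[ZMod p] (Fin n → ZMod p) →ₗ[ZMod p] ZMod p :=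
  (Matrix.toLinearMap₂' (ZMod p) E).compl₁₂ (projOn act) (projOn act)

variable {E : Matrix (Fin n) (Fin n) (ZMod p)} {act : List (Fin n)}

theorem formOn_apply (x y : Fin n → ZMod p) :
    formOn E act x y = projOn act x ⬝ᵥ (E *ᵥ projOn act y) := by
  simp [formOn, Matrix.toLinearMap₂'_apply']

theorem formOn_symm (hE : Eᵀ = E) (x y : Fin n → ZMod p) :
    formOn E act x y = formOn E act y x := by
  rw [formOn_apply, formOn_apply, dotProduct_mulVec, ← mulVec_transpose, hE, dotProduct_comm]

theorem NonDeg.eq_zero (h : NonDeg E act) (hE : Eᵀ = E) {x : Fin n → ZMod p} (hx : SuppOn act x)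
    (h0 : ∀ y, formOn E act x y = 0) : x = 0 := by
  refine h x hx fun k hk => ?_
  have := h0 (Pi.single k 1)
  have hs : SuppOn act (Pi.single k (1 : ZMod p)) := fun i hi =>
    Pi.single_eq_of_ne (fun e : i = k => hi (e ▸ hk)) _
  rw [formOn_symm hE, formOn_apply, projOn_of_suppOn hx, projOn_of_suppOn hs] at this
  simpa using this

/-- More basis vectors than linear conditions. -/
theorem exists_suppOn (hact : act.Nodup) {r : ℕ} (hr : r < act.length)
    (f : Fin r → (Fin n → ZMod p) →ₗ[ZMod p] ZMod p) :
    ∃ x, x ≠ 0 ∧ SuppOn act x ∧ ∀ i, f i x = 0 := by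
  let g : (Fin act.length → ZMod p) →ₗ[ZMod p] (Fin n → ZMod p) :=
    ∑ i, (LinearMap.proj i).smulRight (Pi.single (act.get i) 1)
  have hg (c : Fin act.length → ZMod p) (k : Fin n) :
      g c k = ∑ i, c i * (Pi.single (act.get i) (1 : ZMod p) : Fin n → ZMod p) k := by
    simp [g]
  obtain ⟨c, hc, hc0⟩ := Submodule.exists_mem_ne_zero_of_ne_bot
    (LinearMap.ker_ne_bot_of_finrank_lt (f := (LinearMap.pi f).comp g) (by simpa using hr))
  refine ⟨g c, fun h0 => hc0 ?_, fun k hk => ?_, fun i => ?_⟩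
  · funext i
    have := congrFun h0 (act.get i)
    rw [hg, Finset.sum_eq_single i] at this
    · simpa using this
    · intro j _ hj
      rw [Pi.single_eq_of_ne, mul_zero]
      exact fun e => hj ((List.Nodup.get_inj_iff hact).1 e).symm
    · simp
  · rw [hg]
    refine Finset.sum_eq_zero fun i _ => ?_
    rw [Pi.single_eq_of_ne, mul_zero]
    exact fun e => hk (e ▸ List.get_mem _ _)
  · exact congrFun (LinearMap.mem_ker.1 hc) i

theorem NonDeg.exists_form_ne_zero (h : NonDeg E act) (hp2 : p ≠ 2) (hE : Eᵀ = E)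
    (hact : act.Nodup) (hl : 0 < act.length) : ∃ u, formOn E act u u ≠ 0 := by
  by_contra! hc
  obtain ⟨x, hx0, hx, -⟩ := exists_suppOn (p := p) hact hl (fun i => i.elim0)
  exact hx0 (h.eq_zero hE hx fun y => form_eq_zero hp2 (formOn_symm hE) hc x y)

/-- On vectors orthogonal to `m` the discriminant form is `-B(m, m)` times the given one. In
dimension at least two there is such a vector, and it would lie in the radical if the discriminant
form vanished. -/
theorem NonDeg.exists_discForm_ne_zero (h : NonDeg E act) (hp2 : p ≠ 2) (hE : Eᵀ = E)
    (hact : act.Nodup) (hl : 1 < act.length) {m : Fin n → ZMod p} (hm : formOn E act m m ≠ 0) :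
    ∃ u, discForm (formOn E act) m u u ≠ 0 := by
  by_contra! hc
  obtain ⟨x, hx0, hx, hxm⟩ := exists_suppOn hact hl (fun _ => formOn E act m)
  refine hx0 (h.eq_zero hE hx fun y => ?_)
  have := form_eq_zero hp2 (discForm_symm (formOn_symm hE) m) hc x y
  rw [discForm_apply, hxm 0, zero_mul, zero_sub, neg_eq_zero] at this
  exact (mul_eq_zero.1 this).resolve_left hm

/-- The same descent once more: each discriminant form enlarges the radical by one dimension, so
after two of them something is left in dimension at least three. -/
theorem NonDeg.exists_discForm_discForm_ne_zero (h : NonDeg E act) (hp2 : p ≠ 2) (hE : Eᵀ = E)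
    (hact : act.Nodup) (hl : 2 < act.length) {m u : Fin n → ZMod p}
    (hm : formOn E act m m ≠ 0) (hu : discForm (formOn E act) m u u ≠ 0) :
    ∃ y, discForm (discForm (formOn E act) m) u y y ≠ 0 := by
  by_contra! hc
  obtain ⟨x, hx0, hx, hxm⟩ := exists_suppOn hact hl
    ![formOn E act m, discForm (formOn E act) m u]
  refine hx0 (h.eq_zero hE hx fun y => ?_)
  have h1 : formOn E act m x = 0 := hxm 0
  have h2 : discForm (formOn E act) m u x = 0 := hxm 1
  have h3 := form_eq_zero hp2 (discForm_symm (discForm_symm (formOn_symm hE) m) u) hc x y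
  rw [discForm_apply, h2, zero_mul, zero_sub, neg_eq_zero] at h3
  have h4 := (mul_eq_zero.1 h3).resolve_left hu
  rw [discForm_apply, h1, zero_mul, zero_sub, neg_eq_zero] at h4
  exact (mul_eq_zero.1 h4).resolve_left hm

/-- For the vectors `a`, `m` there is `t` with `a + t m` isotropic and not zero. -/
def GoodPair (E : Matrix (Fin n) (Fin n) (ZMod p)) (act : List (Fin n)) (a m : Fin n → ZMod p) :
    Prop :=
  formOn E act m m ≠ 0 ∧ IsSquare (discForm (formOn E act) m a a) ∧
    ∀ t : ZMod p, projOn act (a + t • m) ≠ 0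

theorem formOn_eq_of_projOn {a b : Fin n → ZMod p} (h : projOn act a = projOn act b) :
    formOn E act a = formOn E act b := by
  ext y
  simp [formOn_apply, h]

/-- If `a + t m` vanishes on `act`, then `a` is there a multiple of `m`, and `m` lies in the radical
of `discForm _ m`. A nonzero value thus guarantees that no root `t` leads to the zero vector. -/
theorem discForm_eq_zero_of_projOn (hE : Eᵀ = E) {a m : Fin n → ZMod p} {t : ZMod p}
    (h0 : projOn act (a + t • m) = 0) (z : Fin n → ZMod p) :
    discForm (formOn E act) m a z = 0 := by
  have e : projOn act a = projOn act (-t • m) := by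
    rw [map_add, map_smul] at h0
    rw [map_smul, neg_smul]
    exact eq_neg_of_add_eq_zero_left h0
  rw [discForm_apply, formOn_symm hE m a, formOn_eq_of_projOn (E := E) e]
  simp only [map_smul, LinearMap.smul_apply, smul_eq_mul]
  ring

/-- The value is minus the Gram determinant of `m, a`, hence minus the determinant of the form times
the square of a coordinate determinant. In dimension two its being a square does not depend on the
choice of vectors when minus the determinant is one. -/
theorem discForm_pair {i j : Fin n} (hij : i ≠ j) (hE : Eᵀ = E) (m a : Fin n → ZMod p) :
    discForm (formOn E [i, j]) m a a =
      (E i j * E i j - E i i * E j j) * (m i * a j - m j * a i) ^ 2 := by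
  have hsym : E j i = E i j := congrFun (congrFun hE i) j
  have hform (x y : Fin n → ZMod p) : formOn E [i, j] x y =
      x i * y i * E i i + (x i * y j + x j * y i) * E i j + x j * y j * E j j := by
    have hx (x : Fin n → ZMod p) : projOn [i, j] x = x i • Pi.single i 1 + x j • Pi.single j 1 := by
      ext k
      by_cases h1 : k = i
      · subst h1; simp [projOn_apply, hij]
      · by_cases h2 : k = j
        · subst h2; simp [projOn_apply, h1]
        · simp [projOn_apply, h1, h2]
    rw [formOn_apply, hx, hx]
    simp [mulVec_add, mulVec_smul, add_dotProduct, hsym]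
    ring
  rw [discForm_apply, hform, hform, hform]
  ring

/-- In dimension at least three, `card_form_square` for the form `discForm _ m` gives the fraction
`1/9`. In dimension two the square condition holds automatically, and only nonvanishing has to be
counted, at the fraction `1/3`. -/
theorem card_goodPair_right (hp2 : p ≠ 2) (hE : Eᵀ = E) (hact : act.Nodup) (h : NonDeg E act)
    (hdim : 2 < act.length ∨ ∃ i j, act = [i, j] ∧ IsSquare (E i j * E i j - E i i * E j j))
    {m : Fin n → ZMod p} (hm : formOn E act m m ≠ 0) [DecidablePred fun a => GoodPair E act a m] :
    Fintype.card (Fin n → ZMod p) ≤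
      9 * (Finset.univ.filter fun a => GoodPair E act a m).card := by
  classical
  have hsymm := discForm_symm (formOn_symm (act := act) hE) m
  rcases hdim with hl | ⟨i, j, rfl, hs⟩
  · obtain ⟨u, hu⟩ := h.exists_discForm_ne_zero hp2 hE hact (by omega) hm
    obtain ⟨y, hy⟩ := h.exists_discForm_discForm_ne_zero hp2 hE hact hl hm hu
    refine (card_form_square hp2 hsymm hu hy).trans (Nat.mul_le_mul_left _
      (Finset.card_le_card fun a ha => ?_))
    simp only [Finset.mem_filter, Finset.mem_univ, true_and] at ha ⊢
    refine ⟨hm, ha.2, fun t h0 => ha.1 ?_⟩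
    have e2 := discForm_eq_zero_of_projOn (E := E) hE h0
    rw [discForm_apply, hsymm u a, e2, e2]
    ring
  · have hij : i ≠ j := by simpa using hact
    obtain ⟨u, hu⟩ := h.exists_discForm_ne_zero hp2 hE hact (by simp) hm
    refine (card_form_ne_zero hp2 hsymm hu).trans (Nat.mul_le_mul (by norm_num)
      (Finset.card_le_card fun a ha => ?_))
    simp only [Finset.mem_filter, Finset.mem_univ, true_and] at ha ⊢
    refine ⟨hm, ?_, fun t h0 => ha (discForm_eq_zero_of_projOn hE h0 a)⟩
    rw [discForm_pair hij hE]
    exact hs.mul (IsSquare.sq _)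

/-- A third of all `m` is anisotropic, and for each of these a ninth of all `a` is good. -/
theorem card_goodPair (hp2 : p ≠ 2) (hE : Eᵀ = E) (hact : act.Nodup) (h : NonDeg E act)
    (hdim : 2 < act.length ∨ ∃ i j, act = [i, j] ∧ IsSquare (E i j * E i j - E i i * E j j))
    [DecidablePred fun x : (Fin n → ZMod p) × (Fin n → ZMod p) => GoodPair E act x.1 x.2] :
    Fintype.card ((Fin n → ZMod p) × (Fin n → ZMod p)) ≤ 27 * (Finset.univ.filter
      fun x : (Fin n → ZMod p) × (Fin n → ZMod p) => GoodPair E act x.1 x.2).card := by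
  classical
  have hl : 0 < act.length := by
    rcases hdim with hl | ⟨i, j, rfl, -⟩
    · omega
    · simp
  obtain ⟨u, hu⟩ := h.exists_form_ne_zero hp2 hE hact hl
  have h1 := card_form_ne_zero hp2 (formOn_symm hE) hu
  have h2 : Fintype.card (Fin n → ZMod p) *
      (Finset.univ.filter fun m => formOn E act m m ≠ 0).card ≤ 9 * (Finset.univ.filter
        fun x : (Fin n → ZMod p) × (Fin n → ZMod p) => GoodPair E act x.1 x.2).card := by
    have e : (Finset.univ.filter
        fun x : (Fin n → ZMod p) × (Fin n → ZMod p) => GoodPair E act x.1 x.2).card =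
        ∑ m, (Finset.univ.filter fun a => GoodPair E act a m).card := by
      simp only [Finset.card_filter]
      rw [Fintype.sum_prod_type_right]
      exact Finset.sum_congr rfl fun m _ => Finset.sum_congr rfl fun a _ => by congr
    rw [e, Finset.mul_sum, mul_comm, ← smul_eq_mul, ← Finset.sum_const]
    refine (Finset.sum_le_sum fun m hm => card_goodPair_right hp2 hE hact h hdim
      (Finset.mem_filter.1 hm).2).trans ?_
    exact Finset.sum_le_sum_of_subset (Finset.filter_subset _ _)
  rw [Fintype.card_prod]
  calc _ ≤ Fintype.card (Fin n → ZMod p) *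
        (3 * (Finset.univ.filter fun m => formOn E act m m ≠ 0).card) := Nat.mul_le_mul_left _ h1
    _ = 3 * (Fintype.card (Fin n → ZMod p) *
        (Finset.univ.filter fun m => formOn E act m m ≠ 0).card) := by ring
    _ ≤ 3 * (9 * _) := Nat.mul_le_mul_left _ h2
    _ = _ := by ring

end Act

/-! ## Square roots and isotropic vectors modulo a prime -/

/-- Success is a matter of the initial draw `ω` alone. The rest of the body is estimated for fixed
`ω` and may contain random loops of its own, as the isotropic search does when it takes square
roots. -/
theorem Runs.untilSome {α β Ω : Type} [Fintype Ω] [Nonempty Ω] {P : Prog ℚ β} {T T' N : ℕ}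
    {g : Ω → β} (hP : Draws P T g) {F : β → Prog ℚ (Option α)} {Post : α → Prop} (good : Ω → Prop)
    [DecidablePred good]
    (hF : ∀ ω, Runs (F (g ω)) T' fun r => (r = none → ¬ good ω) ∧ ∀ b, r = some b → Post b)
    (hN : Fintype.card Ω ≤ N * (Finset.univ.filter good).card) :
    Runs (MaxLat.untilSome (P >>= F)) (N * (T + T' + 1)) Post := by
  refine Runs.loop good (fun f K Y h0 h1 => hP.bind_le fun ω => ?_) hN
  refine hF ω f _ ?_
  rintro (_ | b) ⟨hr, hr'⟩
  · rw [if_neg (hr rfl)]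
    exact h0
  · exact (h1 b (hr' b rfl)).trans le_self_add

section Sqrt

variable {p : ℕ} [hp : Fact p.Prime]

theorem runs_isSquare (x : ℚ) :
    Runs (isSquare p x) (3 + 4 * p.size) fun r => p ≠ 2 → ∀ a : ZMod p, x = red a →
      (r = true ↔ a ≠ 0 ∧ IsSquare a) := by
  have h2 := hp.out.two_le
  unfold isSquare
  refine Runs.le (Runs.lit (Runs.lit (Runs.bind (runs_power_mod (by omega) _ _) fun r hr =>
    Runs.of_bind_pure (Runs.test (Runs.pure ?_))))) ?_
  · intro hp2 a ha
    rw [hr a ha, ← red_one (N := p) (by omega), decide_eq_true_iff, red_inj]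
    have hodd := hp.out.odd_of_ne_two hp2
    have e : (p - 1) / 2 = p / 2 := by
      obtain ⟨k, hk⟩ := hodd
      omega
    rw [e]
    by_cases ha0 : a = 0
    · have : p / 2 ≠ 0 := by omega
      simp [ha0, this]
    · rw [ZMod.euler_criterion p ha0]
      simp [ha0]
  · have : ((p - 1) / 2).size ≤ p.size := Nat.size_le_size (by omega)
    omega

/-- Cipolla's formula. -/
theorem cipolla (hp2 : p ≠ 2) {s a : ZMod p} (ha0 : a ≠ 0) (ha : IsSquare a)
    (hw : ¬ IsSquare (s ^ 2 - a)) :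
    ((⟨s, 1⟩ : QuadraticAlgebra (ZMod p) (s ^ 2 - a) 0) ^ ((p + 1) / 2)).re ^ 2 = a := by
  set w := s ^ 2 - a with hwdef
  have hw0 : w ≠ 0 := fun h => hw (by rw [h]; exact IsSquare.zero)
  have : CharP (QuadraticAlgebra (ZMod p) w 0) p :=
    charP_of_injective_algebraMap (R := ZMod p) QuadraticAlgebra.algebraMap_injective p
  set z : QuadraticAlgebra (ZMod p) w 0 := ⟨s, 1⟩ with hz
  obtain ⟨k, hk⟩ := hp.out.odd_of_ne_two hp2
  have hwk : w ^ k = -1 := by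
    have h1 : ¬ w ^ (p / 2) = 1 := fun h => hw ((ZMod.euler_criterion p hw0).2 h)
    have h2 := (ZMod.pow_div_two_eq_neg_one_or_one p hw0).resolve_left h1
    rwa [show p / 2 = k by omega] at h2
  have hzC : z = algebraMap (ZMod p) _ s + QuadraticAlgebra.omega := by
    ext <;> simp [hz]
  have hom : (QuadraticAlgebra.omega : QuadraticAlgebra (ZMod p) w 0) ^ 2 =
      algebraMap (ZMod p) _ w := by
    rw [sq, QuadraticAlgebra.omega_mul_omega_eq_mk]
    ext <;> simp
  -- Frobenius is conjugation, because `w` is a nonsquare and `w ^ ((p - 1) / 2) = -1`.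
  have hzp : z ^ p = ⟨s, -1⟩ := by
    rw [hzC, add_pow_char, ← map_pow, ZMod.pow_card]
    have : (QuadraticAlgebra.omega : QuadraticAlgebra (ZMod p) w 0) ^ p =
        algebraMap (ZMod p) _ (-1) * QuadraticAlgebra.omega := by
      rw [show (QuadraticAlgebra.omega : QuadraticAlgebra (ZMod p) w 0) ^ p = _ ^ (2 * k + 1) from
        congrArg (fun e : ℕ => (QuadraticAlgebra.omega : QuadraticAlgebra (ZMod p) w 0) ^ e) hk,
        pow_succ, pow_mul, hom, ← map_pow, hwk]
    rw [this]
    ext <;> simp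
  set r := z ^ ((p + 1) / 2) with hr
  -- Here `r² = z ^ (p + 1)` is the norm of `z`, that is, `s² - w = a`.
  have hr2 : r * r = algebraMap (ZMod p) _ a := by
    rw [hr, ← pow_add, show (p + 1) / 2 + (p + 1) / 2 = p + 1 by omega, pow_succ, hzp, hz]
    ext
    · simp [hwdef]; ring
    · simp
  have h1 := congrArg QuadraticAlgebra.re hr2
  have h2 := congrArg QuadraticAlgebra.im hr2
  simp only [QuadraticAlgebra.re_mul, QuadraticAlgebra.im_mul, QuadraticAlgebra.algebraMap_re,
    QuadraticAlgebra.algebraMap_im] at h1 h2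
  have h3 : (2 : ZMod p) * (r.re * r.im) = 0 := by linear_combination h2
  have htwo : (2 : ZMod p) ≠ 0 := by
    intro h0
    have : ((2 : ℕ) : ZMod p) = 0 := by exact_mod_cast h0
    rw [ZMod.natCast_eq_zero_iff] at this
    exact hp2 (Nat.le_antisymm (Nat.le_of_dvd two_pos this) hp.out.two_le)
  -- The square of `r` is a scalar, so one of its components vanishes. It is not the real one: `a =
  -- w r.im²` would make `w` a square.
  rcases mul_eq_zero.1 ((mul_eq_zero.1 h3).resolve_left htwo) with h4 | h4
  · exfalso
    rw [h4] at h1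
    have him : r.im ≠ 0 := fun h => ha0 (by rw [← h1, h]; ring)
    obtain ⟨b, hb⟩ := ha
    refine hw ⟨b / r.im, ?_⟩
    field_simp
    rw [sq, sq, ← hb, ← h1]
    ring
  · rw [h4] at h1
    rw [sq, ← h1]
    ring

/-- Running time of `sqrtMod`. -/
def sqrtCost (p : ℕ) : ℕ := 50 + 40 * p.size

theorem runs_sqrtMod (hp2 : p ≠ 2) (a : ZMod p) :
    Runs (sqrtMod p (red a)) (sqrtCost p) fun r =>
      (∀ v, r = some v → ∃ b : ZMod p, v = red b ∧ b ^ 2 = a) ∧ (r = none → ¬ IsSquare a) := by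
  have h2 := hp.out.two_le
  unfold sqrtMod
  refine Runs.le (Runs.lit (Runs.lit (Runs.lit (Runs.test (Runs.ite (T₁ := 0)
    (T₂ := 40 + 34 * p.size) ?_ ?_))))) ?_
  · intro h
    rw [decide_eq_true_iff, red_eq_zero] at h
    refine Runs.pure ⟨?_, by simp⟩
    rintro v hv
    exact ⟨0, by simpa using hv.symm, by simp [h]⟩
  · intro h
    rw [decide_eq_true_iff, red_eq_zero] at h
    refine Runs.le (Runs.bind (runs_isSquare _) fun b hb => Runs.ite (T₁ := 37 + 30 * p.size)
      (T₂ := 0) ?_ ?_) ?_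
    · intro hb'
      have hsq := ((hb hp2 a rfl).1 hb').2
      refine Runs.le (Runs.bind (Q := fun x => ∃ s : ZMod p, x = (red s, red (s ^ 2 - a)) ∧
        ¬ IsSquare (s ^ 2 - a)) (Runs.untilSome (N := 3) (T' := 8 + 4 * p.size) (Draws.rand p)
        (fun s => ¬ IsSquare (s ^ 2 - a)) (fun s => ?_) ?_) (T₂ := 18 * p.size) ?_) ?_
      · refine Runs.le (Runs.bind (runs_mulMod _ _) fun s2 hs2 => Runs.bind (runs_subMod _ _)
          fun w hw => Runs.test (Runs.ite (T₁ := 0) (T₂ := 3 + 4 * p.size) (fun h0 => ?_)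
          fun h0 => ?_)) ?_
        · have hw' := hw _ _ (by rw [hs2 s s (Rep.red s) (Rep.red s)]; exact Rep.red _) (Rep.red a)
          rw [decide_eq_true_iff, hw', red_eq_zero, ← sq] at h0
          exact Runs.pure ⟨fun _ hn => hn (by rw [h0]; exact IsSquare.zero), by simp⟩
        · have hw' := hw _ _ (by rw [hs2 s s (Rep.red s) (Rep.red s)]; exact Rep.red _) (Rep.red a)
          rw [← sq] at hw'
          rw [decide_eq_true_iff, hw', red_eq_zero] at h0
          refine Runs.le (Runs.bind (runs_isSquare _) fun b hb => Runs.ite (T₁ := 0) (T₂ := 0)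
            (fun h1 => Runs.pure ?_) (fun h1 => Runs.pure ?_)) (by omega)
          · exact ⟨fun _ hn => hn ((hb hp2 _ hw').1 h1).2, by simp⟩
          · refine ⟨by simp, fun x hx => ⟨s, ?_, fun hs => h1 ((hb hp2 _ hw').2 ⟨h0, hs⟩)⟩⟩
            rw [← hw']
            exact (Option.some.inj hx).symm
        · omega
      · simpa using card_nonsquare hp2 h
      · rintro _ ⟨s, rfl, hs⟩
        -- Pairs of residues represent elements of the quadratic extension by a root of `w = s² -
        -- a`; one product takes nine operations.
        refine Runs.le (Runs.bind (runs_power (M := QuadraticAlgebra (ZMod p) (s ^ 2 - a) 0)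
          (fun x z => x = (red z.re, red z.im)) (c := 9) ?_ ?_ (a := ⟨s, 1⟩) ?_ _)
          (fun r hr => Runs.pure ⟨?_, by simp⟩)) ?_
        · rintro x y z z' rfl rfl
          refine Runs.le (Runs.op (Runs.op (Runs.op (Runs.op (Runs.op (Runs.op (Runs.op
            (Runs.op (Runs.op (Runs.pure ?_)))))))))) le_rfl
          refine Prod.ext (Rep.mod ?_) (Rep.mod ?_)
          · have e : (z * z').re = z.re * z'.re + z.im * z'.im * (s ^ 2 - a) := by
              rw [QuadraticAlgebra.re_mul]; ring
            rw [e]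
            exact ((Rep.red _).mul (Rep.red _)).add (((Rep.red _).mul (Rep.red _)).mul (Rep.red _))
          · have e : (z * z').im = z.re * z'.im + z.im * z'.re := by
              rw [QuadraticAlgebra.im_mul]; ring
            rw [e]
            exact ((Rep.red _).mul (Rep.red _)).add ((Rep.red _).mul (Rep.red _))
        · rw [QuadraticAlgebra.re_one, QuadraticAlgebra.im_one, red_one (by omega), red_zero]
        · rw [red_one (by omega)]
        · intro v hv
          exact ⟨_, by rw [← Option.some.inj hv, hr], cipolla hp2 h hsq hs⟩
        · have : ((p + 1) / 2).size ≤ p.size := Nat.size_le_size (by omega)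
          omega
      · omega
    · intro hb'
      refine Runs.pure ⟨by simp, fun _ hs => hb' ((hb hp2 a rfl).2 ⟨h, hs⟩)⟩
    · omega
  · unfold sqrtCost
    omega

end Sqrt

/-! ## Random search for isotropic vectors -/

section Random

variable {p : ℕ} [hp : Fact p.Prime] {n : ℕ}

/-- Exchanging the extra element with the `i`-th coordinate is an involution. In terms of
probability, overwriting a coordinate of a uniform vector by an independent uniform element leaves
it uniform. -/
theorem sum_update {M : Type*} [AddCommMonoid M] (i : Fin n) (h : (Fin n → ZMod p) → M) :
    ∑ ω : ZMod p × (Fin n → ZMod p), h (Function.update ω.2 i ω.1) =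
      ∑ ω : ZMod p × (Fin n → ZMod p), h ω.2 := by
  have hinv : Function.Involutive fun ω : ZMod p × (Fin n → ZMod p) =>
      (ω.2 i, Function.update ω.2 i ω.1) := fun ω => by simp
  exact Fintype.sum_bijective _ hinv.bijective _ _ fun _ => rfl

/-- The program that chooses the entries with positions in `act` at random. -/
theorem draws_foldlM (act : List (Fin n)) (f₀ : Fin n → ℚ) :
    Draws (act.foldlM (fun (f : Fin n → ℚ) i => do
      let x ← rand p
      pure (Function.update f i x)) f₀) act.length
      fun (x : Fin n → ZMod p) i => if i ∈ act then red (x i) else f₀ i := by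
  induction act generalizing f₀ with
  | nil =>
    intro f
    simp only [List.foldlM_nil, List.not_mem_nil, if_false]
    change f f₀ ≤ _
    rw [Finset.sum_const, Finset.card_univ, nsmul_eq_mul, mul_comm,
      ENNReal.mul_div_cancel_right (by simp [hp.out.ne_zero]) (by simp)]
    exact le_add_self
  | cons i act ih =>
    rw [List.foldlM_cons, bind_assoc]
    simp only [pure_bind]
    intro f
    refine ((Draws.rand p).bind (fun s => ih (Function.update f₀ i (red s))) f).trans ?_
    rw [List.length_cons, add_comm 1]
    refine add_le_add le_rfl (le_of_eq ?_)
    set h : (Fin n → ZMod p) → ℝ≥0∞ := fun x =>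
      f fun k => if k ∈ i :: act then red (x k) else f₀ k with hh
    have e : ∑ ω : ZMod p × (Fin n → ZMod p), f (fun k => if k ∈ act then red (ω.2 k)
        else Function.update f₀ i (red ω.1) k) = ∑ ω : ZMod p × (Fin n → ZMod p), h ω.2 := by
      by_cases hi : i ∈ act
      · refine Finset.sum_congr rfl fun ω _ => congrArg f (funext fun k => ?_)
        by_cases hk : k ∈ act
        · simp [hk]
        · have : k ≠ i := fun e => hk (e ▸ hi)
          simp [hk, this]
      · rw [← sum_update i h]
        refine Finset.sum_congr rfl fun ω _ => congrArg f (funext fun k => ?_)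
        by_cases hk : k ∈ act
        · have : k ≠ i := fun e => hi (e ▸ hk)
          simp [hk, this]
        · by_cases hki : k = i
          · subst hki; simp [hk]
          · simp [hk, hki]
    rw [e, Fintype.sum_prod_type]
    dsimp only
    rw [Finset.sum_const, Finset.card_univ, nsmul_eq_mul,
      Fintype.card_prod, Nat.cast_mul]
    exact ENNReal.mul_div_mul_left _ _ (by simp [hp.out.ne_zero]) (by simp)

end Random

section Isotropic

variable {p : ℕ} [hp : Fact p.Prime] {n : ℕ}

/-- The column of reduced representatives of the entries of a vector. -/
def colRed (x : Fin n → ZMod p) : Matrix (Fin n) Unit ℚ := fun i _ => red (x i)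

theorem rep_form (E : Matrix (Fin n) (Fin n) (ZMod p)) (x y : Fin n → ZMod p) :
    Rep (((colRed x)ᵀ * (E.map red * colRed y)) () ()) (x ⬝ᵥ (E *ᵥ y)) := by
  have := Rep.matMul (A := (colRed x)ᵀ) (A' := fun (_ : Unit) i => x i)
    (B' := E * Matrix.of fun i (_ : Unit) => y i) (fun _ _ => Rep.red _)
    (Rep.matMul (A := E.map red) (A' := E) (B := colRed y) (fun _ _ => Rep.red _)
      fun _ _ => Rep.red _) () ()
  exact this

/-- Both draws are merged into a single one from `Ω × Ω`. -/
theorem runs_untilSome_pair {α β Ω : Type} [Fintype Ω] [Nonempty Ω] {P : Prog ℚ β} {T T' N : ℕ}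
    {g : Ω → β} (hP : Draws P T g) {F : β → β → Prog ℚ (Option α)} {Post : α → Prop}
    (good : Ω × Ω → Prop) [DecidablePred good]
    (hF : ∀ ω : Ω × Ω, Runs (F (g ω.1) (g ω.2)) T' fun r =>
      (r = none → ¬ good ω) ∧ ∀ b, r = some b → Post b)
    (hN : Fintype.card (Ω × Ω) ≤ N * (Finset.univ.filter good).card) :
    Runs (MaxLat.untilSome (P >>= fun a => P >>= fun m => F a m)) (N * (T + T + T' + 1)) Post := by
  have hPP : Draws (P >>= fun a => P >>= fun m => pure (a, m)) (T + T)
      fun ω : Ω × Ω => (g ω.1, g ω.2) := by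
    exact Draws.bind (Ω' := Ω) (g' := fun ω ω' => (g ω, g ω')) hP fun ω f => by
      rw [Prog.ert_bind]
      exact hP _
  have := Runs.untilSome hPP (F := fun x => F x.1 x.2) good hF hN
  simpa only [bind_assoc, pure_bind] using this

/-- Running time of `isotropicSearch`. -/
noncomputable def searchCost (p n : ℕ) : ℕ :=
  3 + 27 * (3 * (rectCost n n 1 + rectCost 1 n 1) + 6 * n + sqrtCost p + 4 * p.size + 20)

/-- A round with a `GoodPair` cannot fail: the leading coefficient is nonzero, the discriminant has
a root, and whatever `t` results, `a + t m` is not zero. -/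
theorem runs_isotropicSearch (hp2 : p ≠ 2) {act : List (Fin n)} (hact : act.Nodup)
    {E : Matrix (Fin n) (Fin n) (ZMod p)} (hE : Eᵀ = E) (h : NonDeg E act)
    (hdim : 2 < act.length ∨ ∃ i j, act = [i, j] ∧ IsSquare (E i j * E i j - E i i * E j j)) :
    Runs (isotropicSearch p act (E.map red)) (searchCost p n) fun v =>
      ∃ x : Fin n → ZMod p, v = colRed x ∧ SuppOn act x ∧ x ⬝ᵥ (E *ᵥ x) = 0 := by
  classical
  have h2 := hp.out.two_le
  have hlen : act.length ≤ n := by simpa using hact.length_le_card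
  have hdraw : Draws (do
      let f ← act.foldlM (fun (f : Fin n → ℚ) i => do
        let x ← rand p
        pure (Function.update f i x)) (fun _ => 0)
      pure (fun i (_ : Unit) => f i : Matrix (Fin n) Unit ℚ)) act.length
      fun x : Fin n → ZMod p => colRed (projOn act x) := by
    intro f
    rw [Prog.ert_bind]
    refine (draws_foldlM act _ _).trans (le_of_eq ?_)
    congr 2
    refine Finset.sum_congr rfl fun x _ => congrArg f (funext fun i => funext fun _ => ?_)
    simp only [colRed, projOn_apply]
    split_ifs <;> simp
  have hform (x y : Fin n → ZMod p) : Runs (do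
      let Ey ← mmul (E.map red) (colRed y)
      let r ← mmul (colRed x)ᵀ Ey
      op .mod (r () ()) (p : ℚ)) (rectCost n n 1 + (rectCost 1 n 1 + 1))
      fun r => r = red (x ⬝ᵥ (E *ᵥ y)) := by
    refine Runs.le (Runs.mmul (Runs.mmul (Runs.of_bind_pure (Runs.op (Runs.pure ?_))))) ?_
    · exact (rep_form E x y).mod
    · simp
  unfold isotropicSearch
  refine Runs.le (Runs.lit (Runs.lit (Runs.lit (runs_untilSome_pair (N := 27)
    (T' := 3 * (rectCost n n 1 + rectCost 1 n 1) + 4 * n + sqrtCost p + 4 * p.size + 18)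
    hdraw (fun ω => GoodPair E act ω.1 ω.2)
    ?_ (card_goodPair hp2 hE hact h hdim))))) ?_
  · rintro ⟨a, m⟩
    refine Runs.le (Runs.bind (hform _ _) fun qm hqm => Runs.bind (hform _ _) fun qa hqa =>
      Runs.bind (hform _ _) fun b hb => Runs.test (Runs.ite (T₁ := 0)
        (T₂ := sqrtCost p + 4 * n + 4 * p.size + 10) (fun h0 => ?_) fun h0 => ?_)) ?_
    · rw [decide_eq_true_iff, hqm, red_eq_zero, ← formOn_apply] at h0
      exact Runs.pure ⟨fun _ hg => hg.1 h0, by simp⟩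
    · subst hqm hqa hb
      rw [decide_eq_true_iff, red_eq_zero] at h0
      simp only [← formOn_apply] at h0 ⊢
      refine Runs.le (Runs.bind (runs_mulMod _ _) fun b2 hb2 => Runs.bind (runs_mulMod _ _)
        fun qq hqq => Runs.bind (runs_subMod _ _) fun disc hdisc => ?_)
        (T := 2 + (2 + (2 + (sqrtCost p + (4 * n + 4 * p.size + 4))))) (by omega)
      have hd : disc = red (discForm (formOn E act) m a a) := by
        rw [hb2 _ _ (Rep.red _) (Rep.red _), hqq _ _ (Rep.red _) (Rep.red _)] at hdisc
        rw [hdisc _ _ (Rep.red _) (Rep.red _), discForm_apply, formOn_symm hE m a]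
      subst hd
      refine Runs.bind (runs_sqrtMod hp2 _) ?_
      rintro (_ | r) ⟨hr1, hr2⟩
      · exact Runs.le (Runs.pure ⟨fun _ hg => hr2 rfl hg.2.1, by simp⟩) (Nat.zero_le _)
      · obtain ⟨ρ, rfl, hρ⟩ := hr1 r rfl
        refine Runs.le (Runs.bind (runs_subMod _ _) fun num hnum => Runs.bind
          (runs_power_mod (by omega) _ _) fun inv hinv => Runs.bind (runs_mulMod _ _)
          fun t ht => Runs.each (Runs.zip (Runs.each (Runs.bind
            ((runs_find_ne_zero (fun i => _) act).le hlen) (T₂ := 0) ?_)))) ?_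
        · set qm := formOn E act m m with hqm
          set b := formOn E act a m with hb
          have ht' : t = red ((ρ - b) * qm ^ (p - 2)) := by
            rw [hnum _ _ (Rep.red _) (Rep.red _), hinv _ rfl] at ht
            exact ht _ _ (Rep.red _) (Rep.red _)
          set τ := (ρ - b) * qm ^ (p - 2) with hτ
          have hv : (fun i j => Op.eval .mod (Op.eval .add (colRed (projOn act a) i j)
              (Op.eval .mul (colRed (projOn act m) i j) t)) p : Matrix (Fin n) Unit ℚ) =
              colRed (projOn act (a + τ • m)) := by
            funext i j
            rw [ht']
            have e : projOn act (a + τ • m) i = projOn act a i + projOn act m i * τ := by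
              rw [map_add, map_smul, Pi.add_apply, Pi.smul_apply, smul_eq_mul, mul_comm]
            exact ((Rep.red _).add ((Rep.red _).mul (Rep.red _))).mod.trans
              (congrArg red e.symm)
          rintro (_ | i) hfind
          · refine Runs.pure ⟨fun _ hg => hg.2.2 τ ?_, by simp⟩
            funext i
            by_cases hi : i ∈ act
            · have h3 := hfind.2 rfl i hi
              exact red_eq_zero.1 ((congrFun (congrFun hv i) ()).symm.trans h3)
            · exact projOn_suppOn act _ i hi
          · refine Runs.pure ⟨by simp, fun v hv' => ⟨_, (Option.some.inj hv').symm.trans hv,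
              projOn_suppOn act _, ?_⟩⟩
            rw [← formOn_apply, form_line (formOn_symm hE), formOn_symm hE m a, ← hqm, ← hb]
            have hi : qm * qm ^ (p - 2) = 1 := mul_pow_sub_two h0
            rw [discForm_apply, formOn_symm hE m a, ← hqm, ← hb] at hρ
            -- By completing the square, `Q(m) Q(a + τ m)` is `(Q(m) τ + b)²` minus the
            -- discriminant, and `Q(m) τ + b = ρ`.
            have : qm * (qm * τ ^ 2 + 2 * b * τ + formOn E act a a) = 0 := by
              have hqτ : qm * τ = ρ - b := by
                rw [hτ]; linear_combination (ρ - b) * hi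
              linear_combination (qm * τ + ρ + b) * hqτ + hρ
            exact (mul_eq_zero.1 this).resolve_left h0
        · have : (p - 2).size ≤ p.size := Nat.size_le_size (by omega)
          simp only [Fintype.card_fin, Fintype.card_unit]
          omega
    · omega
  · unfold searchCost
    omega

end Isotropic

/-! ## Maximal totally isotropic subspaces -/

section HyperbolicPair

variable {F : Type*} [Field F] {n : ℕ} {E : Matrix (Fin n) (Fin n) F} {act : List (Fin n)}
  {x : Fin n → F} {i j : Fin n} {s : F}

/-- Gram matrix of the projections of the basis vectors to the orthogonal complement of the
isotropic vector `x` and `s` times the basis vector at `i`. -/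
def projGram (E : Matrix (Fin n) (Fin n) F) (x : Fin n → F) (i : Fin n) (s : F) :
    Matrix (Fin n) (Fin n) F := fun k l =>
  E k l - (E i k * s - (x ᵥ* E) k * (E i i * s * s)) * (x ᵥ* E) l - (x ᵥ* E) k * (E i l * s)

theorem projGram_transpose (hE : Eᵀ = E) : (projGram E x i s)ᵀ = projGram E x i s := by
  ext k l
  have : E l k = E k l := congrFun (congrFun hE k) l
  rw [transpose_apply, projGram, projGram, this]
  ring

/-- As `x_j ≠ 0` and `j ≠ i`, the vectors `x`, `e_i` and the remaining basis vectors span the same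
space as `act`. The projections of the remaining ones therefore form a basis of the complement of a
hyperbolic plane. -/
theorem nonDeg_projGram (hE : Eᵀ = E) (h : NonDeg E act) (hx : SuppOn act x)
    (hxx : x ⬝ᵥ (E *ᵥ x) = 0) (hs : (x ᵥ* E) i * s = 1) (hi : i ∈ act)
    (hji : j ≠ i) (hxj : x j ≠ 0) :
    NonDeg (projGram E x i s) (act.filter fun k => k ≠ i ∧ k ≠ j) := by
  intro y hy hEy
  have hyi : y i = 0 := hy i (by simp)
  have hyj : y j = 0 := hy j (by simp)
  have hsymm (k l) : E k l = E l k := congrFun (congrFun hE l) k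
  have hr : x ᵥ* E = E *ᵥ x := by rw [← mulVec_transpose, hE]
  rw [hr] at hs
  set r := E *ᵥ x with hrdef
  set R := r ⬝ᵥ y with hR
  set β := (E i ⬝ᵥ y) * s - E i i * s * s * R with hβ
  -- The projection of `y` to the orthogonal complement of the pair `x`, `s e_i`.
  set z := y - (R * s) • Pi.single i 1 - β • x with hz
  have hzE : E *ᵥ z = projGram E x i s *ᵥ y := by
    rw [hz, mulVec_sub, mulVec_sub, mulVec_smul, mulVec_smul, ← hrdef, mulVec_single_one]
    funext k
    have e : (projGram E x i s *ᵥ y) k = (E *ᵥ y) k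
        - (E i k * s - r k * (E i i * s * s)) * R - r k * (s * (E i ⬝ᵥ y)) := by
      simp only [mulVec, dotProduct, projGram, hr, hR, Finset.mul_sum, ← Finset.sum_sub_distrib]
      exact Finset.sum_congr rfl fun l _ => by ring
    rw [e]
    simp only [Pi.sub_apply, Pi.smul_apply, smul_eq_mul, col_apply, hβ, hsymm k i]
    ring
  have hrow : (E *ᵥ z) i = 0 := by
    rw [hzE]
    simp only [mulVec, dotProduct]
    refine Finset.sum_eq_zero fun l _ => ?_
    -- The basis vector at `i` lies in the plane of the pair, so its projection is zero.
    have : projGram E x i s i l = 0 := by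
      rw [projGram, hr]
      linear_combination (E i i * s * r l - E i l) * hs
    rw [this, zero_mul]
  have hxz : x ⬝ᵥ (E *ᵥ z) = 0 := by
    rw [dotProduct_mulVec, hr, hz, dotProduct_sub, dotProduct_sub, dotProduct_smul,
      dotProduct_smul, dotProduct_comm r x, hxx, ← hR, dotProduct_single_one, smul_eq_mul,
      smul_eq_mul]
    linear_combination (-R) * hs
  have hz0 (k) (hk : k ∈ act) (hkj : k ≠ j) : (E *ᵥ z) k = 0 := by
    by_cases hki : k = i
    · rw [hki, hrow]
    · rw [hzE]
      exact hEy k (by simp [hk, hki, hkj])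
  -- Orthogonality of `z` to `x` and to all the other basis vectors in `act` forces it at `j`, since
  -- `x_j ≠ 0`.
  have hzj : (E *ᵥ z) j = 0 := by
    rw [dotProduct, Finset.sum_eq_single j (fun k _ hkj => ?_) (by simp)] at hxz
    · exact (mul_eq_zero.1 hxz).resolve_left hxj
    · by_cases hk : k ∈ act
      · rw [hz0 k hk hkj, mul_zero]
      · rw [hx k hk, zero_mul]
  have hzero : z = 0 := by
    refine h z (fun k hk => ?_) fun k hk => ?_
    · have hki : k ≠ i := fun e => hk (e ▸ hi)
      simp [hz, hy k (by simp [hk]), hx k hk, hki]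
    · by_cases hkj : k = j
      · rw [hkj, hzj]
      · exact hz0 k hk hkj
  -- As `y` vanishes at `i` and `j`, the entry of `z = 0` at `j` yields `β = 0`, and then the entry
  -- at `i` yields `R = 0`.
  have h1 : β = 0 := by
    have := congrFun hzero j
    simpa [hz, hyj, hji, hxj] using this
  have hs0 : s ≠ 0 := by rintro rfl; simp at hs
  have h2 : R = 0 := by
    have := congrFun hzero i
    simpa [hz, hyi, h1, hs0] using this
  simpa [hz, h1, h2] using hzero

end HyperbolicPair

theorem IsInt.sub {ι κ : Type*} {A B : Matrix ι κ ℚ} (hA : IsInt A) (hB : IsInt B) :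
    IsInt (fun i j => A i j - B i j) := fun i j => by
  obtain ⟨a, ha⟩ := hA i j
  obtain ⟨b, hb⟩ := hB i j
  exact ⟨a - b, (congrArg₂ (· - ·) ha hb).trans (Int.cast_sub a b).symm⟩

theorem IsInt.mod {ι κ : Type*} {A : Matrix ι κ ℚ} (hA : IsInt A) (N : ℕ) :
    IsInt (fun i j => Op.eval .mod (A i j) (N : ℚ)) := fun i j => by
  obtain ⟨a, ha⟩ := hA i j
  refine ⟨a - N * ⌊A i j / N⌋, ?_⟩
  change A i j - N * (⌊A i j / N⌋ : ℚ) = _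
  push_cast
  exact congrArg (· - _) ha

/-! ### Repeated splitting of hyperbolic pairs. -/

section Subspace

variable {p : ℕ} [hp : Fact p.Prime] {n : ℕ}

theorem isInt_colRed (x : Fin n → ZMod p) : IsInt (colRed x) := fun i _ =>
  ⟨(x i).val, by simp [colRed, red]⟩

/-- For `p = 2` the choice is made among three vectors without randomness, so the time bound needs
nothing about the form there. -/
theorem runs_isotropicVector {act : List (Fin n)} (hact : act.Nodup)
    {E : Matrix (Fin n) (Fin n) (ZMod p)} (hE : p ≠ 2 → Eᵀ = E ∧ NonDeg E act) :
    Runs (isotropicVector p act (E.map red)) (searchCost p n + 4 * p.size + 15) fun o =>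
      ∀ v, o = some v → ∃ x : Fin n → ZMod p, v = colRed x ∧
        (p ≠ 2 → SuppOn act x ∧ x ⬝ᵥ (E *ᵥ x) = 0) := by
  unfold isotropicVector
  refine Runs.le (Runs.lit (Runs.lit (Runs.lit
    (T := searchCost p n + 4 * p.size + 12) ?_))) (by omega)
  match act, hact, hE with
  | [], _, _ => exact Runs.le (Runs.pure (by simp)) (Nat.zero_le _)
  | [_], _, _ => exact Runs.le (Runs.pure (by simp)) (Nat.zero_le _)
  | i :: j :: rest, hact, hE =>
    dsimp only
    have hsome (q : Fin n → Prop) [DecidablePred q] (h2 : p = 2) :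
        ∀ w, some (fun k (_ : Unit) => if q k then (1 : ℚ) else 0) = some w →
          ∃ x : Fin n → ZMod p, w = colRed x ∧
          (p ≠ 2 → SuppOn (i :: j :: rest) x ∧ x ⬝ᵥ (E *ᵥ x) = 0) := fun w hw => by
      refine ⟨fun k => if q k then 1 else 0, ?_, fun h => absurd h2 h⟩
      rw [← Option.some.inj hw]
      funext k _
      by_cases h : q k <;> simp [colRed, h, red_one hp.out.one_lt]
    refine Runs.le (Runs.ite (T₁ := 2) (T₂ := searchCost p n + 4 * p.size + 12)
      (fun h2 => ?_) fun h2 => ?_) (by omega)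
    · refine Runs.le (Runs.test (Runs.ite (T₁ := 0) (T₂ := 1)
        (fun _ => Runs.pure (hsome _ h2))
        fun _ => Runs.le (Runs.test (Runs.ite (T₁ := 0) (T₂ := 0)
        (fun _ => Runs.pure (hsome _ h2))
        fun _ => Runs.pure (hsome _ h2))) (by omega))) (by omega)
    · obtain ⟨hsymm, hnd⟩ := hE h2
      have hsearch := fun hdim => Runs.bind (T₂ := 0)
        (Post := fun o : Option (Matrix (Fin n) Unit ℚ) => ∀ v, o = some v →
          ∃ x : Fin n → ZMod p, v = colRed x ∧ (p ≠ 2 → SuppOn (i :: j :: rest) x ∧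
          x ⬝ᵥ (E *ᵥ x) = 0)) (runs_isotropicSearch h2 hact hsymm hnd hdim)
          (F := fun v => pure (some v)) fun v hv => Runs.pure fun w hw => by
            obtain rfl := Option.some.inj hw
            obtain ⟨x, hx, hx'⟩ := hv
            exact ⟨x, hx, fun _ => hx'⟩
      refine Runs.le (Runs.ite (T₁ := searchCost p n + 4 * p.size + 12) (T₂ := searchCost p n)
        (fun hr => ?_) fun hr => hsearch ?_) (by omega)
      · refine Runs.le (Runs.bind (runs_mulMod _ _) fun a ha => Runs.bind (runs_mulMod _ _)
          fun b hb => Runs.bind (runs_subMod _ _) fun d hd => Runs.bind (runs_isSquare _)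
          fun q hq => Runs.ite (T₁ := searchCost p n + 0) (T₂ := 0)
            (fun h => hsearch (Or.inr ⟨i, j, ?_, ?_⟩)) fun h => Runs.pure (by simp)) ?_
        · rw [List.isEmpty_iff.1 hr]
        · have ha' := ha _ _ (Rep.red _) (Rep.red _)
          have hb' := hb _ _ (Rep.red _) (Rep.red _)
          rw [ha', hb'] at hd
          exact ((hq h2 _ (hd _ _ (Rep.red _) (Rep.red _))).1 h).2
        · omega
      · left
        rcases rest with _ | ⟨k, rest⟩
        · simp at hr
        · simp only [List.length_cons]; omega

/-- The row of reduced representatives of the entries of a vector. -/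
def rowRed (x : Fin n → ZMod p) : Matrix Unit (Fin n) ℚ := fun _ i => red (x i)

/-- Completion of `v` to a hyperbolic pair, and projection to its orthogonal complement. -/
theorem runs_projection {α : Type} {T : ℕ} {Post : α → Prop} {X : Matrix (Fin n) (Fin n) ℚ}
    (hX : IsInt X) (E : Matrix (Fin n) (Fin n) (ZMod p)) (x : Fin n → ZMod p) (i : Fin n)
    {F : Matrix (Fin n) Unit ℚ → Matrix (Fin n) (Fin n) ℚ → Matrix (Fin n) (Fin n) ℚ → Prog ℚ α}
    (h : ∀ v X', IsInt v → IsInt X' →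
      Runs (F v X' ((projGram E x i ((x ᵥ* E) i ^ (p - 2))).map red)) T Post) :
    Runs (do
      let s ← power (mulMod (p : ℚ)) 1 (rowRed (x ᵥ* E) () i) (p - 2)
      let v' ← mmul X (colRed x)
      let v' ← each .mod v' (p : ℚ)
      let w' ← each .mul (fun k (_ : Unit) => X k i) s
      let w' ← each .mod w' (p : ℚ)
      let g ← each .mul (fun (_ : Unit) k => E.map red i k) s
      let g ← each .mod g (p : ℚ)
      let c ← mulMod (p : ℚ) (g () i) s
      let cr ← each .mul (rowRed (x ᵥ* E)) c
      let α ← zip .sub g cr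
      let α ← each .mod α (p : ℚ)
      let vα ← mmul v' α
      let wr ← mmul w' (rowRed (x ᵥ* E))
      let X' ← zip .sub X vα
      let X' ← zip .sub X' wr
      let X' ← each .mod X' (p : ℚ)
      let αr ← mmul α.transpose (rowRed (x ᵥ* E))
      let rg ← mmul (rowRed (x ᵥ* E)).transpose g
      let E' ← zip .sub (E.map red) αr
      let E' ← zip .sub E' rg
      let E' ← each .mod E' (p : ℚ)
      F v' X' E') (T + (4 * p.size + 8 * n + 6 * (n * n) + rectCost n n 1 + 4 * rectCost n 1 n + 2))
      Post := by
  have h1 := hp.out.one_lt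
  have hsize : (p - 2).size ≤ p.size := Nat.size_le_size (by omega)
  have hrow (y : Fin n → ZMod p) : IsInt (rowRed y) := fun _ k => ⟨(y k).val, by simp [rowRed, red]⟩
  set r := x ᵥ* E with hr
  set σ := r i ^ (p - 2) with hσ
  refine Runs.le (Runs.bind (runs_power_mod h1 _ _)
    (T₂ := T + (8 * n + 6 * (n * n) + rectCost n n 1 + 4 * rectCost n 1 n + 2)) fun s hs => ?_)
    (by omega)
  obtain rfl : s = red σ := hs _ rfl
  refine Runs.le (Runs.mmul (Runs.each (Runs.each (Runs.each (Runs.each (Runs.each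
    (T := T + (3 * n + 6 * (n * n) + 4 * rectCost n 1 n + 2)) ?_))))))
    (by simp only [Fintype.card_fin, Fintype.card_unit]; omega)
  have hg : (fun (u : Unit) k => Op.eval .mod (Op.eval .mul (E.map red i k) (red σ)) (p : ℚ)) =
      rowRed fun k => E i k * σ := by
    funext u k
    exact ((Rep.red _).mul (Rep.red _)).mod
  have hv : IsInt fun k (u : Unit) => Op.eval .mod ((X * colRed x) k u) (p : ℚ) :=
    (hX.mul (isInt_colRed x)).mod p
  have hw : IsInt fun k (_ : Unit) => Op.eval .mod (Op.eval .mul (X k i) (red σ)) (p : ℚ) := by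
    refine IsInt.mod (A := fun k (_ : Unit) => X k i * red σ) (fun k _ => ?_) p
    obtain ⟨z, hz⟩ := hX k i
    exact ⟨z * σ.val, (congrArg (· * red σ) hz).trans (by rw [red]; push_cast; rfl)⟩
  set v' : Matrix (Fin n) Unit ℚ :=
    fun k (u : Unit) => Op.eval .mod ((X * colRed x) k u) (p : ℚ)
  set w' : Matrix (Fin n) Unit ℚ :=
    fun k (_ : Unit) => Op.eval .mod (Op.eval .mul (X k i) (red σ)) (p : ℚ)
  rw [hg]
  refine Runs.le (Runs.bind (runs_mulMod _ _) fun c hc => Runs.each (Runs.zip (Runs.each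
    (T := T + (6 * (n * n) + 4 * rectCost n 1 n)) ?_)))
    (by simp only [Fintype.card_fin, Fintype.card_unit]; omega)
  obtain rfl := hc _ _ (Rep.red _) (Rep.red _)
  -- With `c = B(w, w)`, `B(v, w) = 1` and `v` isotropic, `α_k = B(w, e_k) - c r_k` is the
  -- coefficient that makes `e_k - α_k v - r_k w` orthogonal to both `v` and `w`.
  have hα : (fun (u : Unit) k => Op.eval .mod (Op.eval .sub (rowRed (fun k => E i k * σ) u k)
      (Op.eval .mul (rowRed r u k) (red (E i i * σ * σ)))) (p : ℚ)) =
      rowRed fun k => E i k * σ - r k * (E i i * σ * σ) := by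
    funext u k
    exact ((Rep.red _).sub ((Rep.red _).mul (Rep.red _))).mod
  rw [hα]
  refine Runs.le (Runs.mmul (Runs.mmul (Runs.zip (Runs.zip (Runs.each
    (T := T + (3 * (n * n) + 2 * rectCost n 1 n)) ?_)))))
    (by simp only [Fintype.card_fin, Fintype.card_unit]; omega)
  have hX' := ((hX.sub (hv.mul (hrow fun k => E i k * σ - r k * (E i i * σ * σ)))).sub
    (hw.mul (hrow r))).mod p
  refine Runs.le (Runs.mmul (Runs.mmul (Runs.zip (Runs.zip (Runs.each (T := T) ?_)))))
    (by simp only [Fintype.card_fin, Fintype.card_unit]; omega)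
  have hE' : (fun k l => Op.eval .mod (Op.eval .sub (Op.eval .sub (E.map red k l)
      (((rowRed fun k => E i k * σ - r k * (E i i * σ * σ))ᵀ * rowRed r :
        Matrix (Fin n) (Fin n) ℚ) k l))
      (((rowRed r)ᵀ * rowRed fun k => E i k * σ : Matrix (Fin n) (Fin n) ℚ) k l)) (p : ℚ) :
      Matrix (Fin n) (Fin n) ℚ) = (projGram E x i σ).map red := by
    funext k l
    exact (((Rep.red _).sub (Rep.outer (Rep.red _) (Rep.red _))).sub
      (Rep.outer (Rep.red _) (Rep.red _))).mod
  have := h _ _ hv hX'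
  rw [← hE'] at this
  exact this

/-- Running time of one round of `isotropicSubspace`. -/
noncomputable def subspaceCost (p n : ℕ) : ℕ :=
  searchCost p n + 8 * p.size + 11 * n + 6 * (n * n) + rectCost 1 n n + rectCost n n 1
    + 4 * rectCost n 1 n + 20

/-- Symmetry and nondegeneracy pass from round to round, so that every random search stays within
its time bound. Integrality of `X` makes the vectors found integral, as their lifting requires. -/
theorem runs_isotropicSubspace (rounds : ℕ) {act : List (Fin n)} (hact : act.Nodup)
    {X : Matrix (Fin n) (Fin n) ℚ} (hX : IsInt X) {E : Matrix (Fin n) (Fin n) (ZMod p)}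
    (hE : p ≠ 2 → Eᵀ = E ∧ NonDeg E act) :
    Runs (isotropicSubspace p rounds act X (E.map red)) (rounds * subspaceCost p n) fun l =>
      l.length ≤ rounds ∧ ∀ v ∈ l, IsInt v := by
  have h1 := hp.out.one_lt
  induction rounds generalizing act X E with
  | zero => exact Runs.le (Runs.pure (by simp)) (Nat.zero_le _)
  | succ rounds ih =>
    have hlen (l : List (Fin n)) (hl : l.Nodup) : l.length ≤ n := by simpa using hl.length_le_card
    rw [isotropicSubspace]
    refine Runs.le (Runs.lit (Runs.lit (Runs.lit (Runs.bind (runs_isotropicVector hact hE)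
      (T₂ := rounds * subspaceCost p n + (4 * p.size + 11 * n + 6 * (n * n) + rectCost 1 n n
        + rectCost n n 1 + 4 * rectCost n 1 n + 2)) ?_)))) ?_
    · rintro (_ | v) hv
      · exact Runs.le (Runs.pure (by simp)) (Nat.zero_le _)
      obtain ⟨x, rfl, hx⟩ := hv v rfl
      refine Runs.le (Runs.mmul (Runs.each (T := rounds * subspaceCost p n + (4 * p.size + 10 * n
        + 6 * (n * n) + rectCost n n 1 + 4 * rectCost n 1 n + 2)) ?_)) ?_
      · have hr : (fun (u : Unit) k => Op.eval .mod
            (((colRed x)ᵀ * E.map red : Matrix Unit (Fin n) ℚ) u k) (p : ℚ)) =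
            rowRed (x ᵥ* E) := by
          funext u k
          exact (Rep.matMul (A := (colRed x)ᵀ) (A' := fun (_ : Unit) i => x i) (B' := E)
            (fun _ _ => Rep.red _) (fun _ _ => Rep.red _) u k).mod
        rw [hr]
        refine Runs.le (Runs.bind ((runs_find_ne_zero (fun i => _) act).le
          (hlen _ hact)) (T₂ := rounds * subspaceCost p n + (4 * p.size + 9 * n + 6 * (n * n)
            + rectCost n n 1 + 4 * rectCost n 1 n + 2)) ?_) (by omega)
        rintro (_ | i) hi
        · exact Runs.le (Runs.pure (by simp)) (Nat.zero_le _)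
        obtain ⟨hiact, hi0⟩ := hi.1 i rfl
        refine Runs.le (Runs.bind ((runs_find_ne_zero (fun i => _) _).le
          (hlen _ (hact.filter _))) (T₂ := rounds * subspaceCost p n + (4 * p.size + 8 * n
            + 6 * (n * n) + rectCost n n 1 + 4 * rectCost n 1 n + 2)) ?_) (by omega)
        rintro (_ | j) hj
        · exact Runs.le (Runs.pure (by simp)) (Nat.zero_le _)
        obtain ⟨hjact, hj0⟩ := hj.1 j rfl
        obtain ⟨hjact, hji⟩ : j ∈ act ∧ j ≠ i := by simpa using hjact
        refine runs_projection hX E x i fun v X' hv hX' => ?_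
        refine Runs.le (Runs.bind (ih (hact.filter _) hX' fun h2 => ?_) fun l hl =>
          Runs.pure ?_) le_rfl
        · obtain ⟨hsymm, hnd⟩ := hE h2
          obtain ⟨hsupp, hiso⟩ := hx h2
          refine ⟨projGram_transpose hsymm, nonDeg_projGram hsymm hnd hsupp hiso
            (mul_pow_sub_two ?_) hiact hji ?_⟩
          · exact fun h => hi0 (red_eq_zero.2 h)
          · exact fun h => hj0 (red_eq_zero.2 h)
        · simpa [hv] using hl
      · simp only [Fintype.card_fin, Fintype.card_unit]
        omega
    · have e : subspaceCost p n = searchCost p n + 8 * p.size + 11 * n + 6 * (n * n)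
          + rectCost 1 n n + rectCost n n 1 + 4 * rectCost n 1 n + 20 := rfl
      have : (rounds + 1) * subspaceCost p n = rounds * subspaceCost p n + subspaceCost p n :=
        Nat.succ_mul _ _
      omega

end Subspace

/-! ## Overlattices -/

section Cofactor

/-- `∏ q ^ e` over the pairs `(q, e)` with `q ≠ p`. -/
def cof (fs : List (ℕ × ℕ)) (p : ℕ) : ℕ :=
  ((fs.filter fun qe => qe.1 ≠ p).map fun qe => qe.1 ^ qe.2).prod

/-- Running time of `cofactor`. -/
def cofactorCost (fs : List (ℕ × ℕ)) : ℕ := 1 + (fs.map fun qe => 2 + 2 * qe.2.size).sum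

theorem runs_cofactor (fs : List (ℕ × ℕ)) (p : ℕ) :
    Runs (cofactor fs p) (cofactorCost fs) fun u => u = (cof fs p : ℚ) := by
  unfold cofactor
  refine Runs.lit (Runs.foldlM (fun l u => u = (cof l p : ℚ)) ?_ (by simp [cof]))
  rintro l₁ ⟨q, e⟩ l₂ u - rfl
  refine Runs.le (Runs.ite (T₁ := 0) (T₂ := 2 + 2 * e.size) (fun h => Runs.pure ?_) fun h => ?_)
    (by dsimp only; omega)
  · simp only at h
    simp [cof, h]
  · refine Runs.le (Runs.lit (runs_power_mul (Runs.of_bind_pure (Runs.op (Runs.pure ?_)))))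
      (by dsimp only; omega)
    simp only at h
    simp [cof, h, Op.eval]

/-- Being a multiple of the cofactor is all that is used of the idempotent: it keeps denominators
prime to `p` out of the lifts. -/
theorem runs_idempotent {p : ℕ} [hp : Fact p.Prime] (fs : List (ℕ × ℕ)) :
    Runs (idempotent fs p) (cofactorCost fs + 4 * p.size + 4) fun e =>
      ∃ w : ℕ, e = (cof fs p * w : ℚ) := by
  have h1 := hp.out.one_lt
  have hsize : (p - 2).size ≤ p.size := Nat.size_le_size (by omega)
  unfold idempotent
  refine Runs.le (Runs.bind (runs_cofactor fs p) fun u hu => Runs.lit (Runs.lit (Runs.op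
    (Runs.bind (runs_power_mod h1 _ _) fun w hw => Runs.of_bind_pure
      (Runs.op (Runs.pure ?_)))))) (by omega)
  subst hu
  have := hw ((cof fs p : ℕ) : ZMod p) (Rep.mod ⟨(cof fs p : ℤ), by simp, by simp⟩)
  exact ⟨_, by rw [this, red, Op.eval]⟩

end Cofactor

/-! ### Dual lattices of overlattices, and the cost at one prime. -/

section Overlattice

variable {n : ℕ} {G S S' S'' : Matrix (Fin n) (Fin n) ℚ}

/-- Gram matrix of the dual basis. -/
noncomputable def dualGram (G S : Matrix (Fin n) (Fin n) ℚ) : Matrix (Fin n) (Fin n) ℚ :=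
  (Sᵀ * (G * S))⁻¹

/-- The lattice spanned by the columns of `S` lies in the one spanned by the columns of `S'`. -/
def Refines (S S' : Matrix (Fin n) (Fin n) ℚ) : Prop := ∃ T, S' * T = S ∧ IsInt T

theorem Refines.refl (S : Matrix (Fin n) (Fin n) ℚ) : Refines S S := ⟨1, by simp, IsInt.one⟩

theorem Refines.trans (h : Refines S S') (h' : Refines S' S'') : Refines S S'' := by
  obtain ⟨T, rfl, hT⟩ := h
  obtain ⟨T', rfl, hT'⟩ := h'
  exact ⟨T' * T, by rw [Matrix.mul_assoc], hT'.mul hT⟩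

theorem Refines.isUnit (h : Refines S S') (hS : IsUnit S.det) : IsUnit S'.det := by
  obtain ⟨T, rfl, -⟩ := h
  rw [det_mul] at hS
  exact isUnit_of_mul_isUnit_left hS

theorem dualGram_mul {T : Matrix (Fin n) (Fin n) ℚ} (h : S' * T = S) (hS : IsUnit S.det) :
    dualGram G S' = T * dualGram G S * Tᵀ := by
  have hT : IsUnit T.det := by
    rw [← h, det_mul] at hS
    exact isUnit_of_mul_isUnit_right hS
  have hTt : IsUnit Tᵀ.det := by rwa [det_transpose]
  have e : Sᵀ * (G * S) = Tᵀ * (S'ᵀ * (G * S')) * T := by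
    rw [← h, transpose_mul]
    simp only [Matrix.mul_assoc]
  rw [dualGram, dualGram, e]
  generalize S'ᵀ * (G * S') = A
  rw [Matrix.mul_inv_rev, Matrix.mul_inv_rev]
  simp only [Matrix.mul_assoc]
  rw [Matrix.nonsing_inv_mul _ hTt, Matrix.mul_one, ← Matrix.mul_assoc,
    Matrix.mul_nonsing_inv _ hT, Matrix.one_mul]

/-- The dual matrix changes to `T * dualGram G S * Tᵀ` with `T` integral. So a number that kills
`L^#/L` kills the corresponding quotient of every overlattice, and work at one prime does not spoil
what was reached at others. -/
theorem Refines.dual (h : Refines S S') (hS : IsUnit S.det) {c : ℚ}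
    (hc : IsInt (c • dualGram G S)) : IsInt (c • dualGram G S') := by
  obtain ⟨T, hT, hi⟩ := h
  rw [dualGram_mul hT hS, ← Matrix.smul_mul, ← Matrix.mul_smul]
  exact (hi.mul hc).mul hi.transpose

theorem gram_transpose (hG : Gᵀ = G) : (Sᵀ * (G * S))ᵀ = Sᵀ * (G * S) := by
  rw [transpose_mul, transpose_mul, transpose_transpose, hG, Matrix.mul_assoc]

theorem dualGram_transpose (hG : Gᵀ = G) : (dualGram G S)ᵀ = dualGram G S := by
  rw [dualGram, Matrix.transpose_nonsing_inv, gram_transpose hG]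

theorem runs_gram {α : Type} {T : ℕ} {Post : α → Prop} {F : Matrix (Fin n) (Fin n) ℚ → Prog ℚ α}
    (h : Runs (F (Sᵀ * (G * S))) T Post) :
    Runs (gram G S >>= F) (2 * rectCost n n n + T) Post := by
  unfold gram
  rw [bind_assoc]
  refine Runs.le (Runs.mmul (Runs.mmul h)) ?_
  simp only [Fintype.card_fin]
  omega

theorem runs_dual (hG : Gᵀ = G) (hdet : G.det ≠ 0) (hS : IsUnit S.det) :
    Runs (inverse (Sᵀ * (G * S))) (inverseCost n) fun B => B = dualGram G S := by
  refine (runs_inverse _).post fun B hB => hB (gram_transpose hG) ?_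
  rw [det_mul, det_mul, det_transpose]
  exact mul_ne_zero hS.ne_zero (mul_ne_zero hdet hS.ne_zero)

/-- There are `2 ^ d` leaves, and only they depend on `p` and `k`. -/
theorem adjoinCost_eq (n leaf d : ℕ) : adjoinCost n leaf d = adjoinCost n 0 d + 2 ^ d * leaf := by
  induction d with
  | zero => simp [adjoinCost]
  | succ d ih => rw [adjoinCost, adjoinCost, ih]; ring

/-- The part of the running time of one round of `saturate` that is independent of `p`. -/
noncomputable def saturateCost (n : ℕ) (fs : List (ℕ × ℕ)) : ℕ :=
  5 + 2 * rectCost n n n + inverseCost n + cofactorCost fs + n * n + enlargeCost n n 0 0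

/-- Running time of a round of `saturate` per factor `p` by which the exponent of the
discriminant group drops. -/
def saturateStepCost (n p : ℕ) : ℕ := 2 + 2 ^ Nat.clog 2 n * (3 * n + 4 + 4 * p.size)

/-- The cost is affine in `k`; that makes the sum over the saturation rounds telescope. -/
theorem enlargeCost_eq (n h p k : ℕ) :
    enlargeCost n h p k = enlargeCost n h 0 0 +
      k * (2 ^ Nat.clog 2 h * (3 * n + 4 + 4 * p.size)) := by
  simp only [enlargeCost, leafCost]
  rw [adjoinCost_eq, adjoinCost_eq n (5 + _ + _ + _ + _)]
  ring

/-- A round lowers the exponent from `m` to `c = ⌈m / 2⌉` by adjoining columns with denominators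
dividing `p ^ (m - c)`. Its variable cost is proportional to `m - c`, so over all rounds at most `m`
times the step cost accrues. -/
theorem runs_saturate {p : ℕ} [hp : Fact p.Prime] (hG : Gᵀ = G) (hdet : G.det ≠ 0)
    (fs : List (ℕ × ℕ)) {rounds m : ℕ} (hm : 1 ≤ m) (hmr : m ≤ 2 ^ rounds) (hS : IsUnit S.det)
    (hd : IsInt (((cof fs p : ℚ) * p ^ m) • dualGram G S)) :
    Runs (saturate G fs p rounds m S) (rounds * saturateCost n fs + m * saturateStepCost n p)
      fun S' => Refines S S' ∧ IsInt (((cof fs p : ℚ) * p) • dualGram G S') := by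
  induction rounds generalizing m S with
  | zero =>
    obtain rfl : m = 1 := by omega
    exact Runs.le (Runs.pure ⟨Refines.refl S, by simpa using hd⟩) (Nat.zero_le _)
  | succ rounds ih =>
    unfold saturate
    set c := (m + 1) / 2 with hc
    have hk : m = c + (m - c) := by omega
    set k := m - c with hkdef
    rw [pow_succ] at hmr
    refine Runs.le (Runs.lit (Runs.lit (runs_gram (Runs.bind (runs_dual hG hdet hS)
      fun B hB => Runs.bind (runs_cofactor fs p) fun u hu => runs_power_mul (Runs.op (Runs.each
      (Runs.bind (T₂ := rounds * saturateCost n fs + c * saturateStepCost n p)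
      (runs_enlarge k S _) fun S' hS' => ?_))))))) ?_
    · subst hB hu
      set C : Matrix (Fin n) (Fin n) ℚ := ((cof fs p : ℚ) * p ^ c) • dualGram G S with hC
      have e : (fun i j => Op.eval .mul (dualGram G S i j) (Op.eval .mul (cof fs p) (p ^ c)) :
          Matrix (Fin n) (Fin n) ℚ) = C := by
        funext i j
        exact mul_comm _ _
      rw [e] at hS'
      obtain ⟨T, hT, hTi, hTC⟩ := hS' (by
        rw [hC, smul_smul]
        convert hd using 2
        rw [hk, pow_add]; ring)
      have href : Refines S S' := ⟨T, hT, hTi⟩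
      refine (ih (by omega) (by omega) (href.isUnit hS) ?_).post
        fun S'' h => ⟨href.trans h.1, h.2⟩
      -- The columns `C` lie in the new lattice, so `T * C` is integral, and `T * C * Tᵀ` is the
      -- scaled dual matrix of the new lattice.
      rw [dualGram_mul hT hS, ← Matrix.smul_mul, ← Matrix.mul_smul]
      exact hTC.mul hTi.transpose
    -- Powering to `c` is charged to the drop `k`, since `c ≤ k + 1`.
    · have hsize : c.size ≤ k + 1 := (size_le_self c).trans (by omega)
      have e1 : (rounds + 1) * saturateCost n fs =
        rounds * saturateCost n fs + saturateCost n fs := Nat.succ_mul _ _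
      have e2 : m * saturateStepCost n p =
          c * saturateStepCost n p + k * saturateStepCost n p := by rw [← add_mul, ← hk]
      have e3 : k * saturateStepCost n p =
          2 * k + k * (2 ^ Nat.clog 2 n * (3 * n + 4 + 4 * p.size)) := by
        rw [saturateStepCost]; ring
      have e4 := enlargeCost_eq n n p k
      simp only [Fintype.card_fin]
      have e5 : saturateCost n fs = 5 + 2 * rectCost n n n + inverseCost n + cofactorCost fs +
        n * n + enlargeCost n n 0 0 := rfl
      omega

/-- Running time of `liftVector`. -/
noncomputable def liftCost (n p : ℕ) (fs : List (ℕ × ℕ)) : ℕ :=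
  cofactorCost fs + 4 * p.size + 4 + rectCost n n 1 + n

theorem runs_liftVector {p : ℕ} [hp : Fact p.Prime] (fs : List (ℕ × ℕ))
    {B : Matrix (Fin n) (Fin n) ℚ} (hB : IsInt (((cof fs p : ℚ) * p) • B))
    {v : Matrix (Fin n) Unit ℚ} (hv : IsInt v) :
    Runs (liftVector fs p B v) (liftCost n p fs) fun y => IsInt ((p : ℚ) • y) := by
  unfold liftVector
  refine Runs.le (Runs.bind (runs_idempotent fs) fun e he =>
    Runs.mmul (Runs.of_bind_pure (Runs.each (Runs.pure ?_)))) ?_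
  · obtain ⟨w, rfl⟩ := he
    have h := (hB.mul hv).smul w
    convert h using 1
    funext i j
    rw [Matrix.smul_mul]
    change (p : ℚ) * ((B * v) i j * (cof fs p * w)) = ((w : ℤ) : ℚ) * (cof fs p * p * (B * v) i j)
    push_cast
    ring
  · simp only [Fintype.card_fin, Fintype.card_unit, liftCost]
    omega

/-- Running time of `maximizeAt`. -/
noncomputable def maximizeCost (n p : ℕ) (fs : List (ℕ × ℕ)) : ℕ :=
  8 + 2 * rectCost n n n + inverseCost n + cofactorCost fs + 4 * p.size + 2 * (n * n)
    + echelonCost p n + n * subspaceCost p n + n * liftCost n p fs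
    + (Finset.range (n + 1)).sup fun h => enlargeCost n h p 1

theorem runs_maximizeAt {p : ℕ} [hp : Fact p.Prime] (hG : Gᵀ = G) (hdet : G.det ≠ 0)
    (fs : List (ℕ × ℕ)) (hS : IsUnit S.det)
    (hd : IsInt (((cof fs p : ℚ) * p) • dualGram G S)) :
    Runs (maximizeAt G fs p S) (maximizeCost n p fs) (Refines S) := by
  unfold maximizeAt
  refine Runs.le (Runs.lit (Runs.lit (Runs.lit (runs_gram (Runs.bind (runs_dual hG hdet hS)
    fun B hB => Runs.bind (runs_idempotent fs) fun e he => Runs.op (Runs.each (Runs.each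
    (T := echelonCost p n + (n * subspaceCost p n + (n * liftCost n p fs +
      ((Finset.range (n + 1)).sup fun h => enlargeCost n h p 1)))) ?_))))))) ?_
  · subst hB
    obtain ⟨w, rfl⟩ := he
    have hz_int := hd
    choose z hz using hd
    have hz' (i j) : dualGram G S i j * (p * (cof fs p * w)) = ((z i j * w : ℤ) : ℚ) := by
      have h1 : ((cof fs p : ℚ) * p) * dualGram G S i j = z i j := hz i j
      push_cast
      rw [← h1]
      ring
    -- Saturation has made these entries integers, so the form has a reduction modulo `p`.
    set E : Matrix (Fin n) (Fin n) (ZMod p) := fun i j => ((z i j * w : ℤ) : ZMod p) with hE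
    have hEq : (fun i j => Op.eval .mod (Op.eval .mul (dualGram G S i j)
        (Op.eval .mul p (cof fs p * w))) (p : ℚ) : Matrix (Fin n) (Fin n) ℚ) = E.map red := by
      funext i j
      exact Rep.mod ⟨z i j * w, hz' i j, rfl⟩
    have hEt : Eᵀ = E := by
      have hzz (i j) : z i j = z j i := by
        have h3 : dualGram G S i j = dualGram G S j i :=
          congrFun (congrFun (dualGram_transpose hG) j) i
        have h1 : ((cof fs p : ℚ) * p) * dualGram G S i j = z i j := hz i j
        have h2 : ((cof fs p : ℚ) * p) * dualGram G S j i = z j i := hz j i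
        rw [h3, h2] at h1
        exact_mod_cast h1.symm
      ext i j
      change ((z j i * w : ℤ) : ZMod p) = ((z i j * w : ℤ) : ZMod p)
      rw [hzz]
    rw [hEq]
    refine Runs.bind (runs_echelon _) ?_
    rintro ⟨R, piv⟩ hpiv
    obtain ⟨hnodup, hnd⟩ := hpiv E rfl hEt
    refine Runs.bind (runs_isotropicSubspace n hnodup (X := fun i j => if i = j then 1 else 0)
      (E := E) ?_ fun _ => ⟨hEt, hnd⟩) fun vs hvs => ?_
    · intro i j
      by_cases h : i = j
      · exact ⟨1, by simp [h]⟩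
      · exact ⟨0, by simp [h]⟩
    refine Runs.bind ((Runs.mapM fun v hv => runs_liftVector fs hz_int (hvs.2 v hv)).le
      (Nat.mul_le_mul_right _ hvs.1)) fun lifts hlifts => ?_
    refine (runs_enlarge 1 S _).mono ?_ fun S' hS' => ?_
    -- The dimension of the subspace found is only known to be at most `n`, hence the supremum in
    -- the cost.
    · exact Finset.le_sup (f := fun h => enlargeCost n h p 1) (b := lifts.length)
        (Finset.mem_range.2 (by omega))
    · obtain ⟨T, hT, hTi, -⟩ := hS' fun i j => by
        have := hlifts.2 _ (lifts.get_mem j) i ()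
        rw [pow_one]
        exact this
      exact ⟨T, hT, hTi⟩
  · simp only [Fintype.card_fin, maximizeCost]
    omega

end Overlattice

/-! ## The running time of the algorithm -/

section EvenNeighbor

variable {n : ℕ}

theorem runs_find_mem {β : Type} {f : β → Prog ℚ Bool} {c : ℕ} (l : List β)
    (h : ∀ b ∈ l, Runs (f b) c fun _ => True) :
    Runs (MaxLat.find f l) (l.length * c) fun r => ∀ b, r = some b → b ∈ l := by
  induction l with
  | nil => exact (Runs.pure (by simp)).le (Nat.zero_le _)
  | cons b l ih =>
    rw [MaxLat.find]
    refine Runs.le (Runs.bind (h b List.mem_cons_self) fun r _ => Runs.ite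
      (fun _ => Runs.pure (by simp)) fun _ =>
      Runs.post (ih fun b hb => h b (List.mem_cons_of_mem _ hb)) ?_)
      (T := c + max 0 (l.length * c)) (by simp [add_mul, add_comm])
    exact fun r hr x hx => List.mem_cons_of_mem _ (hr x hx)

theorem runs_sum (l : List (Matrix (Fin n) Unit ℚ)) (hl : l.length ≤ 3) (x : Matrix (Fin n) Unit ℚ) :
    Runs (l.foldlM (MaxLat.zip .add) x) (3 * n) fun _ => True := by
  refine (Runs.foldlM (c := fun _ => n) (fun _ _ => True) ?_ trivial).le ?_
  · intro _ _ _ _ _ _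
    refine Runs.le (Runs.of_bind_pure (Runs.zip (Runs.pure trivial))) ?_
    simp
  · rw [List.map_const', List.sum_replicate, smul_eq_mul]
    exact Nat.mul_le_mul_right _ hl

/-- Running time of `evenNeighbor`. -/
noncomputable def evenCost (n : ℕ) : ℕ :=
  4 + 5 * rectCost n n n + 7 * n + n * n + echelonCost 2 n
    + 8 * (3 * n + rectCost n n 1 + rectCost 1 n 1 + 2) + enlargeCost n 1 2 1

/-- Nothing is random here: at most three null vectors are kept, so at most eight combinations are
tested, and the cost does not depend on properties of the lattice. -/
theorem runs_evenNeighbor (G S : Matrix (Fin n) (Fin n) ℚ) :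
    Runs (evenNeighbor G S) (evenCost n) fun _ => True := by
  unfold evenNeighbor
  refine Runs.le (Runs.lit (Runs.lit (Runs.lit (Runs.lit (runs_gram (Runs.each (Runs.bind
    (runs_find_mem (c := 1) _ fun i _ => Runs.of_bind_pure (Runs.test (Runs.pure trivial)))
    (T₂ := 3 * rectCost n n n + 5 * n + n * n + echelonCost 2 n
    + 8 * (3 * n + rectCost n n 1 + rectCost 1 n 1 + 2) + enlargeCost n 1 2 1) ?_))))))) ?_
  · rintro (_ | i₀) -
    · exact Runs.le (Runs.pure trivial) (Nat.zero_le _)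
    refine Runs.le (Runs.zip (Runs.mmul (runs_gram (Runs.each (Runs.bind (runs_echelon (p := 2) _)
      (T₂ := 4 * n + 8 * (3 * n + rectCost n n 1 + rectCost 1 n 1 + 2) + enlargeCost n 1 2 1)
        ?_))))) ?_
    · rintro ⟨R, piv⟩ -
      dsimp only
      have hlen (N : List (Matrix (Fin n) Unit ℚ)) :
          ((N.take 3).sublists.filter fun l => !l.isEmpty).length ≤ 8 := by
        refine (List.length_filter_le _ _).trans ?_
        rw [List.length_sublists]
        exact (Nat.pow_le_pow_right (by norm_num) (List.length_take_le 3 _)).trans (by norm_num)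
      have hmem (N : List (Matrix (Fin n) Unit ℚ)) :
          ∀ l ∈ (N.take 3).sublists.filter fun l => !l.isEmpty, l.length ≤ 3 := fun l hl =>
        (List.mem_sublists.1 (List.mem_filter.1 hl).1).length_le.trans (List.length_take_le 3 _)
      refine Runs.le (Runs.bind ((runs_find_mem (c := 3 * n + rectCost n n 1 + rectCost 1 n 1 + 2)
        _ fun l hl => ?_).le (Nat.mul_le_mul_right _ (hlen _)))
        (T₂ := 4 * n + enlargeCost n 1 2 1) ?_) ?_
      · refine Runs.le (Runs.bind (runs_sum l (hmem _ l hl) _) fun x _ => Runs.mmul (Runs.mmul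
          (Runs.op (Runs.of_bind_pure (Runs.test (Runs.pure trivial)))))) ?_
        simp only [Fintype.card_fin, Fintype.card_unit]
        omega
      · rintro (_ | l) hl
        · exact Runs.le (Runs.pure trivial) (Nat.zero_le _)
        · refine Runs.le (Runs.bind (runs_sum l (hmem _ l (hl l rfl)) _) fun x _ =>
            Runs.each ((runs_enlarge 1 _ _).post fun _ _ => trivial)) ?_
          simp only [Fintype.card_fin, Fintype.card_unit]
          omega
      · omega
    · simp only [Fintype.card_fin, Fintype.card_unit]
      omega
  · simp only [Fintype.card_fin, Fintype.card_unit, List.length_finRange, evenCost]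
    omega

end EvenNeighbor

/-! ### The exact cost summed over all primes. -/

section Total

theorem mem_factorPairs {D p e : ℕ} :
    (p, e) ∈ factorPairs D ↔ p ∈ D.primeFactors ∧ e = padicValNat p D := by
  simp only [factorPairs, List.mem_map, List.mem_dedup, Prod.mk.injEq, Nat.primeFactors,
    List.mem_toFinset]
  constructor
  · rintro ⟨q, hq, rfl, rfl⟩
    exact ⟨hq, rfl⟩
  · rintro ⟨h, rfl⟩
    exact ⟨p, h, rfl, rfl⟩

theorem primeFactors_eq_toFinset_dedup (D : ℕ) :
    D.primeFactors = D.primeFactorsList.dedup.toFinset := by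
  ext
  simp only [Nat.primeFactors, List.mem_toFinset, List.mem_dedup]

theorem sum_factorPairs (D : ℕ) (f : ℕ × ℕ → ℕ) :
    ((factorPairs D).map f).sum = ∑ p ∈ D.primeFactors, f (p, padicValNat p D) := by
  rw [factorPairs, List.map_map, primeFactors_eq_toFinset_dedup,
    List.sum_toFinset _ (List.nodup_dedup _)]
  rfl

theorem prod_primeFactors_pow {D : ℕ} (hD : D ≠ 0) : ∏ p ∈ D.primeFactors, p ^ padicValNat p D = D := by
  conv_rhs => rw [← Nat.prod_factorization_pow_eq_self hD]
  rw [Finsupp.prod, Nat.support_factorization]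
  exact Finset.prod_congr rfl fun q hq => by
    rw [Nat.factorization_def _ (Nat.prime_of_mem_primeFactors hq)]

theorem one_le_padicVal {D : ℕ} (hD : D ≠ 0) {p : ℕ} (hp : p ∈ D.primeFactors) : 1 ≤ padicValNat p D :=
  have : Fact p.Prime := ⟨Nat.prime_of_mem_primeFactors hp⟩
  one_le_padicValNat_of_dvd hD (Nat.dvd_of_mem_primeFactors hp)

theorem cof_factorPairs_mul {D p : ℕ} (hD : D ≠ 0) (hp : p ∈ D.primeFactors) :
    cof (factorPairs D) p * p ^ padicValNat p D = D := by
  have h1 : cof (factorPairs D) p = ∏ q ∈ D.primeFactors.erase p, q ^ padicValNat q D := by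
    have : D.primeFactors.erase p = (D.primeFactorsList.dedup.filter (· ≠ p)).toFinset := by
      ext q
      simp [primeFactors_eq_toFinset_dedup, -Nat.toFinset_factors, and_comm]
    rw [this, List.prod_toFinset _ ((List.nodup_dedup _).filter _), cof, factorPairs,
      List.filter_map, List.map_map]
    rfl
  rw [h1, Finset.prod_erase_mul _ _ hp, prod_primeFactors_pow hD]

variable {n : ℕ}

/-- Up to sign the matrix is the adjugate of `G`. -/
theorem isInt_det_smul_inv (G : Matrix (Fin n) (Fin n) ℤ) (h : G.det ≠ 0) :
    IsInt ((G.det.natAbs : ℚ) • (G.map (Int.cast : ℤ → ℚ))⁻¹) := by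
  have hdet : (G.map (Int.cast : ℤ → ℚ)).det = G.det := (Int.cast_det G).symm
  have hadj : (G.map (Int.cast : ℤ → ℚ)).adjugate = G.adjugate.map (Int.cast : ℤ → ℚ) :=
    (RingHom.map_adjugate (Int.castRingHom ℚ) G).symm
  have h0 : (G.det : ℚ) ≠ 0 := by exact_mod_cast h
  rw [Matrix.inv_def, hdet, hadj, smul_smul, Ring.inverse_eq_inv']
  intro i j
  refine ⟨G.det.sign * G.adjugate i j, ?_⟩
  change ((G.det.natAbs : ℚ) * (G.det : ℚ)⁻¹) * (G.adjugate i j : ℚ) = _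
  rw [Int.cast_mul]
  congr 1
  have h1 : (G.det.sign : ℚ) * G.det = G.det.natAbs := by
    rw [Nat.cast_natAbs, ← Int.cast_mul, Int.sign_mul_self_eq_abs]
  rw [← h1, mul_assoc, mul_inv_cancel₀ h0, mul_one]

/-- Running time of `maximalOverlattice`. -/
noncomputable def totalCost (n D : ℕ) : ℕ :=
  2 + ((∑ p ∈ D.primeFactors, (Nat.clog 2 (padicValNat p D) * saturateCost n (factorPairs D)
      + padicValNat p D * saturateStepCost n p))
    + ((∑ p ∈ D.primeFactors, maximizeCost n p (factorPairs D)) + evenCost n))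

/-- The initial bound on the discriminant group is kept for all primes, since those not yet treated
need it; the sharper bound accumulates over the treated ones. Both survive by `Refines.dual`. -/
theorem runs_saturate_all {G S : Matrix (Fin n) (Fin n) ℚ} (hG : Gᵀ = G) (hdet : G.det ≠ 0)
    {fs : List (ℕ × ℕ)} (hfs : ∀ pe ∈ fs, pe.1.Prime ∧ 1 ≤ pe.2) (hS : IsUnit S.det)
    (hd : ∀ pe ∈ fs, IsInt (((cof fs pe.1 : ℚ) * pe.1 ^ pe.2) • dualGram G S)) :
    Runs (fs.foldlM (fun S pe => saturate G fs pe.1 (Nat.clog 2 pe.2) pe.2 S) S)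
      (fs.map fun pe => Nat.clog 2 pe.2 * saturateCost n fs + pe.2 * saturateStepCost n pe.1).sum
      fun S => IsUnit S.det ∧ ∀ pe ∈ fs, IsInt (((cof fs pe.1 : ℚ) * pe.1) • dualGram G S) := by
  refine (Runs.foldlM
      (fun l S => IsUnit S.det ∧ (∀ pe ∈ fs, IsInt (((cof fs pe.1 : ℚ) * pe.1 ^ pe.2) •
        dualGram G S)) ∧ ∀ pe ∈ l, IsInt (((cof fs pe.1 : ℚ) * pe.1) • dualGram G S)) ?_
      ⟨hS, hd, by simp⟩).post fun S h => ⟨h.1, h.2.2⟩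
  rintro l₁ pe l₂ S hl ⟨h1, h2, h3⟩
  have hmem : pe ∈ fs := by rw [hl]; simp
  have : Fact pe.1.Prime := ⟨(hfs pe hmem).1⟩
  refine (runs_saturate hG hdet fs (hfs pe hmem).2 (Nat.le_pow_clog (by norm_num) _) h1
    (h2 _ hmem)).post fun S' ⟨hr, hS'⟩ => ⟨hr.isUnit h1, fun pe h => hr.dual h1 (h2 pe h),
      fun pe h => ?_⟩
  rcases List.mem_append.1 h with h | h
  · exact hr.dual h1 (h3 pe h)
  · rw [List.mem_singleton.1 h]
    exact hS'

theorem runs_maximize_all {G S : Matrix (Fin n) (Fin n) ℚ} (hG : Gᵀ = G) (hdet : G.det ≠ 0)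
    {fs : List (ℕ × ℕ)} (hfs : ∀ pe ∈ fs, pe.1.Prime) (hS : IsUnit S.det)
    (hd : ∀ pe ∈ fs, IsInt (((cof fs pe.1 : ℚ) * pe.1) • dualGram G S)) :
    Runs (fs.foldlM (fun S pe => maximizeAt G fs pe.1 S) S)
      (fs.map fun pe => maximizeCost n pe.1 fs).sum fun _ => True := by
  refine (Runs.foldlM (fun _ S => IsUnit S.det ∧
      ∀ pe ∈ fs, IsInt (((cof fs pe.1 : ℚ) * pe.1) • dualGram G S)) ?_
      ⟨hS, hd⟩).post fun _ _ => trivial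
  rintro l₁ pe l₂ S hl ⟨h1, h2⟩
  have hmem : pe ∈ fs := by rw [hl]; simp
  have : Fact pe.1.Prime := ⟨hfs pe hmem⟩
  exact (runs_maximizeAt hG hdet fs h1 (h2 _ hmem)).post fun S' hr =>
    ⟨hr.isUnit h1, fun pe h => hr.dual h1 (h2 pe h)⟩

theorem runs_maximalOverlattice {D : ℕ} (G : Matrix (Fin n) (Fin n) ℤ) (hG : G.IsSymm)
    (hD : D = G.det.natAbs) (hD2 : 2 ≤ D) :
    Runs (maximalOverlattice (factorPairs D) (G.map (Int.cast : ℤ → ℚ))) (totalCost n D)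
      fun _ => True := by
  have hdet : G.det ≠ 0 := by rintro h; rw [h] at hD; simp at hD; omega
  have hDinv := isInt_det_smul_inv G hdet
  have hsymm : (G.map (Int.cast : ℤ → ℚ))ᵀ = G.map Int.cast := by rw [← transpose_map, hG.eq]
  have hdet' : (G.map (Int.cast : ℤ → ℚ)).det ≠ 0 := by
    rw [show (G.map (Int.cast : ℤ → ℚ)).det = (G.det : ℚ) from (Int.cast_det G).symm]
    exact_mod_cast hdet
  rw [← hD] at hDinv
  generalize G.map (Int.cast : ℤ → ℚ) = G' at *
  have hfs : ∀ pe ∈ factorPairs D, pe.1.Prime ∧ 1 ≤ pe.2 := by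
    rintro ⟨p, e⟩ h
    obtain ⟨hpD, rfl⟩ := mem_factorPairs.1 h
    exact ⟨Nat.prime_of_mem_primeFactors hpD, one_le_padicVal (by omega) hpD⟩
  unfold maximalOverlattice
  refine Runs.le (Runs.lit (Runs.lit (Runs.bind (runs_saturate_all (S := 1) hsymm hdet' hfs
    (by simp) fun pe h => ?_) fun S hS => Runs.bind (runs_maximize_all hsymm hdet'
      (fun pe h => (hfs pe h).1) hS.1 hS.2) fun S' _ => runs_evenNeighbor G' S'))) ?_
  -- At the start cofactor times prime power is `D` for every `p`, and `D G⁻¹` is integral.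
  · obtain ⟨p, e⟩ := pe
    obtain ⟨hpD, rfl⟩ := mem_factorPairs.1 h
    have h1 := cof_factorPairs_mul (by omega : D ≠ 0) hpD
    have e1 : ((cof (factorPairs D) p : ℚ) * p ^ padicValNat p D) = D := by exact_mod_cast h1
    simp only [e1, dualGram, transpose_one, Matrix.mul_one, Matrix.one_mul]
    exact hDinv
  · rw [sum_factorPairs, sum_factorPairs, totalCost]
    dsimp only
    omega

end Total

/-! ## Asymptotic estimates -/

section Estimates

variable {ψ κ : ℝ}

/-- `κ` bounds the cost of square products relative to the exponent `ψ`. -/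
structure ExponentBound (ψ κ : ℝ) : Prop where
  two_lt : 2 < ψ
  le_three : ψ ≤ 3
  one_le : 1 ≤ κ
  bound : ∀ s : ℕ, 1 ≤ s → (mmCost s : ℝ) + (s : ℝ) ^ 2 ≤ κ * (s : ℝ) ^ ψ

theorem IsMatMulExponent.exists_bound (h : IsMatMulExponent ψ) (h2 : 2 < ψ) (h3 : ψ ≤ 3) :
    ∃ κ, ExponentBound ψ κ := by
  obtain ⟨c, hc⟩ := h
  refine ⟨|c| + 1, h2, h3, by linarith [abs_nonneg c], fun s hs => ?_⟩
  have hs' : (1 : ℝ) ≤ s := by exact_mod_cast hs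
  have h0 : (0 : ℝ) ≤ (s : ℝ) ^ ψ := Real.rpow_nonneg (by linarith) _
  have h1 : (s : ℝ) ^ 2 ≤ (s : ℝ) ^ ψ := by
    rw [← Real.rpow_natCast]
    exact Real.rpow_le_rpow_of_exponent_le hs' (by push_cast; linarith)
  have := hc s hs
  nlinarith [le_abs_self c]

theorem ceilDiv_mul_le {a s : ℕ} (hs : 1 ≤ s) (h : s ≤ a) : (a ⌈/⌉ s) * s ≤ 2 * a := by
  rw [Nat.ceilDiv_eq_add_pred_div]
  exact (Nat.div_mul_le_self _ _).trans (by omega)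

/-- As `s` is the least dimension, each number of blocks is at most twice the exact quotient, whence
the factor `8`. -/
theorem ExponentBound.rectCost_le (hκ : ExponentBound ψ κ) {a b c : ℕ} (ha : 1 ≤ a) (hb : 1 ≤ b)
    (hc : 1 ≤ c) : (rectCost a b c : ℝ) ≤
      8 * κ * (a * b * c) * ((min a (min b c) : ℕ) : ℝ) ^ (ψ - 3) := by
  set s := min a (min b c) with hs
  have hs1 : 1 ≤ s := by omega
  have hs0 : (0 : ℝ) < s := by exact_mod_cast hs1
  have e1 : ((a ⌈/⌉ s : ℕ) : ℝ) * s ≤ 2 * a := by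
    exact_mod_cast ceilDiv_mul_le hs1 (by omega)
  have e2 : ((b ⌈/⌉ s : ℕ) : ℝ) * s ≤ 2 * b := by
    exact_mod_cast ceilDiv_mul_le hs1 (by omega)
  have e3 : ((c ⌈/⌉ s : ℕ) : ℝ) * s ≤ 2 * c := by
    exact_mod_cast ceilDiv_mul_le hs1 (by omega)
  have e4 := hκ.bound s hs1
  have hκ0 : 0 ≤ κ := by linarith [hκ.one_le]
  have hpow : (s : ℝ) ^ ψ = (s : ℝ) ^ (ψ - 3) * s ^ 3 := by
    rw [Real.rpow_sub hs0]
    have : (s : ℝ) ^ (3 : ℝ) = s ^ 3 := by exact_mod_cast Real.rpow_natCast (s : ℝ) 3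
    rw [this, div_mul_cancel₀ _ (by positivity)]
  rw [hpow] at e4
  have e : (rectCost a b c : ℝ) =
      (a ⌈/⌉ s : ℕ) * (b ⌈/⌉ s : ℕ) * (c ⌈/⌉ s : ℕ) * (mmCost s + (s : ℝ) ^ 2) := by
    rw [show rectCost a b c = (a ⌈/⌉ s) * (b ⌈/⌉ s) * (c ⌈/⌉ s) * (mmCost s + s ^ 2) from rfl]
    push_cast
    rfl
  have hr : (0 : ℝ) ≤ (s : ℝ) ^ (ψ - 3) := Real.rpow_nonneg hs0.le _
  rw [e]
  calc _ ≤ (a ⌈/⌉ s : ℕ) * (b ⌈/⌉ s : ℕ) * (c ⌈/⌉ s : ℕ) * (κ * ((s : ℝ) ^ (ψ - 3) * s ^ 3)) := by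
        gcongr
    _ = κ * (s : ℝ) ^ (ψ - 3) *
        (((a ⌈/⌉ s : ℕ) * s) * ((b ⌈/⌉ s : ℕ) * s) * ((c ⌈/⌉ s : ℕ) * s)) := by ring
    _ ≤ κ * (s : ℝ) ^ (ψ - 3) * ((2 * a) * (2 * b) * (2 * c)) := by gcongr
    _ = _ := by ring

theorem ExponentBound.rectCost_le_mul (hκ : ExponentBound ψ κ) {a b c : ℕ} (ha : 1 ≤ a)
    (hb : 1 ≤ b) (hc : 1 ≤ c) : (rectCost a b c : ℝ) ≤ 8 * κ * (a * b * c) := by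
  refine (hκ.rectCost_le ha hb hc).trans ?_
  have hκ0 : 0 ≤ κ := by linarith [hκ.one_le]
  refine mul_le_of_le_one_right (by positivity) (Real.rpow_le_one_of_one_le_of_nonpos ?_ ?_)
  · exact_mod_cast (by omega : 1 ≤ min a (min b c))
  · linarith [hκ.le_three]

/-- The bound for products in which `s` is the least dimension. -/
theorem ExponentBound.rectCost_le_rpow (hκ : ExponentBound ψ κ) {a b c s : ℕ} (hs : 1 ≤ s)
    (hmin : min a (min b c) = s) : (rectCost a b c : ℝ) ≤
      8 * κ * (a * b * c) * (s : ℝ) ^ (ψ - 3) := by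
  rw [← hmin]
  exact hκ.rectCost_le (by omega) (by omega) (by omega)

theorem ExponentBound.rectCost_self (hκ : ExponentBound ψ κ) {s : ℕ} (hs : 1 ≤ s) :
    (rectCost s s s : ℝ) ≤ 8 * κ * (s : ℝ) ^ ψ := by
  refine (hκ.rectCost_le_rpow hs (by simp)).trans (le_of_eq ?_)
  have hs0 : (0 : ℝ) < s := by exact_mod_cast hs
  have : (s : ℝ) ^ (3 : ℝ) = s ^ 3 := by exact_mod_cast Real.rpow_natCast (s : ℝ) 3
  rw [Real.rpow_sub hs0, this]
  field_simp

/-- The constant satisfies `2 * 18 + 4 * 8 + 3 + 1 = 4 * 18`, and `4 ≤ 2 ^ ψ`. -/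
theorem ExponentBound.invCost_le (hκ : ExponentBound ψ κ) (d : ℕ) :
    (invCost d : ℝ) ≤ 18 * κ * ((2 ^ d : ℕ) : ℝ) ^ ψ := by
  induction d with
  | zero => simp [invCost]; linarith [hκ.one_le]
  | succ d ih =>
    have h1 : (1 : ℝ) ≤ ((2 ^ d : ℕ) : ℝ) := by exact_mod_cast Nat.one_le_two_pow
    set x : ℝ := ((2 ^ d : ℕ) : ℝ) with hx
    have hr := hκ.rectCost_self (s := 2 ^ d) Nat.one_le_two_pow
    rw [← hx] at hr
    have e : ((2 ^ (d + 1) : ℕ) : ℝ) = 2 * x := by rw [hx]; push_cast; ring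
    have h4 : (4 : ℝ) ≤ 2 ^ ψ := by
      calc (4 : ℝ) = 2 ^ (2 : ℝ) := by norm_num
        _ ≤ _ := Real.rpow_le_rpow_of_exponent_le (by norm_num) hκ.two_lt.le
    have h2 : x * x ≤ x ^ ψ := by
      rw [← pow_two, ← Real.rpow_natCast]
      exact Real.rpow_le_rpow_of_exponent_le h1 (by push_cast; exact hκ.two_lt.le)
    have hy : 1 ≤ x ^ ψ := by nlinarith
    rw [e, Real.mul_rpow (by norm_num) (by linarith), invCost]
    push_cast at hx ⊢
    rw [← hx]
    have hκ1 := hκ.one_le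
    have h5 : x ^ ψ ≤ κ * x ^ ψ := le_mul_of_one_le_left (by linarith) hκ1
    have h6 : 4 * (κ * x ^ ψ) ≤ 2 ^ ψ * (κ * x ^ ψ) :=
      mul_le_mul_of_nonneg_right h4 (by positivity)
    nlinarith

/-- The constant in the bound for `adjoinCost`. -/
noncomputable def adjoinConst (ψ κ : ℝ) : ℝ := 51 * κ / ((2 : ℝ) ^ (ψ - 1) - 2)

theorem two_lt_two_rpow (h : 2 < ψ) : (2 : ℝ) < (2 : ℝ) ^ (ψ - 1) := by
  calc (2 : ℝ) = (2 : ℝ) ^ (1 : ℝ) := by norm_num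
    _ < _ := Real.rpow_lt_rpow_of_exponent_lt (by norm_num) (by linarith)

theorem ExponentBound.adjoinConst_nonneg (hκ : ExponentBound ψ κ) : 0 ≤ adjoinConst ψ κ :=
  div_nonneg (by linarith [hκ.one_le]) (by linarith [two_lt_two_rpow hκ.two_lt])

/-- Doubling the number of columns doubles the recursive work, while the target grows by `2 ^ (ψ -
1) > 2`; the products on each level fit into the gap. At `ψ = 2` the gap would close. -/
theorem ExponentBound.adjoinCost_le (hκ : ExponentBound ψ κ) {n : ℕ} (d : ℕ)
    (hd : ∀ d' < d, 2 ^ d' ≤ n) :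
    (adjoinCost n 0 d : ℝ) ≤ adjoinConst ψ κ * n * ((2 ^ d : ℕ) : ℝ) ^ (ψ - 1) := by
  have hK := hκ.adjoinConst_nonneg
  induction d with
  | zero => simp only [adjoinCost, Nat.cast_zero]; positivity
  | succ d ih =>
    have hdn := hd d (by omega)
    have h1 : (1 : ℝ) ≤ ((2 ^ d : ℕ) : ℝ) := by exact_mod_cast Nat.one_le_two_pow
    have ih := ih fun d' h => hd d' (by omega)
    have hr1 := hκ.rectCost_le_rpow (a := 2 ^ d) (b := n) (c := 2 ^ d) (s := 2 ^ d)
      Nat.one_le_two_pow (by omega)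
    have hr2 := hκ.rectCost_le_rpow (a := n) (b := 2 ^ d) (c := 2 ^ d) (s := 2 ^ d)
      Nat.one_le_two_pow (by omega)
    have e : ((2 ^ (d + 1) : ℕ) : ℝ) = 2 * ((2 ^ d : ℕ) : ℝ) := by push_cast; ring
    rw [e, adjoinCost]
    push_cast only [Nat.cast_add, Nat.cast_mul]
    generalize hx : ((2 ^ d : ℕ) : ℝ) = x at *
    have hx0 : 0 < x := by linarith
    have e2 : x * x * x ^ (ψ - 3) = x ^ (ψ - 1) := by
      rw [show ψ - 1 = 1 + 1 + (ψ - 3) by ring, Real.rpow_add hx0, Real.rpow_add hx0,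
        Real.rpow_one]
    have h2 : x ≤ x ^ (ψ - 1) := by
      conv_lhs => rw [← Real.rpow_one x]
      exact Real.rpow_le_rpow_of_exponent_le h1 (by linarith [hκ.two_lt])
    rw [Real.mul_rpow (by norm_num) hx0.le]
    set y := x ^ (ψ - 1) with hy
    have hr1' : (rectCost (2 ^ d) n (2 ^ d) : ℝ) ≤ 8 * κ * (n * y) := by
      refine hr1.trans (le_of_eq ?_); rw [← e2]; ring
    have hr2' : (rectCost n (2 ^ d) (2 ^ d) : ℝ) ≤ 8 * κ * (n * y) := by
      refine hr2.trans (le_of_eq ?_); rw [← e2]; ring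
    -- The constant solves `K 2 ^ (ψ - 1) = 2 K + 51 κ`, with `51 = 3 (8 + 8 + 1)` for three updates
    -- of two products and one addition each.
    have hKe : adjoinConst ψ κ * ((2 : ℝ) ^ (ψ - 1) - 2) = 51 * κ :=
      div_mul_cancel₀ _ (by linarith [two_lt_two_rpow hκ.two_lt])
    have hny : (n : ℝ) * x ≤ κ * (n * y) := by
      have : (n : ℝ) * x ≤ n * y := by gcongr
      have h0 : 0 ≤ (n : ℝ) * y := by positivity
      nlinarith [hκ.one_le]
    have e3 : adjoinConst ψ κ * n * ((2 : ℝ) ^ (ψ - 1) * y) =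
        2 * (adjoinConst ψ κ * n * y) + 51 * (κ * (n * y)) := by
      linear_combination (n * y : ℝ) * hKe
    rw [e3]
    push_cast
    linarith

theorem two_pow_clog_le {n h : ℕ} (hn : 1 ≤ n) (hh : h ≤ n) : 2 ^ Nat.clog 2 h ≤ 2 * n := by
  rcases Nat.lt_or_ge h 2 with h2 | h2
  · rw [Nat.clog_of_right_le_one (by omega)]; omega
  · have := Nat.pow_pred_clog_lt_self (b := 2) (by norm_num) h2
    have h0 : 0 < Nat.clog 2 h := Nat.clog_pos (by norm_num) h2
    obtain ⟨d, hd⟩ := Nat.exists_eq_succ_of_ne_zero h0.ne'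
    rw [hd] at this ⊢
    rw [Nat.pow_succ]
    simp only [Nat.succ_eq_add_one, Nat.pred_eq_sub_one, Nat.add_sub_cancel] at this
    omega

theorem two_pow_le_of_lt_clog {n h d : ℕ} (hh : h ≤ n) (hd : d < Nat.clog 2 h) : 2 ^ d ≤ n :=
  ((Nat.lt_clog_iff_pow_lt (by norm_num)).1 hd).le.trans hh

variable {n : ℕ}

theorem ExponentBound.natCast_pow_le (hκ : ExponentBound ψ κ) (hn : 1 ≤ n) :
    (1 : ℝ) ≤ n ∧ (n : ℝ) ≤ (n : ℝ) ^ 2 ∧ (n : ℝ) ^ 2 ≤ (n : ℝ) ^ ψ ∧ (n : ℝ) ^ ψ ≤ (n : ℝ) ^ 3 := by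
  have h1 : (1 : ℝ) ≤ n := by exact_mod_cast hn
  refine ⟨h1, by nlinarith, ?_, ?_⟩
  · rw [← Real.rpow_natCast]
    exact Real.rpow_le_rpow_of_exponent_le h1 (by push_cast; exact hκ.two_lt.le)
  · rw [← Real.rpow_natCast (n : ℝ) 3]
    exact Real.rpow_le_rpow_of_exponent_le h1 (by push_cast; exact hκ.le_three)

theorem ExponentBound.inverseCost_le (hκ : ExponentBound ψ κ) (hn : 1 ≤ n) :
    (inverseCost n : ℝ) ≤ 162 * κ * (n : ℝ) ^ ψ := by
  obtain ⟨h1, h2, h3, -⟩ := hκ.natCast_pow_le hn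
  have hκ1 := hκ.one_le
  have hi := hκ.invCost_le (Nat.clog 2 n)
  have hr := hκ.rectCost_self hn
  have hle : (((2 ^ Nat.clog 2 n : ℕ) : ℝ)) ^ ψ ≤ 8 * (n : ℝ) ^ ψ := by
    calc (((2 ^ Nat.clog 2 n : ℕ) : ℝ)) ^ ψ ≤ ((2 * n : ℕ) : ℝ) ^ ψ := by
          refine Real.rpow_le_rpow (by positivity) ?_ (by linarith [hκ.two_lt])
          exact_mod_cast two_pow_clog_le hn le_rfl
      _ = 2 ^ ψ * (n : ℝ) ^ ψ := by
          push_cast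
          exact Real.mul_rpow (by norm_num) (by linarith)
      _ ≤ 8 * (n : ℝ) ^ ψ := by
          gcongr
          calc (2 : ℝ) ^ ψ ≤ 2 ^ (3 : ℝ) :=
                Real.rpow_le_rpow_of_exponent_le (by norm_num) hκ.le_three
            _ = 8 := by norm_num
  rw [inverseCost]
  push_cast
  have h5 : κ * (((2 ^ Nat.clog 2 n : ℕ) : ℝ)) ^ ψ ≤ κ * (8 * (n : ℝ) ^ ψ) :=
    mul_le_mul_of_nonneg_left hle (by linarith)
  have h6 : (n : ℝ) ^ ψ ≤ κ * (n : ℝ) ^ ψ := le_mul_of_one_le_left (by linarith) hκ1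
  linarith

theorem ExponentBound.adjoinCost_clog_le (hκ : ExponentBound ψ κ) (hn : 1 ≤ n) {h : ℕ}
    (hh : h ≤ n) : (adjoinCost n 0 (Nat.clog 2 h) : ℝ) ≤ 4 * adjoinConst ψ κ * (n : ℝ) ^ ψ := by
  have hn0 : (0 : ℝ) < n := by exact_mod_cast hn
  have hK := hκ.adjoinConst_nonneg
  have h2 := hκ.two_lt
  calc (adjoinCost n 0 (Nat.clog 2 h) : ℝ)
      ≤ adjoinConst ψ κ * n * ((2 ^ Nat.clog 2 h : ℕ) : ℝ) ^ (ψ - 1) :=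
        hκ.adjoinCost_le _ fun _ => two_pow_le_of_lt_clog hh
    _ ≤ adjoinConst ψ κ * n * ((2 * n : ℕ) : ℝ) ^ (ψ - 1) := by
        have : ((2 ^ Nat.clog 2 h : ℕ) : ℝ) ≤ ((2 * n : ℕ) : ℝ) := by
          exact_mod_cast two_pow_clog_le hn hh
        gcongr
        linarith
    _ = (2 : ℝ) ^ (ψ - 1) * adjoinConst ψ κ * (n * (n : ℝ) ^ (ψ - 1)) := by
        push_cast
        rw [Real.mul_rpow (by norm_num) hn0.le]
        ring
    _ = (2 : ℝ) ^ (ψ - 1) * adjoinConst ψ κ * (n : ℝ) ^ ψ := by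
        congr 1
        rw [Real.rpow_sub hn0, Real.rpow_one]
        field_simp
    _ ≤ _ := by
        gcongr
        calc (2 : ℝ) ^ (ψ - 1) ≤ 2 ^ (2 : ℝ) :=
              Real.rpow_le_rpow_of_exponent_le (by norm_num) (by linarith [hκ.le_three])
          _ = 4 := by norm_num

theorem ExponentBound.enlargeCost_self_le (hκ : ExponentBound ψ κ) (hn : 1 ≤ n) :
    (enlargeCost n n 0 0 : ℝ) ≤ (4 * adjoinConst ψ κ + 54 * κ) * (n : ℝ) ^ ψ := by
  obtain ⟨h1, h2, h3, -⟩ := hκ.natCast_pow_le hn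
  have hκ1 := hκ.one_le
  have hn0 : (0 : ℝ) < n := by linarith
  have ha := hκ.adjoinCost_clog_le hn le_rfl
  have hle : n ≤ 2 ^ Nat.clog 2 n := Nat.le_pow_clog (by norm_num) n
  have hx : ((2 ^ Nat.clog 2 n : ℕ) : ℝ) ≤ 2 * n := by exact_mod_cast two_pow_clog_le hn le_rfl
  have hr1 := hκ.rectCost_le_rpow (a := n) (b := n) (c := 2 ^ Nat.clog 2 n) (s := n) hn (by omega)
  have hr2 := hκ.rectCost_le_rpow (a := n) (b := 2 ^ Nat.clog 2 n) (c := n) (s := n) hn (by omega)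
  have e : enlargeCost n n 0 0 = 1 + (adjoinCost n 0 (Nat.clog 2 n) +
      2 ^ Nat.clog 2 n * (5 + 5 * n)) + rectCost n n (2 ^ Nat.clog 2 n) +
      rectCost n (2 ^ Nat.clog 2 n) n + n * n := by
    rw [enlargeCost, adjoinCost_eq]
    simp [leafCost]
  rw [e]
  generalize 2 ^ Nat.clog 2 n = x at *
  have e2 : (n : ℝ) * n * n * (n : ℝ) ^ (ψ - 3) = (n : ℝ) ^ ψ := by
    have : (n : ℝ) ^ (3 : ℝ) = n ^ 3 := by exact_mod_cast Real.rpow_natCast (n : ℝ) 3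
    rw [Real.rpow_sub hn0, this]
    field_simp
  have hp : (0 : ℝ) ≤ (n : ℝ) ^ (ψ - 3) := Real.rpow_nonneg hn0.le _
  have hb : κ * ((n : ℝ) * n * x) * (n : ℝ) ^ (ψ - 3) ≤ 2 * (κ * (n : ℝ) ^ ψ) := by
    rw [← e2]
    calc κ * ((n : ℝ) * n * x) * (n : ℝ) ^ (ψ - 3)
        ≤ κ * ((n : ℝ) * n * (2 * n)) * (n : ℝ) ^ (ψ - 3) := by gcongr
      _ = _ := by ring
  have hr1' : (rectCost n n x : ℝ) ≤ 16 * (κ * (n : ℝ) ^ ψ) := by linarith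
  have hr2' : (rectCost n x n : ℝ) ≤ 16 * (κ * (n : ℝ) ^ ψ) := by
    have : (n : ℝ) * x * n = n * n * x := by ring
    rw [this] at hr2
    linarith
  have hl : (x : ℝ) * (5 + 5 * n) ≤ 20 * (n : ℝ) ^ 2 := by
    calc (x : ℝ) * (5 + 5 * n) ≤ 2 * n * (5 + 5 * n) := by gcongr
      _ ≤ _ := by nlinarith
  have h6 : (n : ℝ) ^ ψ ≤ κ * (n : ℝ) ^ ψ := le_mul_of_one_le_left (by linarith) hκ1
  push_cast
  nlinarith

theorem ExponentBound.saturateCost_le (hκ : ExponentBound ψ κ) (hn : 1 ≤ n)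
    (fs : List (ℕ × ℕ)) : (saturateCost n fs : ℝ) ≤
      (4 * adjoinConst ψ κ + 238 * κ) * (n : ℝ) ^ ψ + cofactorCost fs := by
  obtain ⟨h1, h2, h3, -⟩ := hκ.natCast_pow_le hn
  have hr := hκ.rectCost_self hn
  have hi := hκ.inverseCost_le hn
  have he := hκ.enlargeCost_self_le hn
  have h6 : (n : ℝ) ^ ψ ≤ κ * (n : ℝ) ^ ψ := le_mul_of_one_le_left (by linarith) hκ.one_le
  rw [saturateCost]
  push_cast
  nlinarith

theorem saturateStepCost_le (hn : 1 ≤ n) (p : ℕ) :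
    saturateStepCost n p ≤ 16 * n ^ 2 + 8 * (n * p.size) := by
  rw [saturateStepCost]
  have h := Nat.mul_le_mul_right (3 * n + 4 + 4 * p.size) (two_pow_clog_le hn le_rfl)
  nlinarith

theorem ExponentBound.enlargeCost_le (hκ : ExponentBound ψ κ) (hn : 1 ≤ n) {h : ℕ} (hh : h ≤ n)
    (p : ℕ) : (enlargeCost n h p 1 : ℝ) ≤
      (4 * adjoinConst ψ κ + 68 * κ) * (n : ℝ) ^ 3 + 8 * (n * p.size) := by
  obtain ⟨h1, h2, h3, h4⟩ := hκ.natCast_pow_le hn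
  have hκ1 := hκ.one_le
  have hK := hκ.adjoinConst_nonneg
  have ha := hκ.adjoinCost_clog_le hn hh
  have hx : ((2 ^ Nat.clog 2 h : ℕ) : ℝ) ≤ 2 * n := by exact_mod_cast two_pow_clog_le hn hh
  have hr1 := hκ.rectCost_le_mul (a := n) (b := n) (c := 2 ^ Nat.clog 2 h) hn hn
    Nat.one_le_two_pow
  have hr2 := hκ.rectCost_le_mul (a := n) (b := 2 ^ Nat.clog 2 h) (c := n) hn
    Nat.one_le_two_pow hn
  have e : enlargeCost n h p 1 = 1 + (adjoinCost n 0 (Nat.clog 2 h) +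
      2 ^ Nat.clog 2 h * (9 + 8 * n + 4 * p.size)) + rectCost n n (2 ^ Nat.clog 2 h) +
      rectCost n (2 ^ Nat.clog 2 h) n + n * n := by
    rw [enlargeCost, adjoinCost_eq, leafCost]
    ring
  rw [e]
  generalize 2 ^ Nat.clog 2 h = x at *
  have hb : κ * ((n : ℝ) * n * x) ≤ 2 * (κ * (n : ℝ) ^ 3) := by
    calc κ * ((n : ℝ) * n * x) ≤ κ * ((n : ℝ) * n * (2 * n)) := by gcongr
      _ = _ := by ring
  have hr1' : (rectCost n n x : ℝ) ≤ 16 * (κ * (n : ℝ) ^ 3) := by linarith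
  have hr2' : (rectCost n x n : ℝ) ≤ 16 * (κ * (n : ℝ) ^ 3) := by
    have : (n : ℝ) * x * n = n * n * x := by ring
    rw [this] at hr2
    linarith
  have hl : (x : ℝ) * (9 + 8 * n + 4 * p.size) ≤ 34 * (n : ℝ) ^ 2 + 8 * (n * p.size) := by
    calc (x : ℝ) * (9 + 8 * n + 4 * p.size) ≤ 2 * n * (9 + 8 * n + 4 * p.size) := by gcongr
      _ ≤ _ := by nlinarith
  have h6 : (n : ℝ) ^ 3 ≤ κ * (n : ℝ) ^ 3 := le_mul_of_one_le_left (by positivity) hκ1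
  have h7 : adjoinConst ψ κ * (n : ℝ) ^ ψ ≤ adjoinConst ψ κ * (n : ℝ) ^ 3 := by gcongr
  push_cast
  nlinarith

end Estimates

/-! ### Estimates at one prime, and their sum over the prime factors. -/

section Total

variable {ψ κ : ℝ} {n : ℕ}

theorem ExponentBound.searchCost_le (hκ : ExponentBound ψ κ) (hn : 1 ≤ n) (p : ℕ) :
    (searchCost p n : ℝ) ≤ 3351 * (κ * (n : ℝ) ^ 2) + 1188 * p.size := by
  obtain ⟨h1, h2, -, -⟩ := hκ.natCast_pow_le hn
  have hκ1 := hκ.one_le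
  have r1 := hκ.rectCost_le_mul hn hn le_rfl
  have r2 := hκ.rectCost_le_mul le_rfl hn le_rfl
  have h3 : κ * (n : ℝ) ≤ κ * (n : ℝ) ^ 2 := by gcongr
  have h4 : (n : ℝ) ^ 2 ≤ κ * (n : ℝ) ^ 2 := le_mul_of_one_le_left (by positivity) hκ1
  rw [searchCost, sqrtCost]
  push_cast at r1 r2 ⊢
  linarith

theorem ExponentBound.subspaceCost_le (hκ : ExponentBound ψ κ) (hn : 1 ≤ n) (p : ℕ) :
    (subspaceCost p n : ℝ) ≤ 3436 * (κ * (n : ℝ) ^ 2) + 1196 * p.size := by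
  obtain ⟨h1, h2, -, -⟩ := hκ.natCast_pow_le hn
  have hκ1 := hκ.one_le
  have r1 := hκ.rectCost_le_mul hn hn le_rfl
  have r2 := hκ.rectCost_le_mul le_rfl hn hn
  have r3 := hκ.rectCost_le_mul hn le_rfl hn
  have h4 : (n : ℝ) ^ 2 ≤ κ * (n : ℝ) ^ 2 := le_mul_of_one_le_left (by positivity) hκ1
  have hs := hκ.searchCost_le hn p
  rw [subspaceCost]
  push_cast at r1 r2 r3 ⊢
  linarith

theorem ExponentBound.echelonCost_le (hκ : ExponentBound ψ κ) (hn : 1 ≤ n) (p : ℕ) :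
    (echelonCost p n : ℝ) ≤ 16 * (κ * (n : ℝ) ^ 3) + 4 * (n * p.size) := by
  obtain ⟨h1, h2, h3, h3'⟩ := hκ.natCast_pow_le hn
  have hκ1 := hκ.one_le
  have r3 := hκ.rectCost_le_mul hn le_rfl hn
  have h4 : (n : ℝ) ^ 3 ≤ κ * (n : ℝ) ^ 3 := le_mul_of_one_le_left (by positivity) hκ1
  have r : (n : ℝ) * rectCost n 1 n ≤ n * (8 * κ * (n * (1 : ℕ) * n)) := by gcongr
  rw [echelonCost]
  push_cast at r ⊢
  linarith

theorem ExponentBound.maximizeCost_le (hκ : ExponentBound ψ κ) (hn : 1 ≤ n) (p : ℕ)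
    (fs : List (ℕ × ℕ)) : (maximizeCost n p fs : ℝ) ≤
      (4 * adjoinConst ψ κ + 3800 * κ) * (n : ℝ) ^ 3 + 1300 * (n * p.size)
        + 2 * (n * cofactorCost fs) := by
  obtain ⟨h1, h2, h3, h3'⟩ := hκ.natCast_pow_le hn
  have hκ1 := hκ.one_le
  obtain ⟨h, hh, e⟩ := Finset.exists_mem_eq_sup (Finset.range (n + 1)) ⟨0, by simp⟩
    fun h => enlargeCost n h p 1
  have he := hκ.enlargeCost_le hn (Nat.lt_succ_iff.1 (Finset.mem_range.1 hh)) p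
  have r1 := hκ.rectCost_le_mul hn hn hn
  have r2 := hκ.rectCost_le_mul hn hn le_rfl
  have hi := hκ.inverseCost_le hn
  have hec := hκ.echelonCost_le hn p
  have hsub := hκ.subspaceCost_le hn p
  have h4 : (n : ℝ) ^ 3 ≤ κ * (n : ℝ) ^ 3 := le_mul_of_one_le_left (by positivity) hκ1
  have h5 : κ * (n : ℝ) ^ ψ ≤ κ * (n : ℝ) ^ 3 := by gcongr
  have hsub' : (n : ℝ) * subspaceCost p n ≤ n * (3436 * (κ * (n : ℝ) ^ 2) + 1196 * p.size) := by
    gcongr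
  have r2' : (n : ℝ) * rectCost n n 1 ≤ n * (8 * κ * (n * n * (1 : ℕ))) := by gcongr
  have hc : (cofactorCost fs : ℝ) ≤ n * cofactorCost fs :=
    le_mul_of_one_le_left (by positivity) h1
  have hp : (p.size : ℝ) ≤ n * p.size := le_mul_of_one_le_left (by positivity) h1
  rw [maximizeCost, e, liftCost]
  push_cast at r1 r2' ⊢
  nlinarith

theorem ExponentBound.evenCost_le (hκ : ExponentBound ψ κ) (hn : 1 ≤ n) :
    (evenCost n : ℝ) ≤ (4 * adjoinConst ψ κ + 400 * κ) * (n : ℝ) ^ 3 := by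
  obtain ⟨h1, h2, h3, h3'⟩ := hκ.natCast_pow_le hn
  have hκ1 := hκ.one_le
  have he := hκ.enlargeCost_le hn hn 2
  have r1 := hκ.rectCost_le_mul hn hn hn
  have r2 := hκ.rectCost_le_mul hn hn le_rfl
  have r3 := hκ.rectCost_le_mul le_rfl hn le_rfl
  have hec := hκ.echelonCost_le hn 2
  have h4 : (n : ℝ) ^ 3 ≤ κ * (n : ℝ) ^ 3 := le_mul_of_one_le_left (by positivity) hκ1
  have h5 : κ * (n : ℝ) ^ 2 ≤ κ * (n : ℝ) ^ 3 := by gcongr; linarith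
  have h6 : κ * (n : ℝ) ≤ κ * (n : ℝ) ^ 2 := by gcongr
  have hs : (2 : ℕ).size = 2 := by decide
  rw [hs] at he hec
  rw [evenCost]
  push_cast at he hec r1 r2 r3 ⊢
  nlinarith

theorem two_thirds_le_log_two : (2 / 3 : ℝ) ≤ Real.log 2 := by linarith [Real.log_two_gt_d9]

/-- The number of binary digits is at most `1 + log p / log 2`, and `log p ≥ log 2 ≥ 2/3` absorbs
the `1`. -/
theorem size_le_log {p : ℕ} (hp : 2 ≤ p) : (p.size : ℝ) ≤ 3 * Real.log p := by
  have h0 : 0 < p.size := Nat.size_pos.2 (by omega)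
  have h1 : 2 ^ (p.size - 1) ≤ p := Nat.lt_size.1 (by omega)
  have h2 : ((p.size - 1 : ℕ) : ℝ) * Real.log 2 ≤ Real.log p := by
    rw [← Real.log_pow]
    exact Real.log_le_log (by positivity) (by exact_mod_cast h1)
  have h3 : Real.log 2 ≤ Real.log p := Real.log_le_log (by norm_num) (by exact_mod_cast hp)
  rw [Nat.cast_sub (by omega), Nat.cast_one] at h2
  nlinarith [two_thirds_le_log_two]

theorem clog_le_log {m : ℕ} (hm : 1 ≤ m) : (Nat.clog 2 m : ℝ) ≤ 3 * Real.log m := by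
  rcases Nat.lt_or_ge m 2 with h | h
  · obtain rfl : m = 1 := by omega
    simp
  · have h0 : 0 < Nat.clog 2 m := Nat.clog_pos (by norm_num) h
    have h1 : 2 ^ (Nat.clog 2 m - 1) ≤ m := two_pow_le_of_lt_clog le_rfl (by omega)
    have h2 : ((Nat.clog 2 m - 1 : ℕ) : ℝ) * Real.log 2 ≤ Real.log m := by
      rw [← Real.log_pow]
      exact Real.log_le_log (by positivity) (by exact_mod_cast h1)
    have h3 : Real.log 2 ≤ Real.log m := Real.log_le_log (by norm_num) (by exact_mod_cast h)
    rw [Nat.cast_sub (by omega), Nat.cast_one] at h2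
    nlinarith [two_thirds_le_log_two]

theorem clog_le_self (m : ℕ) : Nat.clog 2 m ≤ m :=
  (Nat.clog_le_iff_le_pow (by norm_num)).2 Nat.lt_two_pow_self.le

variable {D : ℕ}

theorem cardFactors_eq_sum (D : ℕ) :
    ArithmeticFunction.cardFactors D = ∑ p ∈ D.primeFactors, padicValNat p D := by
  rw [ArithmeticFunction.cardFactors_eq_sum_factorization, Finsupp.sum, Nat.support_factorization]
  exact Finset.sum_congr rfl fun q hq => by
    rw [Nat.factorization_def _ (Nat.prime_of_mem_primeFactors hq)]

theorem cardDistinctFactors_eq_card (D : ℕ) :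
    ArithmeticFunction.cardDistinctFactors D = D.primeFactors.card := by
  rw [ArithmeticFunction.cardDistinctFactors_apply, primeFactors_eq_toFinset_dedup,
    List.toFinset_card_of_nodup (List.nodup_dedup _)]

theorem log_eq_sum (hD : D ≠ 0) :
    Real.log D = ∑ p ∈ D.primeFactors, (padicValNat p D : ℝ) * Real.log p := by
  conv_lhs => rw [← prod_primeFactors_pow hD]
  push_cast
  rw [Real.log_prod]
  · exact Finset.sum_congr rfl fun p _ => Real.log_pow _ _
  · intro p hp
    have := (Nat.prime_of_mem_primeFactors hp).ne_zero
    positivity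

theorem card_primeFactors_le (hD : D ≠ 0) :
    D.primeFactors.card ≤ ArithmeticFunction.cardFactors D := by
  rw [cardFactors_eq_sum, Finset.card_eq_sum_ones]
  exact Finset.sum_le_sum fun p hp => one_le_padicVal hD hp

/-- The cost is at most `1 + 2 ω + 2 Ω`, and `1 ≤ ω ≤ Ω`. -/
theorem cofactorCost_factorPairs_le (hD : 2 ≤ D) :
    cofactorCost (factorPairs D) ≤ 5 * ArithmeticFunction.cardFactors D := by
  have h1 : 1 ≤ D.primeFactors.card := Finset.card_pos.2 (Nat.nonempty_primeFactors.2 hD)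
  have h2 := card_primeFactors_le (D := D) (by omega)
  have h3 : ∑ p ∈ D.primeFactors, (2 + 2 * (padicValNat p D).size) ≤
      2 * D.primeFactors.card + 2 * ArithmeticFunction.cardFactors D := by
    rw [Finset.sum_add_distrib, ← Finset.mul_sum, cardFactors_eq_sum, Finset.sum_const,
      smul_eq_mul, mul_comm]
    gcongr with p hp
    exact size_le_self _
  rw [cofactorCost, sum_factorPairs]
  dsimp only
  omega

theorem sum_mul_size_le (hD : D ≠ 0) :
    ∑ p ∈ D.primeFactors, (padicValNat p D : ℝ) * p.size ≤ 3 * Real.log D := by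
  rw [log_eq_sum hD, Finset.mul_sum]
  refine Finset.sum_le_sum fun p hp => ?_
  have := size_le_log (Nat.prime_of_mem_primeFactors hp).two_le
  have h0 : (0 : ℝ) ≤ padicValNat p D := by positivity
  nlinarith

theorem cardFactors_le_log (hD : D ≠ 0) :
    (ArithmeticFunction.cardFactors D : ℝ) ≤ 2 * Real.log D := by
  rw [cardFactors_eq_sum, log_eq_sum hD, Finset.mul_sum]
  push_cast
  refine Finset.sum_le_sum fun p hp => ?_
  have h2 : Real.log 2 ≤ Real.log p := Real.log_le_log (by norm_num)
    (by exact_mod_cast (Nat.prime_of_mem_primeFactors hp).two_le)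
  have h0 : (0 : ℝ) ≤ padicValNat p D := by positivity
  nlinarith [two_thirds_le_log_two]

/-- The `12` is `4 * 3`: the adjoining constant in a saturation round, times the `3` from comparing
`Nat.clog` with the logarithm. The other two uses add `4 + 4` on the cubic term. The coefficient of
`κ` is generous; the large contributions are `3800` and `400` for cubic terms and `1300 * 3` for `n
log D`. -/
theorem ExponentBound.totalCost_le (hκ : ExponentBound ψ κ) (hn : 1 ≤ n) (hD : 2 ≤ D) :
    (totalCost n D : ℝ) ≤ (12 * adjoinConst ψ κ + 10000 * κ) *
      ((n : ℝ) ^ 3 * (ArithmeticFunction.cardDistinctFactors D : ℝ)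
        + (n : ℝ) ^ ψ * ∑ p ∈ D.primeFactors, Real.log (padicValNat p D)
        + (n : ℝ) ^ 2 * (ArithmeticFunction.cardFactors D : ℝ)
        + (n : ℝ) * (ArithmeticFunction.cardDistinctFactors D : ℝ)
          * (ArithmeticFunction.cardFactors D : ℝ) * Real.log D) := by
  obtain ⟨h1, h2, h3, h3'⟩ := hκ.natCast_pow_le hn
  have hκ1 := hκ.one_le
  have hK := hκ.adjoinConst_nonneg
  have hD0 : D ≠ 0 := by omega
  have hlog : (2 / 3 : ℝ) ≤ Real.log D :=
    two_thirds_le_log_two.trans (Real.log_le_log (by norm_num) (by exact_mod_cast hD))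
  have hcof : (cofactorCost (factorPairs D) : ℝ) ≤ 5 * ArithmeticFunction.cardFactors D := by
    exact_mod_cast cofactorCost_factorPairs_le hD
  have hΩl := cardFactors_le_log hD0
  have hsize := sum_mul_size_le hD0
  have hω : (1 : ℝ) ≤ ArithmeticFunction.cardDistinctFactors D := by
    rw [cardDistinctFactors_eq_card]
    exact_mod_cast Finset.card_pos.2 (Nat.nonempty_primeFactors.2 hD)
  have hωΩ : (ArithmeticFunction.cardDistinctFactors D : ℝ) ≤
      ArithmeticFunction.cardFactors D := by
    rw [cardDistinctFactors_eq_card]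
    exact_mod_cast card_primeFactors_le hD0
  have hclogΩ : ∑ p ∈ D.primeFactors, (Nat.clog 2 (padicValNat p D) : ℝ) ≤
      ArithmeticFunction.cardFactors D := by
    rw [cardFactors_eq_sum]
    push_cast
    exact Finset.sum_le_sum fun p _ => by exact_mod_cast clog_le_self _
  have hclog : ∑ p ∈ D.primeFactors, (Nat.clog 2 (padicValNat p D) : ℝ) ≤
      3 * ∑ p ∈ D.primeFactors, Real.log (padicValNat p D) := by
    rw [Finset.mul_sum]
    exact Finset.sum_le_sum fun p hp => clog_le_log (one_le_padicVal hD0 hp)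
  have hsize1 : ∑ p ∈ D.primeFactors, (p.size : ℝ) ≤ 3 * Real.log D := by
    refine le_trans (Finset.sum_le_sum fun p hp => ?_) hsize
    exact le_mul_of_one_le_left (by positivity) (by exact_mod_cast one_le_padicVal hD0 hp)
  have hS1 : ((∑ p ∈ D.primeFactors, (Nat.clog 2 (padicValNat p D) *
      saturateCost n (factorPairs D) + padicValNat p D * saturateStepCost n p) : ℕ) : ℝ) ≤
      (∑ p ∈ D.primeFactors, (Nat.clog 2 (padicValNat p D) : ℝ)) *
        ((4 * adjoinConst ψ κ + 238 * κ) * (n : ℝ) ^ ψ + cofactorCost (factorPairs D))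
      + (16 * (n : ℝ) ^ 2 * ArithmeticFunction.cardFactors D
        + 8 * n * ∑ p ∈ D.primeFactors, (padicValNat p D : ℝ) * p.size) := by
    rw [cardFactors_eq_sum]
    push_cast
    rw [Finset.sum_add_distrib]
    refine add_le_add ?_ ?_
    · rw [Finset.sum_mul]
      refine Finset.sum_le_sum fun p _ => ?_
      gcongr
      exact hκ.saturateCost_le hn _
    · rw [Finset.mul_sum, Finset.mul_sum, ← Finset.sum_add_distrib]
      refine Finset.sum_le_sum fun p _ => ?_
      have h : (saturateStepCost n p : ℝ) ≤ 16 * n ^ 2 + 8 * (n * p.size) := by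
        exact_mod_cast saturateStepCost_le hn p
      have h0 : (0 : ℝ) ≤ padicValNat p D := by positivity
      nlinarith
  have hS2 : ((∑ p ∈ D.primeFactors, maximizeCost n p (factorPairs D) : ℕ) : ℝ) ≤
      ((4 * adjoinConst ψ κ + 3800 * κ) * (n : ℝ) ^ 3 + 2 * (n * cofactorCost (factorPairs D)))
        * ArithmeticFunction.cardDistinctFactors D
        + 1300 * n * ∑ p ∈ D.primeFactors, (p.size : ℝ) := by
    rw [cardDistinctFactors_eq_card, Finset.card_eq_sum_ones]
    push_cast
    rw [Finset.mul_sum, Finset.mul_sum, ← Finset.sum_add_distrib]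
    refine Finset.sum_le_sum fun p _ => ?_
    linarith [hκ.maximizeCost_le hn p (factorPairs D)]
  have hS3 := hκ.evenCost_le hn
  rw [totalCost]
  push_cast only [Nat.cast_add] at hS1 hS2 ⊢
  have hcl0 : 0 ≤ ∑ p ∈ D.primeFactors, (Nat.clog 2 (padicValNat p D) : ℝ) := by positivity
  have hco0 : (0 : ℝ) ≤ cofactorCost (factorPairs D) := by positivity
  generalize ∑ p ∈ D.primeFactors, (Nat.clog 2 (padicValNat p D) : ℝ) = cl at *
  generalize ∑ p ∈ D.primeFactors, Real.log (padicValNat p D) = lg at *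
  generalize ∑ p ∈ D.primeFactors, (padicValNat p D : ℝ) * p.size = sz at *
  generalize ∑ p ∈ D.primeFactors, (p.size : ℝ) = sz1 at *
  generalize (cofactorCost (factorPairs D) : ℝ) = co at *
  generalize (ArithmeticFunction.cardFactors D : ℝ) = Ω at *
  generalize (ArithmeticFunction.cardDistinctFactors D : ℝ) = ω at *
  generalize Real.log D = L at *
  have hn3 : 0 ≤ (n : ℝ) ^ 3 := by positivity
  have hnψ : 0 ≤ (n : ℝ) ^ ψ := by positivity
  have hΩ : 1 ≤ Ω := hω.trans hωΩ
  have hlg : 0 ≤ lg := by linarith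
  have hΩ0 : 0 ≤ Ω := by linarith
  have hω0 : 0 ≤ ω := by linarith
  have hL0 : 0 ≤ L := by linarith
  have hκ0 : 0 ≤ κ := by linarith
  have hA : (n : ℝ) ^ 3 ≤ (n : ℝ) ^ 3 * ω := le_mul_of_one_le_right hn3 hω
  have hnω : 1 ≤ (n : ℝ) * ω := by nlinarith
  have hE1 : Ω * L ≤ n * ω * Ω * L := by
    have : 0 ≤ Ω * L := by positivity
    nlinarith
  have hE2 : n * L ≤ n * ω * Ω * L := by
    have h : 1 ≤ ω * Ω := by nlinarith
    have : 0 ≤ n * L := by positivity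
    nlinarith
  -- The `O(n)` cofactors at each prime go into the last term, as `log D ≥ 2/3`.
  have hE3 : 2 * (n * (Ω * ω)) ≤ 3 * (n * ω * Ω * L) := by
    have : 0 ≤ n * ω * Ω := by positivity
    nlinarith
  -- The cofactors of saturation number at most `Ω`, each of cost at most `5 Ω`; one factor `Ω` is
  -- at most `2 log D`.
  have hc1 : cl * co ≤ 10 * (Ω * L) := by
    calc cl * co ≤ Ω * (5 * Ω) := by gcongr
      _ ≤ Ω * (5 * (2 * L)) := by gcongr
      _ = _ := by ring
  have hc2 : cl * ((4 * adjoinConst ψ κ + 238 * κ) * (n : ℝ) ^ ψ) ≤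
      (3 * lg) * ((4 * adjoinConst ψ κ + 238 * κ) * (n : ℝ) ^ ψ) := by gcongr
  have hc3 : (n : ℝ) * sz ≤ n * (3 * L) := by gcongr
  have hc4 : (n : ℝ) * sz1 ≤ n * (3 * L) := by gcongr
  have hc5 : (n : ℝ) * co * ω ≤ n * (5 * Ω) * ω := by gcongr
  have hB : 0 ≤ (n : ℝ) ^ ψ * lg := by positivity
  have hC : 0 ≤ (n : ℝ) ^ 2 * Ω := by positivity
  have hE : 0 ≤ n * ω * Ω * L := by positivity
  have hA0 : 1 ≤ (n : ℝ) ^ 3 := by linarith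
  have hKA := mul_le_mul_of_nonneg_left hA hK
  have hκA := mul_le_mul_of_nonneg_left hA (by linarith : 0 ≤ κ)
  have k1 : (n : ℝ) ^ 3 * ω ≤ κ * ((n : ℝ) ^ 3 * ω) := le_mul_of_one_le_left (by linarith) hκ1
  have k2 : (n : ℝ) ^ 2 * Ω ≤ κ * ((n : ℝ) ^ 2 * Ω) := le_mul_of_one_le_left hC hκ1
  have k3 : n * ω * Ω * L ≤ κ * (n * ω * Ω * L) := le_mul_of_one_le_left hE hκ1
  have k4 : 0 ≤ adjoinConst ψ κ * ((n : ℝ) ^ 3 * ω) := mul_nonneg hK (by linarith)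
  have k5 : 0 ≤ adjoinConst ψ κ * ((n : ℝ) ^ 2 * Ω) := mul_nonneg hK hC
  have k6 : 0 ≤ adjoinConst ψ κ * (n * ω * Ω * L) := mul_nonneg hK hE
  have k7 : 0 ≤ κ * ((n : ℝ) ^ ψ * lg) := mul_nonneg (by linarith) hB
  rw [Nat.cast_ofNat]
  linarith

end Total

end MaxLat

theorem mainTheorem9 (ψ : ℝ) (hψ₂ : 2 < ψ) (hψ₃ : ψ ≤ 3) (hψ : MaxLat.IsMatMulExponent ψ) :
    ∃ C : ℝ, 0 < C ∧
      ∀ (n D : ℕ) (G : Matrix (Fin n) (Fin n) ℤ), G.IsSymm → D = G.det.natAbs → 2 ≤ D →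
        (MaxLat.maximalOverlattice (MaxLat.factorPairs D)
            (G.map (Int.cast : ℤ → ℚ))).expectedTime ≤
          ENNReal.ofReal (C *
            ((n : ℝ) ^ 3 * (ArithmeticFunction.cardDistinctFactors D : ℝ)
              + (n : ℝ) ^ ψ * ∑ p ∈ D.primeFactors, Real.log (padicValNat p D)
              + (n : ℝ) ^ 2 * (ArithmeticFunction.cardFactors D : ℝ)
              + (n : ℝ) * (ArithmeticFunction.cardDistinctFactors D : ℝ)
                * (ArithmeticFunction.cardFactors D : ℝ) * Real.log D)) := by
  obtain ⟨κ, hκ⟩ := MaxLat.IsMatMulExponent.exists_bound hψ hψ₂ hψ₃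
  refine ⟨12 * MaxLat.adjoinConst ψ κ + 10000 * κ, ?_, fun n D G hG hD hD2 => ?_⟩
  · linarith [hκ.adjoinConst_nonneg, hκ.one_le]
  -- The empty matrix has determinant `1`, so rank `0` is excluded by `2 ≤ D`.
  have hn : 1 ≤ n := by
    rcases Nat.eq_zero_or_pos n with rfl | h
    · rw [Matrix.det_isEmpty] at hD
      simp only [Int.natAbs_one] at hD
      omega
    · exact h
  calc _ ≤ ((MaxLat.totalCost n D : ℕ) : ℝ≥0∞) :=
        (MaxLat.runs_maximalOverlattice G hG hD hD2).expectedTime_le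
    _ = ENNReal.ofReal (MaxLat.totalCost n D) := (ENNReal.ofReal_natCast _).symm
    _ ≤ _ := ENNReal.ofReal_le_ofReal (hκ.totalCost_le hn hD2)
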